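/- Let $\Gamma$ be a finite group, $R(\Gamma)$ the space of complex class functions on $\Gamma$, $R_{\mathbb Z}(\Gamma)\subset R(\Gamma)$ the lattice of virtual characters, and $\xi\in R_{\mathbb Z}(\Gamma)$ self-dual, i.e. $\xi(x^{-1})=\xi(x)$. Put $\langle f,g\rangle_\xi=\frac1{|\Gamma|}\sum_{x\in\Gamma}\xi(x)f(x)g(x^{-1})$. For $n\ge 0$ let $\Pi_n$ be the group generated by $a_1,\dots,a_n$ and a central element $z$ with $a_i^2=z$, $z^2=1$, $a_ia_j=za_ja_i$ ($i\ne j$), and let $\widetilde\Gamma_n=(\Gamma^n\times\Pi_n)\rtimes S_n$, with $S_n$ permuting the factors of $\Gamma^n$ and the $a_i$; grade it by $p(a_i)=1$, $p=0$ on $\Gamma^n$ and $S_n$. Let $R^-(\widetilde\Gamma_n)$ be the space of class functions $f$ on $\widetilde\Gamma_n$ with $f(zx)=-f(x)$ which vanish on odd elements, and let $R^-=\bigoplus_{n\ge0}R^-(\widetilde\Gamma_n)$. For $\gamma\in R(\Gamma)$ let $\eta_n(\gamma)(g,s)$ be the product of the values of $\gamma$ at the cycle products of $(g,s)\in\Gamma^n\rtimes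 S_n$ over all cycles of $s$ (for the character $\gamma$ of a module $V$ this is the character of $V^{\otimes n}$), and let $\chi_n(\gamma)=\eta_n(\gamma)\chi_n$, where $\chi_n$ is the character of $\Pi_n\rtimes S_n$ on the Clifford algebra with generators $e_1,\dots,e_n$, $e_ie_j+e_je_i=-2\delta_{ij}$, on which $z$ acts as $-1$, $a_i$ as left multiplication by $e_i$, and $s\in S_n$ as the automorphism $e_i\mapsto e_{s(i)}$. On $R^-(\widetilde\Gamma_n)$ put $\langle f,g\rangle_\xi=|\widetilde\Gamma_n|^{-1}\sum_x\eta_n(\xi)(x)f(x)g(x^{-1})$. Let $\widetilde\Gamma_n\hat\times\widetilde\Gamma_m\subset\widetilde\Gamma_{n+m}$ be the subgroup of products $xy$ of elements $x$ of $\widetilde\Gamma_n$ (first $n$ positions) and $y$ of $\widetilde\Gamma_m$ (last $m$ positions). Define the operators on $R^-$ $$H_{-n}(\gamma)f=\mathrm{Ind}_{\widetilde\Gamma_n\hat\times\widetilde\Gamma_m}^{\widetilde\Gamma_{n+m}}(\chi_n(\gamma)\otimes f)\quad (f\in R^-(\widetilde\Gamma_m)),$$ where $(\chi_n(\gamma)\otimes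 f)(xy)=\chi_n(\gamma)(x)f(y)$, and $$(H_n(\gamma)F)(y)=\langle \chi_n(\gamma),F(\,\cdot\; y)\rangle_\xi\quad (F\in R^-(\widetilde\Gamma_{n+k}),\ y\in\widetilde\Gamma_k),$$ with $H_n(\gamma)=0$ on $R^-(\widetilde\Gamma_m)$ for $m<n$, and set $H_+(\gamma,z)=\sum_{n\ge0}H_{-n}(\gamma)z^n$, $H_-(\gamma,z)=\sum_{n\ge0}H_n(\gamma)z^{-n}$. For $\alpha,\beta\in R_{\mathbb Z}(\Gamma)$ let $\bar\alpha=\alpha+2R_{\mathbb Z}(\Gamma)$ and $c_1(\bar\alpha,\bar\beta)=\langle\alpha,\beta\rangle_\xi+\langle\alpha,\alpha\rangle_\xi\langle\beta,\beta\rangle_\xi \bmod 2$. Let $\hat R$ be a central extension of $R_{\mathbb Z}(\Gamma)/2R_{\mathbb Z}(\Gamma)$ by $\langle\pm1\rangle$ with commutator map $(-1)^{c_1}$, let $\Phi\supseteq 2R_{\mathbb Z}(\Gamma)$ be a subgroup of $R_{\mathbb Z}(\Gamma)$ maximal subject to $c_1$ vanishing on $\Phi/2R_{\mathbb Z}(\Gamma)$,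 and fix an irreducible $\hat R$-module structure on $\mathbb C[R_{\mathbb Z}(\Gamma)/\Phi]$ in which $-1$ acts as $-1$ and elements $e_{\bar\alpha}\in\hat R$ above $\bar\alpha$ act by $e_{\bar\alpha}e^{[\beta]}=\epsilon(\alpha,\beta)e^{[\alpha+\beta]}$ with $\epsilon(\alpha,\beta)\in\{\pm1\}$, normalized by $\epsilon(\alpha,0)=1$. On $R^-\otimes\mathbb C[R_{\mathbb Z}(\Gamma)/\Phi]$ define $$X(\alpha,z)=H_+(\alpha,z)H_-(\alpha,-z)e_{\bar\alpha},$$ $$:X(\alpha,z)X(\beta,w):\;=H_+(\alpha,z)H_+(\beta,w)H_-(\alpha,-z)H_-(\beta,-w)e_{\bar\alpha+\bar\beta}.$$ Then for all $\alpha,\beta\in R_{\mathbb Z}(\Gamma)$ $$X(\alpha,z)X(\beta,w)=\epsilon(\alpha,\beta)\,:X(\alpha,z)X(\beta,w):\,\Bigl(\frac{z-w}{z+w}\Bigr)^{\langle\alpha,\beta\rangle_\xi},$$ an identity of formal series in $z^{\pm1},w^{\pm1}$ with operator coefficients, where the last factor is expanded in powers of $w/z$; each coefficient of the right-hand side is a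 locally finite sum of operators. -/

import Mathlib

open scoped TensorProduct DirectSum

noncomputable section

namespace SpinWreath

open Equiv (Perm)

/-! ### The groups `Π_n` and `Γ^n ⋊ (Π_n ⋊ S_n)` -/

/-- The group `Π_n` generated by `a_1, …, a_n` and a central `z` subject to `a_i ^ 2 = z`,
`z ^ 2 = 1` and `a_i a_j = z a_j a_i` for `i ≠ j`. The element with components `c = sgn` and
`I = supp` is the normal form `z ^ c a_1 ^ (I 1) ⋯ a_n ^ (I n)`. -/
@[ext] structure PiGrp (n : ℕ) where
  sgn : ZMod 2
  supp : Fin n → ZMod 2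

namespace PiGrp

variable {n : ℕ}

/-- `Π_n` as a set is `ℤ/2 × (ℤ/2)^n`. -/
def equivProd (n : ℕ) : PiGrp n ≃ ZMod 2 × (Fin n → ZMod 2) where
  toFun x := (x.sgn, x.supp)
  invFun x := ⟨x.1, x.2⟩
  left_inv _ := rfl
  right_inv _ := rfl

instance : Fintype (PiGrp n) := Fintype.ofEquiv _ (equivProd n).symm

/-- The exponent of `z` in `a_I a_J = z ^ (cocycle I J) a_{I+J}`: moving every `a_j` to its place
costs a `z` for each `a_i` with `i > j` that it passes, and another one for `a_j ^ 2 = z`. -/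
def cocycle (I J : Fin n → ZMod 2) : ZMod 2 :=
  ∑ i, ∑ j, if j ≤ i then I i * J j else 0

theorem cocycle_add_left (I I' J : Fin n → ZMod 2) :
    cocycle (I + I') J = cocycle I J + cocycle I' J := by
  simp only [cocycle, ← Finset.sum_add_distrib]
  refine Finset.sum_congr rfl fun i _ => Finset.sum_congr rfl fun j _ => ?_
  split_ifs <;> simp [add_mul]

theorem cocycle_add_right (I J J' : Fin n → ZMod 2) :
    cocycle I (J + J') = cocycle I J + cocycle I J' := by
  simp only [cocycle, ← Finset.sum_add_distrib]
  refine Finset.sum_congr rfl fun i _ => Finset.sum_congr rfl fun j _ => ?_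
  split_ifs <;> simp [mul_add]

theorem cocycle_zero_left (J : Fin n → ZMod 2) : cocycle 0 J = 0 := by simp [cocycle]

theorem cocycle_zero_right (J : Fin n → ZMod 2) : cocycle J 0 = 0 := by simp [cocycle]

instance : Mul (PiGrp n) := ⟨fun x y => ⟨x.sgn + y.sgn + cocycle x.supp y.supp, x.supp + y.supp⟩⟩
instance : One (PiGrp n) := ⟨⟨0, 0⟩⟩
instance : Inv (PiGrp n) := ⟨fun x => ⟨x.sgn + cocycle x.supp x.supp, x.supp⟩⟩

@[simp] theorem mul_sgn (x y : PiGrp n) :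
    (x * y).sgn = x.sgn + y.sgn + cocycle x.supp y.supp := rfl
@[simp] theorem mul_supp (x y : PiGrp n) : (x * y).supp = x.supp + y.supp := rfl
@[simp] theorem one_sgn : (1 : PiGrp n).sgn = 0 := rfl
@[simp] theorem one_supp : (1 : PiGrp n).supp = 0 := rfl
@[simp] theorem inv_supp (x : PiGrp n) : (x⁻¹).supp = x.supp := rfl
@[simp] theorem inv_sgn (x : PiGrp n) : (x⁻¹).sgn = x.sgn + cocycle x.supp x.supp := rfl

instance : Group (PiGrp n) :=
  Group.ofLeftAxioms
    (fun x y w => by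
      ext
      · simp only [mul_sgn, mul_supp, cocycle_add_left, cocycle_add_right]; ring
      · simp [add_assoc])
    (fun x => by ext <;> simp [cocycle_zero_left])
    (fun x => by
      ext
      · simp only [mul_sgn, inv_sgn, inv_supp, one_sgn]
        generalize cocycle x.supp x.supp = b
        generalize x.sgn = a
        revert a b; decide
      · simp only [mul_supp, inv_supp, one_supp, Pi.add_apply, Pi.zero_apply]
        exact CharTwo.add_self_eq_zero _)

/-- The central element `z`. -/
def z : PiGrp n := ⟨1, 0⟩

/-- The generator `a_i`. -/
def a (i : Fin n) : PiGrp n := ⟨0, Pi.single i 1⟩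

theorem cocycle_single (i j : Fin n) :
    cocycle (Pi.single i 1) (Pi.single j 1) = if j ≤ i then 1 else 0 := by
  unfold cocycle
  rw [Finset.sum_eq_single i, Finset.sum_eq_single j]
  · simp
  · intro b _ hb; simp [hb]
  · simp
  · intro b _ hb; simp [hb]
  · simp

theorem z_sq : (z : PiGrp n) ^ 2 = 1 := by
  rw [pow_two]
  refine PiGrp.ext ?_ ?_
  · simp [z, cocycle_zero_left]; decide
  · simp [z]

theorem a_sq (i : Fin n) : a i ^ 2 = z := by
  rw [pow_two]
  refine PiGrp.ext ?_ ?_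
  · simp [z, a, cocycle_single]
  · simp only [mul_supp, z]; funext k; exact CharTwo.add_self_eq_zero _

theorem a_mul_a {i j : Fin n} (h : i ≠ j) : a i * a j = z * (a j * a i) := by
  refine PiGrp.ext ?_ ?_
  · simp only [mul_sgn, mul_supp, a, z, cocycle_single, cocycle_zero_left]
    rcases lt_or_gt_of_ne h with h | h
    · simp [h.le, not_le.2 h]; decide
    · simp [h.le, not_le.2 h]
  · simp [a, z, add_comm]

/-- The exponent of `z` that arises when `a_{s(i_1)} ⋯ a_{s(i_k)}` (for `i_1 < ⋯ < i_k` the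
elements of `I`) is put in order: the number of inversions of `s` in `I`. -/
def inversions (s : Perm (Fin n)) (I : Fin n → ZMod 2) : ZMod 2 :=
  ∑ i, ∑ j, if i < j ∧ s j < s i then I i * I j else 0

theorem cocycle_perm (s : Perm (Fin n)) (I J : Fin n → ZMod 2) :
    cocycle (fun i => I (s⁻¹ i)) (fun i => J (s⁻¹ i)) =
      ∑ i, ∑ j, if s j ≤ s i then I i * J j else 0 := by
  unfold cocycle
  rw [← Equiv.sum_comp s]
  refine Finset.sum_congr rfl fun i _ => ?_
  rw [← Equiv.sum_comp s]
  simp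

theorem inversions_add (s : Perm (Fin n)) (I J : Fin n → ZMod 2) :
    inversions s (I + J) = inversions s I + inversions s J +
      (cocycle (fun i => I (s⁻¹ i)) (fun i => J (s⁻¹ i)) + cocycle I J) := by
  have h : inversions s (I + J) = inversions s I + inversions s J +
      ((∑ i, ∑ j, if i < j ∧ s j < s i then I i * J j else 0) +
        ∑ i, ∑ j, if j < i ∧ s i < s j then I i * J j else 0) := by
    rw [Finset.sum_comm (f := fun i j => if j < i ∧ s i < s j then I i * J j else 0)]
    simp only [inversions, ← Finset.sum_add_distrib]
    refine Finset.sum_congr rfl fun i _ => Finset.sum_congr rfl fun j _ => ?_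
    split_ifs
    · simp; ring
    · simp
  rw [h, cocycle_perm]
  congr 1
  simp only [cocycle, ← Finset.sum_add_distrib]
  refine Finset.sum_congr rfl fun i _ => Finset.sum_congr rfl fun j _ => ?_
  generalize I i * J j = t
  rcases lt_trichotomy i j with h1 | h1 | h1
  · rcases lt_or_gt_of_ne (s.injective.ne h1.ne) with h2 | h2
    · simp [h1, h2.not_gt, h1.not_gt, not_le.2 h1, not_le.2 h2]
    · simp [h1, h2, h2.le, h2.not_gt, h1.not_gt, not_le.2 h1]
  · subst h1; simp; exact (CharTwo.add_self_eq_zero t).symm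
  · rcases lt_or_gt_of_ne (s.injective.ne h1.ne) with h2 | h2
    · simp [h1, h1.le, h2.le, h2.not_gt, h1.not_gt]; exact (CharTwo.add_self_eq_zero t).symm
    · simp [h1, h1.le, h2, h2.not_gt, h1.not_gt, not_le.2 h2]

theorem inversions_mul (s t : Perm (Fin n)) (I : Fin n → ZMod 2) :
    inversions (s * t) I = inversions t I + inversions s (fun i => I (t⁻¹ i)) := by
  have h : inversions s (fun i => I (t⁻¹ i)) =
      (∑ i, ∑ j, if i < j ∧ t i < t j ∧ s (t j) < s (t i) then I i * I j else 0) +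
      ∑ i, ∑ j, if i < j ∧ t j < t i ∧ s (t i) < s (t j) then I i * I j else 0 := by
    rw [Finset.sum_comm
      (f := fun i j => if i < j ∧ t j < t i ∧ s (t i) < s (t j) then I i * I j else 0)]
    simp only [inversions, ← Finset.sum_add_distrib]
    rw [← Equiv.sum_comp t]
    refine Finset.sum_congr rfl fun i _ => ?_
    rw [← Equiv.sum_comp t]
    refine Finset.sum_congr rfl fun j _ => ?_
    simp only [Equiv.Perm.inv_def, Equiv.symm_apply_apply]
    rw [mul_comm (I j)]
    generalize I i * I j = u
    rcases lt_trichotomy i j with h1 | h1 | h1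
    · simp [h1, h1.not_gt]
    · subst h1; simp
    · simp [h1, h1.not_gt]
  rw [h]
  simp only [inversions, ← Finset.sum_add_distrib]
  refine Finset.sum_congr rfl fun i _ => Finset.sum_congr rfl fun j _ => ?_
  generalize I i * I j = u
  by_cases h1 : i < j
  · rcases lt_or_gt_of_ne (t.injective.ne h1.ne) with h2 | h2 <;>
      rcases lt_or_gt_of_ne (s.injective.ne (t.injective.ne h1.ne)) with h3 | h3
    · simp [h1, h2, h2.not_gt, h3, h3.not_gt]
    · simp [h1, h2, h2.not_gt, h3, h3.not_gt]
    · simp [h1, h2, h2.not_gt, h3, h3.not_gt]; exact (CharTwo.add_self_eq_zero u).symm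
    · simp [h1, h2, h2.not_gt, h3, h3.not_gt]
  · simp [h1]

/-- The action of `S_n` on `Π_n` by automorphisms with `s(a_i) = a_{s(i)}` and `s(z) = z`. -/
def permFun (s : Perm (Fin n)) (x : PiGrp n) : PiGrp n :=
  ⟨x.sgn + inversions s x.supp, fun i => x.supp (s⁻¹ i)⟩

theorem inversions_one (I : Fin n → ZMod 2) : inversions 1 I = 0 := by
  unfold inversions
  refine Finset.sum_eq_zero fun i _ => Finset.sum_eq_zero fun j _ => ?_
  rw [if_neg]
  rintro ⟨h1, h2⟩
  exact absurd h1 h2.not_gt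

theorem permFun_one (x : PiGrp n) : permFun 1 x = x := by
  refine PiGrp.ext ?_ rfl
  simp [permFun, inversions_one]

theorem permFun_permFun (s t : Perm (Fin n)) (x : PiGrp n) :
    permFun (s * t) x = permFun s (permFun t x) := by
  refine PiGrp.ext ?_ ?_
  · simp [permFun, inversions_mul, add_assoc]
  · funext i; simp [permFun, mul_inv_rev]

theorem permFun_mul (s : Perm (Fin n)) (x y : PiGrp n) :
    permFun s (x * y) = permFun s x * permFun s y := by
  refine PiGrp.ext ?_ rfl
  simp only [permFun, mul_sgn, mul_supp, inversions_add]
  generalize cocycle x.supp y.supp = b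
  have : b + b = 0 := CharTwo.add_self_eq_zero b
  linear_combination this

theorem inversions_single (s : Perm (Fin n)) (i : Fin n) : inversions s (Pi.single i 1) = 0 := by
  unfold inversions
  refine Finset.sum_eq_zero fun k _ => Finset.sum_eq_zero fun j _ => ?_
  rw [ite_eq_right_iff]
  rintro ⟨h1, -⟩
  by_cases hk : k = i
  · subst hk; simp [h1.ne']
  · simp [hk]

theorem permFun_a (s : Perm (Fin n)) (i : Fin n) : permFun s (a i) = a (s i) := by
  refine PiGrp.ext ?_ ?_
  · simp [permFun, a, inversions_single]
  · funext j
    simp only [permFun, a, Pi.single_apply, Equiv.Perm.inv_eq_iff_eq]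

theorem permFun_z (s : Perm (Fin n)) : permFun s z = z := by
  refine PiGrp.ext ?_ rfl
  simp [permFun, z, inversions]

end PiGrp

/-- The action of `S_n` on `Γ^n × Π_n` by simultaneous permutations. -/
def permAct (Γ : Type*) [Group Γ] (n : ℕ) : Perm (Fin n) →* MulAut ((Fin n → Γ) × PiGrp n) where
  toFun s :=
    { toFun := fun x => (fun i => x.1 (s⁻¹ i), PiGrp.permFun s x.2)
      invFun := fun x => (fun i => x.1 (s i), PiGrp.permFun s⁻¹ x.2)
      left_inv := fun x => by
        ext : 1
        · simp
        · simp [← PiGrp.permFun_permFun, PiGrp.permFun_one]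
      right_inv := fun x => by
        ext : 1
        · simp
        · simp [← PiGrp.permFun_permFun, PiGrp.permFun_one]
      map_mul' := fun x y => by
        ext : 1
        · rfl
        · exact PiGrp.permFun_mul s x.2 y.2 }
  map_one' := by
    ext x : 2
    · rfl
    · exact PiGrp.permFun_one x.2
  map_mul' s t := by
    ext x : 2
    · rfl
    · exact PiGrp.permFun_permFun s t x.2

/-- The group `Γ̃_n = Γ^n ⋊ (Π_n ⋊ S_n) = (Γ^n × Π_n) ⋊ S_n`, a double cover of the wreath
product `(Γ × ℤ/2)^n ⋊ S_n`. -/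
abbrev BG (Γ : Type*) [Group Γ] (n : ℕ) : Type _ :=
  ((Fin n → Γ) × PiGrp n) ⋊[permAct Γ n] Perm (Fin n)

variable {Γ : Type*} [Group Γ]

instance (n : ℕ) [Fintype Γ] : Fintype (BG Γ n) :=
  Fintype.ofEquiv _ SemidirectProduct.equivProd.symm

namespace BG

variable {n : ℕ}

/-- The central element `z`. -/
def z : BG Γ n := ⟨(1, PiGrp.z), 1⟩

/-- The parity `p` with `p(a_i) = 1` and `p = 0` on `Γ^n`, on `S_n` and at `z`. -/
def parity (x : BG Γ n) : ZMod 2 := ∑ i, x.left.2.supp i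

@[simp] theorem mul_left_fst (x y : BG Γ n) :
    (x * y).left.1 = x.left.1 * fun i => y.left.1 (x.right⁻¹ i) := rfl
@[simp] theorem mul_left_snd (x y : BG Γ n) :
    (x * y).left.2 = x.left.2 * PiGrp.permFun x.right y.left.2 := rfl
@[simp] theorem z_left_fst : (z : BG Γ n).left.1 = 1 := rfl
@[simp] theorem z_left_snd : (z : BG Γ n).left.2 = PiGrp.z := rfl
@[simp] theorem z_right : (z : BG Γ n).right = 1 := rfl

theorem ext' {x y : BG Γ n} (h1 : x.left.1 = y.left.1) (h2 : x.left.2 = y.left.2)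
    (h3 : x.right = y.right) : x = y :=
  SemidirectProduct.ext (Prod.ext h1 h2) h3

theorem z_mul_left_snd (x : BG Γ n) : (z * x).left.2 = ⟨x.left.2.sgn + 1, x.left.2.supp⟩ := by
  refine PiGrp.ext ?_ ?_
  · simp [PiGrp.z, PiGrp.cocycle_zero_left, add_comm]
  · simp [PiGrp.z]

theorem z_mul_left_fst (x : BG Γ n) : (z * x).left.1 = x.left.1 := by
  simp [z]

theorem z_mul_right (x : BG Γ n) : (z * x).right = x.right := by simp

theorem mul_z (x : BG Γ n) : x * z = z * x := by
  refine ext' ?_ ?_ ?_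
  · rw [mul_left_fst, z_mul_left_fst]; funext i; simp
  · rw [z_mul_left_snd, mul_left_snd, z_left_snd, PiGrp.permFun_z]
    refine PiGrp.ext ?_ ?_
    · simp [PiGrp.z, PiGrp.cocycle_zero_right]
    · simp [PiGrp.z]
  · simp

theorem z_mul_z : (z : BG Γ n) * z = 1 := by
  refine ext' ?_ ?_ ?_
  · funext i; simp
  · rw [z_mul_left_snd]; refine PiGrp.ext ?_ rfl; exact CharTwo.add_self_eq_zero (1 : ZMod 2)
  · simp

theorem parity_mul (x y : BG Γ n) : parity (x * y) = parity x + parity y := by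
  simp only [parity, mul_left_snd, PiGrp.mul_supp, Pi.add_apply, Finset.sum_add_distrib,
    PiGrp.permFun]
  congr 1
  exact Equiv.sum_comp x.right⁻¹ y.left.2.supp

@[simp] theorem parity_one : parity (1 : BG Γ n) = 0 := by simp [parity]

theorem parity_inv (x : BG Γ n) : parity x⁻¹ = parity x := by
  have h := parity_mul x x⁻¹
  rw [mul_inv_cancel, parity_one] at h
  generalize parity x⁻¹ = a at *
  generalize parity x = b at *
  revert a b; decide

theorem parity_conj (t x : BG Γ n) : parity (t * x * t⁻¹) = parity x := by
  rw [parity_mul, parity_mul, parity_inv, add_comm, ← add_assoc, CharTwo.add_self_eq_zero, zero_add]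

@[simp] theorem parity_z : parity (z : BG Γ n) = 0 := by simp [parity, PiGrp.z]

end BG

/-! ### Induction along order embeddings of the index sets and the spin product subgroup -/

section Embedding

variable {n N : ℕ} (f : Fin n ↪o Fin N)

theorem extend_notMem {A : Type*} (I : Fin n → A) (J : Fin N → A) {i : Fin N}
    (hi : i ∉ Set.range f) : Function.extend f I J i = J i :=
  Function.extend_apply' _ _ _ hi

theorem extend_mem {A : Type*} (I : Fin n → A) (J : Fin N → A) (i : Fin n) :
    Function.extend f I J (f i) = I i :=
  f.injective.extend_apply _ _ _

theorem sum_extend {A : Type*} [AddCommMonoid A] (F : Fin N → A)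
    (hF : ∀ i, i ∉ Set.range f → F i = 0) : ∑ i, F i = ∑ i, F (f i) := by
  classical
  exact (Finset.sum_of_injOn f f.injective.injOn (by simp [Set.MapsTo])
    (by intro i _ hi; exact hF i (by simpa using hi)) (by simp)).symm

theorem extend_add_zero (I J : Fin n → ZMod 2) :
    Function.extend f (I + J) 0 = Function.extend f I 0 + Function.extend f J (0 : Fin N → ZMod 2) := by
  funext i
  by_cases hi : i ∈ Set.range f
  · obtain ⟨i, rfl⟩ := hi
    simp only [Pi.add_apply, extend_mem]
  · simp [extend_notMem f _ _ hi]

theorem cocycle_extend (I J : Fin n → ZMod 2) :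
    PiGrp.cocycle (Function.extend f I 0) (Function.extend f J (0 : Fin N → ZMod 2)) =
      PiGrp.cocycle I J := by
  unfold PiGrp.cocycle
  rw [sum_extend f]
  · refine Finset.sum_congr rfl fun i _ => ?_
    rw [sum_extend f]
    · simp only [extend_mem, f.le_iff_le]
    · intro j hj; simp [extend_notMem f _ _ hj]
  · intro i hi; simp [extend_notMem f _ _ hi]

theorem viaEmbedding_inv_apply (s : Perm (Fin n)) (i : Fin n) :
    (Equiv.Perm.viaEmbeddingHom f.toEmbedding s)⁻¹ (f i) = f (s⁻¹ i) := by
  rw [← map_inv]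
  exact Equiv.Perm.viaEmbedding_apply s⁻¹ f.toEmbedding i

theorem viaEmbedding_apply' (s : Perm (Fin n)) (i : Fin n) :
    (Equiv.Perm.viaEmbeddingHom f.toEmbedding s) (f i) = f (s i) :=
  Equiv.Perm.viaEmbedding_apply s f.toEmbedding i

theorem viaEmbedding_notMem (s : Perm (Fin n)) {i : Fin N} (hi : i ∉ Set.range f) :
    (Equiv.Perm.viaEmbeddingHom f.toEmbedding s) i = i :=
  Equiv.Perm.viaEmbedding_apply_of_notMem s f.toEmbedding i hi

theorem viaEmbedding_inv_notMem (s : Perm (Fin n)) {i : Fin N} (hi : i ∉ Set.range f) :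
    (Equiv.Perm.viaEmbeddingHom f.toEmbedding s)⁻¹ i = i := by
  rw [← map_inv]; exact viaEmbedding_notMem f _ hi

theorem inversions_extend (s : Perm (Fin n)) (I : Fin n → ZMod 2) :
    PiGrp.inversions (Equiv.Perm.viaEmbeddingHom f.toEmbedding s)
      (Function.extend f I (0 : Fin N → ZMod 2)) = PiGrp.inversions s I := by
  unfold PiGrp.inversions
  rw [sum_extend f]
  · refine Finset.sum_congr rfl fun i _ => ?_
    rw [sum_extend f]
    · simp only [extend_mem, f.lt_iff_lt, viaEmbedding_apply']
    · intro j hj; simp [extend_notMem f _ _ hj]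
  · intro i hi; simp [extend_notMem f _ _ hi]

theorem extend_perm {A : Type*} (s : Perm (Fin n)) (I : Fin n → A) (b : A) :
    Function.extend f (fun i => I (s⁻¹ i)) (fun _ => b) =
      fun i => Function.extend f I (fun _ => b)
        ((Equiv.Perm.viaEmbeddingHom f.toEmbedding s)⁻¹ i) := by
  funext i
  by_cases hi : i ∈ Set.range f
  · obtain ⟨i, rfl⟩ := hi
    rw [viaEmbedding_inv_apply, extend_mem, extend_mem]
  · rw [viaEmbedding_inv_notMem f s hi, extend_notMem f _ _ hi, extend_notMem f _ _ hi]

/-- The homomorphism `Γ^n × Π_n → Γ^N × Π_N` given by `a_i ↦ a_{f(i)}` and by placing the `i`-th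
factor of `Γ^n` at position `f(i)`. -/
def embedLeft (Γ : Type*) [Group Γ] : (Fin n → Γ) × PiGrp n →* (Fin N → Γ) × PiGrp N where
  toFun x := (Function.extend f x.1 1, ⟨x.2.sgn, Function.extend f x.2.supp 0⟩)
  map_one' := by
    refine Prod.ext ?_ (PiGrp.ext rfl ?_)
    · funext i
      by_cases hi : i ∈ Set.range f
      · obtain ⟨i, rfl⟩ := hi
        simp [extend_mem]
      · simp [extend_notMem f _ _ hi]
    · funext i
      by_cases hi : i ∈ Set.range f
      · obtain ⟨i, rfl⟩ := hi
        simp [extend_mem]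
      · simp [extend_notMem f _ _ hi]
  map_mul' x y := by
    refine Prod.ext ?_ (PiGrp.ext ?_ ?_)
    · funext i
      by_cases hi : i ∈ Set.range f
      · obtain ⟨i, rfl⟩ := hi
        simp [extend_mem]
      · simp [extend_notMem f _ _ hi]
    · simp [cocycle_extend]
    · exact extend_add_zero f _ _

/-- The homomorphism `Γ̃_n → Γ̃_N` induced by an order embedding `f` of the index sets: it places
the factors of `Γ^n` at the positions `f(i)`, sends `a_i` to `a_{f(i)}`, and lets `S_n` permute
the positions `f(i)`. -/
def embed : BG Γ n →* BG Γ N :=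
  SemidirectProduct.map (embedLeft f Γ) (Equiv.Perm.viaEmbeddingHom f.toEmbedding) fun s => by
    ext x : 1
    refine Prod.ext ?_ (PiGrp.ext ?_ ?_)
    · exact extend_perm f s x.1 1
    · change x.2.sgn + _ = x.2.sgn + _
      congr 1
      exact (inversions_extend f s x.2.supp).symm
    · exact extend_perm f s x.2.supp 0

theorem embed_left_fst (x : BG Γ n) : (embed f x).left.1 = Function.extend f x.left.1 1 := rfl
theorem embed_left_snd (x : BG Γ n) :
    (embed f x).left.2 = ⟨x.left.2.sgn, Function.extend f x.left.2.supp 0⟩ := rfl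
theorem embed_right (x : BG Γ n) :
    (embed f x).right = Equiv.Perm.viaEmbeddingHom f.toEmbedding x.right := rfl

theorem extend_zero : Function.extend f (0 : Fin n → ZMod 2) (0 : Fin N → ZMod 2) = 0 := by
  funext i
  by_cases hi : i ∈ Set.range f
  · obtain ⟨i, rfl⟩ := hi
    simp [extend_mem]
  · simp [extend_notMem f _ _ hi]

theorem extend_one : Function.extend f (1 : Fin n → Γ) (1 : Fin N → Γ) = 1 := by
  funext i
  by_cases hi : i ∈ Set.range f
  · obtain ⟨i, rfl⟩ := hi
    simp [extend_mem]
  · simp [extend_notMem f _ _ hi]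

theorem embed_z : embed f (BG.z : BG Γ n) = BG.z := by
  refine BG.ext' ?_ ?_ ?_
  · rw [embed_left_fst]; exact extend_one f
  · rw [embed_left_snd]; exact PiGrp.ext rfl (extend_zero f)
  · rw [embed_right, BG.z_right, map_one, BG.z_right]

theorem parity_embed (x : BG Γ n) : BG.parity (embed f x) = BG.parity x := by
  have h := sum_extend (A := ZMod 2) f (Function.extend f x.left.2.supp (0 : Fin N → ZMod 2)) fun i hi => extend_notMem f _ _ hi
  simp only [extend_mem] at h
  exact h

end Embedding

section SpinProduct

variable {n m : ℕ}

/-- The embedding of `Γ̃_n` on the first `n` of `n + m` positions. -/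
def inL (n m : ℕ) : BG Γ n →* BG Γ (n + m) := embed (Fin.castAddOrderEmb m)

/-- The embedding of `Γ̃_m` on the last `m` of `n + m` positions. -/
def inR (n m : ℕ) : BG Γ m →* BG Γ (n + m) := embed (Fin.natAddOrderEmb n)

theorem notMem_left (i : Fin n) :
    Fin.castAddOrderEmb m i ∉ Set.range (Fin.natAddOrderEmb n (m := m)) := by
  rintro ⟨j, hj⟩
  have := congrArg Fin.val hj
  simp at this
  omega

theorem notMem_right (i : Fin m) :
    Fin.natAddOrderEmb n i ∉ Set.range (Fin.castAddOrderEmb (n := n) m) := by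
  rintro ⟨j, hj⟩
  have := congrArg Fin.val hj
  simp at this
  omega

theorem block_cases {P : Fin (n + m) → Prop} (hl : ∀ i, P (Fin.castAddOrderEmb m i))
    (hr : ∀ i, P (Fin.natAddOrderEmb n i)) (i : Fin (n + m)) : P i :=
  Fin.addCases hl hr i

theorem cocycle_left_right (I : Fin n → ZMod 2) (J : Fin m → ZMod 2) :
    PiGrp.cocycle (Function.extend (Fin.castAddOrderEmb m) I 0)
      (Function.extend (Fin.natAddOrderEmb n) J (0 : Fin (n + m) → ZMod 2)) = 0 := by
  unfold PiGrp.cocycle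
  rw [sum_extend (Fin.castAddOrderEmb m)]
  · refine Finset.sum_eq_zero fun i _ => ?_
    rw [sum_extend (Fin.natAddOrderEmb n)]
    · refine Finset.sum_eq_zero fun j _ => if_neg ?_
      rw [not_le, Fin.lt_def]
      simp
      omega
    · intro j hj; simp [extend_notMem _ _ _ hj]
  · intro i hi; simp [extend_notMem _ _ _ hi]

theorem cocycle_right_left (I : Fin n → ZMod 2) (J : Fin m → ZMod 2) :
    PiGrp.cocycle (Function.extend (Fin.natAddOrderEmb n) J 0)
      (Function.extend (Fin.castAddOrderEmb m) I (0 : Fin (n + m) → ZMod 2)) =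
      (∑ i, I i) * ∑ j, J j := by
  unfold PiGrp.cocycle
  rw [mul_comm, Finset.sum_mul_sum, sum_extend (Fin.natAddOrderEmb n)]
  · refine Finset.sum_congr rfl fun j _ => ?_
    rw [sum_extend (Fin.castAddOrderEmb m)]
    · refine Finset.sum_congr rfl fun i _ => ?_
      rw [if_pos, extend_mem, extend_mem]
      rw [Fin.le_def]
      simp
      omega
    · intro j hj; simp [extend_notMem _ _ _ hj]
  · intro i hi; simp [extend_notMem _ _ _ hi]

theorem inR_right_left (y : BG Γ m) (i : Fin n) :
    (inR n m y).right⁻¹ (Fin.castAddOrderEmb m i) = Fin.castAddOrderEmb m i :=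
  viaEmbedding_inv_notMem (Fin.natAddOrderEmb n) _ (notMem_left i)

theorem inL_right_right (x : BG Γ n) (i : Fin m) :
    (inL n m x).right⁻¹ (Fin.natAddOrderEmb n i) = Fin.natAddOrderEmb n i :=
  viaEmbedding_inv_notMem (Fin.castAddOrderEmb m) _ (notMem_right i)

theorem inversions_eq_zero {N : ℕ} (s : Perm (Fin N)) (I : Fin N → ZMod 2)
    (h : ∀ i, I i ≠ 0 → s i = i) : PiGrp.inversions s I = 0 := by
  unfold PiGrp.inversions
  refine Finset.sum_eq_zero fun i _ => Finset.sum_eq_zero fun j _ => ?_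
  rw [ite_eq_right_iff]
  rintro ⟨h1, h2⟩
  by_contra hne
  rw [h i (left_ne_zero_of_mul hne), h j (right_ne_zero_of_mul hne)] at h2
  exact absurd h1 h2.not_gt

theorem permFun_inR_inL (x : BG Γ n) (y : BG Γ m) :
    PiGrp.permFun (inR n m y).right (inL n m x).left.2 = (inL n m x).left.2 := by
  refine PiGrp.ext ?_ ?_
  · change _ + PiGrp.inversions _ _ = _
    rw [inversions_eq_zero, add_zero]
    refine block_cases (fun i _ => ?_) fun i hi => ?_
    · exact viaEmbedding_notMem (Fin.natAddOrderEmb n) _ (notMem_left i)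
    · exact absurd (extend_notMem (Fin.castAddOrderEmb m) _ _ (notMem_right i)) hi
  · funext i
    revert i
    refine block_cases (fun i => ?_) fun i => ?_
    · exact congrArg (inL n m x).left.2.supp (inR_right_left y i)
    · change (inL n m x).left.2.supp ((inR n m y).right⁻¹ (Fin.natAddOrderEmb n i)) = _
      rw [inR, embed_right, viaEmbedding_inv_apply, inL, embed_left_snd]
      have h (j : Fin m) := extend_notMem (Fin.castAddOrderEmb m) x.left.2.supp 0 (notMem_right j)
      exact (h _).trans (h i).symm

theorem permFun_inL_inR (x : BG Γ n) (y : BG Γ m) :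
    PiGrp.permFun (inL n m x).right (inR n m y).left.2 = (inR n m y).left.2 := by
  refine PiGrp.ext ?_ ?_
  · change _ + PiGrp.inversions _ _ = _
    rw [inversions_eq_zero, add_zero]
    refine block_cases (fun i hi => ?_) fun i _ => ?_
    · exact absurd (extend_notMem (Fin.natAddOrderEmb n) _ _ (notMem_left i)) hi
    · exact viaEmbedding_notMem (Fin.castAddOrderEmb m) _ (notMem_right i)
  · funext i
    revert i
    refine block_cases (fun i => ?_) fun i => ?_
    · change (inR n m y).left.2.supp ((inL n m x).right⁻¹ (Fin.castAddOrderEmb m i)) = _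
      rw [inL, embed_right, viaEmbedding_inv_apply, inR, embed_left_snd]
      have h (j : Fin n) := extend_notMem (Fin.natAddOrderEmb n) y.left.2.supp 0 (notMem_left j)
      exact (h _).trans (h i).symm
    · exact congrArg (inR n m y).left.2.supp (inL_right_right x i)

/-- The central element `z ^ c`. -/
def BG.zc {n : ℕ} (c : ZMod 2) : BG Γ n := ⟨(1, ⟨c, 0⟩), 1⟩

theorem BG.zc_mul_left_fst {n : ℕ} (c : ZMod 2) (x : BG Γ n) : (zc c * x).left.1 = x.left.1 := by
  simp [zc]

theorem BG.zc_mul_left_snd {n : ℕ} (c : ZMod 2) (x : BG Γ n) :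
    (zc c * x).left.2 = ⟨x.left.2.sgn + c, x.left.2.supp⟩ := by
  refine PiGrp.ext ?_ ?_
  · simp [zc, PiGrp.cocycle_zero_left, add_comm]
  · simp [zc]

theorem BG.zc_mul_right {n : ℕ} (c : ZMod 2) (x : BG Γ n) : (zc c * x).right = x.right := by
  simp [zc]

theorem BG.zc_zero {n : ℕ} : zc 0 = (1 : BG Γ n) := rfl

theorem BG.zc_one {n : ℕ} : zc 1 = (z : BG Γ n) := rfl

theorem zc_cases {P : ZMod 2 → Prop} (h0 : P 0) (h1 : P 1) (c : ZMod 2) : P c := by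
  fin_cases c
  exacts [h0, h1]

theorem inL_zc (c : ZMod 2) : inL n m (BG.zc c : BG Γ n) = BG.zc c :=
  zc_cases (P := fun c => inL n m (BG.zc c : BG Γ n) = BG.zc c) (map_one _) (embed_z _) c

theorem inR_zc (c : ZMod 2) : inR n m (BG.zc c : BG Γ m) = BG.zc c :=
  zc_cases (P := fun c => inR n m (BG.zc c : BG Γ m) = BG.zc c) (map_one _) (embed_z _) c

theorem mul_left_fst_left (x : BG Γ n) (y : BG Γ m) (i : Fin n) :
    (inL n m x * inR n m y).left.1 (Fin.castAddOrderEmb m i) = x.left.1 i := by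
  rw [BG.mul_left_fst, Pi.mul_apply]
  simp only [inL, inR, embed_left_fst, embed_right, viaEmbedding_inv_apply, extend_mem]
  rw [extend_notMem _ _ _ (notMem_left _)]
  exact mul_one _

theorem mul_left_fst_right (x : BG Γ n) (y : BG Γ m) (i : Fin m) :
    (inL n m x * inR n m y).left.1 (Fin.natAddOrderEmb n i) = y.left.1 i := by
  rw [BG.mul_left_fst, Pi.mul_apply, inL_right_right]
  simp only [inL, inR, embed_left_fst, extend_mem]
  rw [extend_notMem _ _ _ (notMem_right _)]
  exact one_mul _

theorem mul_sgn_block (x : BG Γ n) (y : BG Γ m) :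
    (inL n m x * inR n m y).left.2.sgn = x.left.2.sgn + y.left.2.sgn := by
  rw [BG.mul_left_snd, permFun_inL_inR]
  exact (congrArg _ (cocycle_left_right _ _)).trans (add_zero _)

theorem mul_supp_left (x : BG Γ n) (y : BG Γ m) (i : Fin n) :
    (inL n m x * inR n m y).left.2.supp (Fin.castAddOrderEmb m i) = x.left.2.supp i := by
  rw [BG.mul_left_snd, permFun_inL_inR, PiGrp.mul_supp, Pi.add_apply]
  simp only [inL, inR, embed_left_snd, extend_mem]
  rw [extend_notMem _ _ _ (notMem_left _)]
  exact add_zero _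

theorem mul_supp_right (x : BG Γ n) (y : BG Γ m) (i : Fin m) :
    (inL n m x * inR n m y).left.2.supp (Fin.natAddOrderEmb n i) = y.left.2.supp i := by
  rw [BG.mul_left_snd, permFun_inL_inR, PiGrp.mul_supp, Pi.add_apply]
  simp only [inL, inR, embed_left_snd, extend_mem]
  rw [extend_notMem _ _ _ (notMem_right _)]
  exact zero_add _

theorem mul_perm_left (x : BG Γ n) (y : BG Γ m) (i : Fin n) :
    (inL n m x * inR n m y).right (Fin.castAddOrderEmb m i) =
      Fin.castAddOrderEmb m (x.right i) := by
  change (inL n m x).right ((inR n m y).right _) = _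
  simp only [inL, inR, embed_right]
  rw [viaEmbedding_notMem _ _ (notMem_left i), viaEmbedding_apply']

theorem mul_perm_right (x : BG Γ n) (y : BG Γ m) (i : Fin m) :
    (inL n m x * inR n m y).right (Fin.natAddOrderEmb n i) =
      Fin.natAddOrderEmb n (y.right i) := by
  change (inL n m x).right ((inR n m y).right _) = _
  simp only [inL, inR, embed_right]
  rw [viaEmbedding_apply', viaEmbedding_notMem _ _ (notMem_right _)]

/-- Elements of the two blocks commute up to sign: `y x = z ^ (p(x) p(y)) x y`. -/
theorem inR_mul_inL (x : BG Γ n) (y : BG Γ m) :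
    inR n m y * inL n m x = BG.zc (BG.parity x * BG.parity y) * (inL n m x * inR n m y) := by
  refine BG.ext' ?_ ?_ ?_
  · rw [BG.zc_mul_left_fst]
    funext i
    revert i
    refine block_cases (fun i => ?_) fun i => ?_
    · rw [mul_left_fst_left, BG.mul_left_fst, Pi.mul_apply, inR_right_left]
      simp only [inL, inR, embed_left_fst, extend_mem]
      rw [extend_notMem _ _ _ (notMem_left _)]
      exact one_mul _
    · rw [mul_left_fst_right, BG.mul_left_fst, Pi.mul_apply]
      simp only [inL, inR, embed_left_fst, embed_right, viaEmbedding_inv_apply, extend_mem]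
      rw [extend_notMem _ _ _ (notMem_right _)]
      exact mul_one _
  · rw [BG.zc_mul_left_snd]
    refine PiGrp.ext ?_ ?_
    · change _ = (inL n m x * inR n m y).left.2.sgn + _
      rw [mul_sgn_block, BG.mul_left_snd, permFun_inR_inL]
      have h := cocycle_right_left x.left.2.supp y.left.2.supp
      change y.left.2.sgn + x.left.2.sgn + _ = _
      rw [add_comm y.left.2.sgn]
      exact congrArg (x.left.2.sgn + y.left.2.sgn + ·) h
    · change _ = (inL n m x * inR n m y).left.2.supp
      rw [BG.mul_left_snd, BG.mul_left_snd, permFun_inR_inL, permFun_inL_inR, PiGrp.mul_supp,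
        PiGrp.mul_supp]
      exact add_comm _ _
  · rw [BG.zc_mul_right]
    refine Equiv.ext fun i => ?_
    revert i
    refine block_cases (fun i => ?_) fun i => ?_
    · rw [mul_perm_left]
      change (inR n m y).right ((inL n m x).right _) = _
      simp only [inL, inR, embed_right]
      rw [viaEmbedding_apply', viaEmbedding_notMem _ _ (notMem_left _)]
    · rw [mul_perm_right]
      change (inR n m y).right ((inL n m x).right _) = _
      simp only [inL, inR, embed_right]
      rw [viaEmbedding_notMem _ _ (notMem_right i), viaEmbedding_apply']

/-- The pair of factors is determined up to a simultaneous multiplication by a power of `z`. -/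
theorem block_unique {x x' : BG Γ n} {y y' : BG Γ m}
    (h : inL n m x * inR n m y = inL n m x' * inR n m y') :
    ∃ c, x' = BG.zc c * x ∧ y' = BG.zc c * y := by
  have hs := congrArg (fun u => u.left.2.sgn) h
  simp only [mul_sgn_block] at hs
  refine ⟨x'.left.2.sgn - x.left.2.sgn, ?_, ?_⟩
  · refine BG.ext' ?_ ?_ ?_
    · rw [BG.zc_mul_left_fst]
      funext i
      rw [← mul_left_fst_left x' y', ← mul_left_fst_left x y, h]
    · rw [BG.zc_mul_left_snd]
      refine PiGrp.ext ?_ ?_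
      · simp
      · funext i
        rw [← mul_supp_left x' y', h.symm, mul_supp_left]
    · rw [BG.zc_mul_right]
      refine Equiv.ext fun i => ?_
      apply (Fin.castAddOrderEmb m).injective
      rw [← mul_perm_left x' y', ← mul_perm_left x y, h]
  · refine BG.ext' ?_ ?_ ?_
    · rw [BG.zc_mul_left_fst]
      funext i
      rw [← mul_left_fst_right x' y', ← mul_left_fst_right x y, h]
    · rw [BG.zc_mul_left_snd]
      refine PiGrp.ext ?_ ?_
      · change _ = y.left.2.sgn + (x'.left.2.sgn - x.left.2.sgn)
        revert hs
        generalize x.left.2.sgn = a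
        generalize y.left.2.sgn = b
        generalize x'.left.2.sgn = c
        generalize y'.left.2.sgn = d
        revert a b c d; decide
      · funext i
        rw [← mul_supp_right x' y', h.symm, mul_supp_right]
    · rw [BG.zc_mul_right]
      refine Equiv.ext fun i => ?_
      apply (Fin.natAddOrderEmb n).injective
      rw [← mul_perm_right x' y', ← mul_perm_right x y, h]

theorem BG.zc_comm {n : ℕ} (c : ZMod 2) (x : BG Γ n) : x * zc c = zc c * x :=
  zc_cases (P := fun c => x * zc c = zc c * x) (by simp [zc_zero]) (mul_z x) c

/-- The spin product of `Γ̃_n` and `Γ̃_m` as a subgroup of `Γ̃_{n+m}`. The map `(x, y) ↦ x y` on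
pairs identifies it with the set `Γ̃_n × Γ̃_m` with the multiplication
`(t, t') (s, s') = (t s, z ^ (p(t') p(s)) t' s')`, modulo `{(1, 1), (z, z)}`. -/
def spinProd (Γ : Type*) [Group Γ] (n m : ℕ) : Subgroup (BG Γ (n + m)) where
  carrier := {u | ∃ (x : BG Γ n) (y : BG Γ m), inL n m x * inR n m y = u}
  one_mem' := ⟨1, 1, by simp⟩
  mul_mem' := by
    rintro _ _ ⟨x, y, rfl⟩ ⟨x', y', rfl⟩
    refine ⟨x * (BG.zc (BG.parity x' * BG.parity y) * x'), y * y', ?_⟩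
    calc inL n m (x * (BG.zc (BG.parity x' * BG.parity y) * x')) * inR n m (y * y')
        = inL n m x * (BG.zc (BG.parity x' * BG.parity y) * (inL n m x' * inR n m y)) *
            inR n m y' := by simp only [map_mul, inL_zc, mul_assoc]
      _ = _ := by rw [← inR_mul_inL]; simp only [mul_assoc]
  inv_mem' := by
    rintro _ ⟨x, y, rfl⟩
    refine ⟨BG.zc (BG.parity x⁻¹ * BG.parity y⁻¹) * x⁻¹, y⁻¹, ?_⟩
    rw [map_mul, inL_zc, mul_assoc, ← inR_mul_inL, mul_inv_rev, map_inv, map_inv]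

end SpinProduct

/-! ### Class functions, induction and restriction -/

section ClassFunctions

variable (Γ) in
/-- `R(Γ)`: the complex class functions on `Γ`. -/
def ClassFun : Submodule ℂ (Γ → ℂ) where
  carrier := {f | ∀ t x, f (t * x * t⁻¹) = f x}
  add_mem' hf hg t x := by simp [hf t x, hg t x]
  zero_mem' _ _ := rfl
  smul_mem' c f hf t x := by simp [hf t x]

variable (Γ) in
/-- `R^-(Γ̃_n)`: the spin super class functions on `Γ̃_n`, i.e. the class functions `f` with
`f(zx) = -f(x)` that vanish on odd elements. -/
def Rm (n : ℕ) : Submodule ℂ (BG Γ n → ℂ) where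
  carrier := {f | (∀ t x, f (t * x * t⁻¹) = f x) ∧ (∀ x, f (BG.z * x) = -f x) ∧
    ∀ x, BG.parity x = 1 → f x = 0}
  add_mem' := by
    rintro f g ⟨h1, h2, h3⟩ ⟨k1, k2, k3⟩
    refine ⟨fun t x => ?_, fun x => ?_, fun x hx => ?_⟩
    · simp [h1 t x, k1 t x]
    · simp [h2 x, k2 x, add_comm]
    · simp [h3 x hx, k3 x hx]
  zero_mem' := ⟨fun _ _ => rfl, fun _ => by simp, fun _ _ => rfl⟩
  smul_mem' := by
    rintro c f ⟨h1, h2, h3⟩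
    refine ⟨fun t x => ?_, fun x => ?_, fun x hx => ?_⟩
    · simp [h1 t x]
    · simp [h2 x]
    · simp [h3 x hx]

/-- The function on `G` induced from the class function `f` on the subgroup `H`. -/
def ind {G : Type*} [Group G] [Fintype G] (H : Subgroup G) (f : H → ℂ) (u : G) : ℂ :=
  open Classical in
  (Nat.card H : ℂ)⁻¹ * ∑ t : G, if h : t⁻¹ * u * t ∈ H then f ⟨t⁻¹ * u * t, h⟩ else 0

variable {n m : ℕ}

/-- A pair `(x, y)` with product the given element of the spin product. -/
def factors (h : spinProd Γ n m) : BG Γ n × BG Γ m :=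
  (⟨(h.2.choose, h.2.choose_spec.choose), h.2.choose_spec.choose_spec⟩ :
    ∃ p : BG Γ n × BG Γ m, inL n m p.1 * inR n m p.2 = h).choose

theorem factors_spec (h : spinProd Γ n m) :
    inL n m (factors h).1 * inR n m (factors h).2 = h :=
  (⟨(h.2.choose, h.2.choose_spec.choose), h.2.choose_spec.choose_spec⟩ :
    ∃ p : BG Γ n × BG Γ m, inL n m p.1 * inR n m p.2 = h).choose_spec

/-- The outer tensor product of `f` and `g`: the function `x y ↦ f(x) g(y)` on the spin product of
`Γ̃_n` and `Γ̃_m`. It does not depend on the choice of `x` and `y` for spin functions `f`, `g`. -/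
def outer (f : BG Γ n → ℂ) (g : BG Γ m → ℂ) (h : spinProd Γ n m) : ℂ :=
  f (factors h).1 * g (factors h).2

theorem spin_zc {f : BG Γ n → ℂ} (hf : ∀ x, f (BG.z * x) = -f x) (c : ZMod 2) (x : BG Γ n) :
    f (BG.zc c * x) = (-1) ^ c.val * f x :=
  zc_cases (P := fun c => f (BG.zc c * x) = (-1) ^ c.val * f x) (by simp [BG.zc_zero])
    (by simp [BG.zc_one, hf, ZMod.val_one]) c

theorem neg_one_pow_val_mul (c : ZMod 2) : ((-1 : ℂ) ^ c.val) * (-1) ^ c.val = 1 :=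
  zc_cases (P := fun c => ((-1 : ℂ) ^ c.val) * (-1) ^ c.val = 1) (by simp) (by simp [ZMod.val_one]) c

theorem outer_eq {f : BG Γ n → ℂ} {g : BG Γ m → ℂ} (hf : ∀ x, f (BG.z * x) = -f x)
    (hg : ∀ x, g (BG.z * x) = -g x) (h : spinProd Γ n m) {x : BG Γ n} {y : BG Γ m}
    (hxy : inL n m x * inR n m y = h) : outer f g h = f x * g y := by
  obtain ⟨c, hc1, hc2⟩ := block_unique (hxy.trans (factors_spec h).symm)
  unfold outer
  rw [hc1, hc2, spin_zc hf, spin_zc hg, mul_mul_mul_comm, neg_one_pow_val_mul, one_mul]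

variable [Fintype Γ]

theorem ind_outer_mem (f : Rm Γ n) (g : Rm Γ m) :
    ind (spinProd Γ n m) (outer f.1 g.1) ∈ Rm Γ (n + m) := by
  classical
  refine ⟨fun s u => ?_, fun u => ?_, fun u hu => ?_⟩
  · unfold ind
    congr 1
    rw [← Equiv.sum_comp (Equiv.mulLeft s)]
    refine Finset.sum_congr rfl fun t _ => ?_
    have : (s * t)⁻¹ * (s * u * s⁻¹) * (s * t) = t⁻¹ * u * t := by group
    simp only [Equiv.coe_mulLeft, this]
  · unfold ind
    rw [← mul_neg, ← Finset.sum_neg_distrib]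
    congr 1
    refine Finset.sum_congr rfl fun t _ => ?_
    have ht : t⁻¹ * (BG.z * u) * t = BG.z * (t⁻¹ * u * t) := by
      rw [← mul_assoc t⁻¹, BG.mul_z]; simp only [mul_assoc]
    have hz : BG.z ∈ spinProd Γ n m := ⟨BG.z, 1, by rw [map_one, mul_one]; exact embed_z _⟩
    by_cases h : t⁻¹ * u * t ∈ spinProd Γ n m
    · have h' : t⁻¹ * (BG.z * u) * t ∈ spinProd Γ n m := by rw [ht]; exact mul_mem hz h
      rw [dif_pos h, dif_pos h']
      obtain ⟨x, y, hxy⟩ := id h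
      rw [outer_eq f.2.2.1 g.2.2.1 ⟨_, h⟩ hxy, outer_eq f.2.2.1 g.2.2.1 ⟨_, h'⟩ (x := BG.z * x) (y := y) ?_,
        f.2.2.1, neg_mul]
      change _ = t⁻¹ * (BG.z * u) * t
      rw [map_mul, ht, ← hxy, mul_assoc]
      congr 1
      exact embed_z _
    · have h' : t⁻¹ * (BG.z * u) * t ∉ spinProd Γ n m := by
        rw [ht]; exact fun h' => h ((Subgroup.mul_mem_cancel_left _ hz).1 h')
      rw [dif_neg h, dif_neg h', neg_zero]
  · unfold ind
    rw [Finset.sum_eq_zero, mul_zero]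
    intro t _
    split_ifs with h
    · obtain ⟨x, y, hxy⟩ := h
      rw [outer_eq f.2.2.1 g.2.2.1 _ hxy]
      have hp : BG.parity x + BG.parity y = 1 := by
        rw [← hu, ← BG.parity_conj t⁻¹ u, inv_inv, ← hxy, BG.parity_mul]
        exact congrArg₂ _ (parity_embed _ _).symm (parity_embed _ _).symm
      by_cases hx : BG.parity x = 1
      · rw [f.2.2.2 x hx, zero_mul]
      · rw [g.2.2.2 y, mul_zero]
        revert hp hx
        generalize BG.parity x = a
        generalize BG.parity y = b
        revert a b; decide
    · rfl

/-- The map `R^-(Γ̃_m) → R^-(Γ̃_{n+m})` given by the outer tensor product with `f` followed by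
induction from the spin product. -/
def indMul (f : Rm Γ n) (m : ℕ) : Rm Γ m →ₗ[ℂ] Rm Γ (n + m) where
  toFun g := ⟨ind (spinProd Γ n m) (outer f.1 g.1), ind_outer_mem f g⟩
  map_add' g g' := by
    classical
    ext u
    simp only [ind, outer, Submodule.coe_add, Pi.add_apply, ← mul_add, ← Finset.sum_add_distrib]
    congr 1
    refine Finset.sum_congr rfl fun t _ => ?_
    split_ifs
    · ring
    · simp
  map_smul' c g := by
    classical
    ext u
    simp only [ind, outer, Submodule.coe_smul, Pi.smul_apply, smul_eq_mul, RingHom.id_apply]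
    rw [mul_left_comm]
    congr 1
    rw [Finset.mul_sum]
    refine Finset.sum_congr rfl fun t _ => ?_
    split_ifs
    · ring
    · simp

end ClassFunctions

/-! ### The characters `η_n(γ)` and `χ_n(γ)` -/

section Characters

variable {n : ℕ}

/-- The cycle product `g_i g_{s⁻¹(i)} g_{s⁻²(i)} ⋯` of `x = (g, a, s)` along the cycle of `s`
through `i`; the number of factors is the length of the cycle. -/
def cycleProd (x : BG Γ n) (i : Fin n) : Γ :=
  ((List.range (Function.minimalPeriod x.right i)).map
    fun j => x.left.1 ((x.right⁻¹ ^ j) i)).prod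

theorem pow_right (x : BG Γ n) (k : ℕ) : (x ^ k).right = x.right ^ k :=
  map_pow (SemidirectProduct.rightHom) x k

theorem pow_left_fst (x : BG Γ n) (i : Fin n) (k : ℕ) :
    (x ^ k).left.1 i = ((List.range k).map fun j => x.left.1 ((x.right⁻¹ ^ j) i)).prod := by
  induction k with
  | zero => rfl
  | succ k ih =>
    rw [pow_succ, BG.mul_left_fst, Pi.mul_apply, ih, List.range_succ, List.map_append,
      List.prod_append, pow_right]
    simp

theorem cycleProd_eq (x : BG Γ n) (i : Fin n) :
    cycleProd x i = (x ^ Function.minimalPeriod x.right i).left.1 i :=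
  (pow_left_fst x i _).symm

theorem cycleProd_conj (t x : BG Γ n) (i : Fin n) :
    cycleProd (t * x * t⁻¹) (t.right i) =
      t.left.1 (t.right i) * cycleProd x i * (t.left.1 (t.right i))⁻¹ := by
  have hp (k : ℕ) : (((t * x * t⁻¹).right) ^ k) (t.right i) = t.right ((x.right ^ k) i) := by
    change ((t.right * x.right * t.right⁻¹) ^ k) (t.right i) = _
    rw [conj_pow]
    simp
  have hper : Function.minimalPeriod (t * x * t⁻¹).right (t.right i) =
      Function.minimalPeriod x.right i := by
    rw [Function.minimalPeriod_eq_minimalPeriod_iff]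
    intro k
    simp only [Function.IsPeriodicPt, Function.IsFixedPt, ← Equiv.Perm.coe_pow, hp,
      EmbeddingLike.apply_eq_iff_eq]
  rw [cycleProd_eq, cycleProd_eq, hper, conj_pow]
  set k := Function.minimalPeriod x.right i with hk
  have hfix : (x.right ^ k) i = i := by
    have := Function.isPeriodicPt_minimalPeriod x.right i
    rwa [← hk, Function.IsPeriodicPt, Function.IsFixedPt, ← Equiv.Perm.coe_pow] at this
  have hfix' : (x.right ^ k)⁻¹ i = i := by rw [Equiv.Perm.inv_eq_iff_eq, hfix]
  have hinv : t⁻¹.left.1 i = (t.left.1 (t.right i))⁻¹ := by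
    have h : (t * t⁻¹).left.1 (t.right i) = 1 := by rw [mul_inv_cancel]; rfl
    rw [BG.mul_left_fst, Pi.mul_apply] at h
    rw [mul_eq_one_iff_inv_eq.1 h]
    simp
  rw [BG.mul_left_fst, Pi.mul_apply, BG.mul_left_fst, Pi.mul_apply]
  have h1 : (t * x ^ k).right⁻¹ (t.right i) = i := by
    change (t.right * (x ^ k).right)⁻¹ (t.right i) = i
    rw [pow_right]
    simpa using hfix'
  rw [h1, hinv]
  simp

/-- `η_n(γ)`, pulled back to `Γ̃_n` along `(g, a, s) ↦ (g, s)`: the product of the values of `γ` at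
the cycle products of `(g, s)`, over all cycles of `s` (fixed points included). For the character
`γ` of a `Γ`-module `V` this is the character of the wreath product on `V^{⊗ n}`. -/
def eta (γ : ClassFun Γ) (x : BG Γ n) : ℂ :=
  ∏ᶠ c : Quotient (Equiv.Perm.SameCycle.setoid x.right), γ.1 (cycleProd x c.out)

theorem eta_conj (γ : ClassFun Γ) (t x : BG Γ n) : eta γ (t * x * t⁻¹) = eta γ x := by
  have key (t x : BG Γ n) (i : Fin n) :
      γ.1 (cycleProd (t * x * t⁻¹) (t.right i)) = γ.1 (cycleProd x i) := by
    rw [cycleProd_conj]; exact γ.2 _ _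
  have same (x : BG Γ n) {i j : Fin n} (h : Equiv.Perm.SameCycle x.right i j) :
      γ.1 (cycleProd x i) = γ.1 (cycleProd x j) := by
    obtain ⟨k, rfl⟩ := h
    have h1 : x ^ k * x * (x ^ k)⁻¹ = x := by group
    have h2 : (x ^ k).right = x.right ^ k := map_zpow SemidirectProduct.rightHom x k
    rw [← h2, ← key (x ^ k) x i, h1]
  let e : Quotient (Equiv.Perm.SameCycle.setoid x.right) ≃
      Quotient (Equiv.Perm.SameCycle.setoid (t * x * t⁻¹).right) :=
    Quotient.congr t.right fun i j => by
      change Equiv.Perm.SameCycle x.right i j ↔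
        Equiv.Perm.SameCycle (t.right * x.right * t.right⁻¹) (t.right i) (t.right j)
      rw [Equiv.Perm.sameCycle_conj]
      simp
  unfold eta
  rw [← finprod_comp_equiv e]
  refine finprod_congr fun c => ?_
  rw [← key t x c.out]
  apply same
  have h : e c = ⟦t.right c.out⟧ := by
    conv_lhs => rw [← Quotient.out_eq c]
    rfl
  rw [h]
  have h2 := Quotient.exact (Quotient.out_eq
    (Quotient.mk (Equiv.Perm.SameCycle.setoid (t * x * t⁻¹).right) (t.right c.out)))
  exact h2

theorem prod_matrix_apply {d : ℕ} {m : ℕ} (M : Fin (m + 1) → Matrix (Fin d) (Fin d) ℂ)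
    (a b : Fin d) : (List.ofFn M).prod a b = ∑ f : Fin m → Fin d,
      ∏ j : Fin (m + 1), M j (Fin.cons (α := fun _ => Fin d) a f j)
        (Fin.snoc (α := fun _ => Fin d) f b j) := by
  induction m generalizing a with
  | zero => simp [Fin.snoc]
  | succ m ih =>
    rw [List.ofFn_succ, List.prod_cons, Matrix.mul_apply,
      ← (Fin.consEquiv fun _ : Fin (m + 1) => Fin d).sum_comp, Fintype.sum_prod_type]
    refine Finset.sum_congr rfl fun c _ => ?_
    rw [ih, Finset.mul_sum]
    refine Finset.sum_congr rfl fun f _ => ?_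
    rw [Fin.prod_univ_succ (n := m + 1)]
    have hc : (Fin.consEquiv fun _ : Fin (m + 1) => Fin d) (c, f) =
      Fin.cons (α := fun _ => Fin d) c f := rfl
    simp only [hc, Fin.cons_zero, Fin.cons_succ, ← Fin.cons_snoc_eq_snoc_cons]

theorem trace_prod_eq {d k : ℕ} (hk : 0 < k) (M : ℕ → Matrix (Fin d) (Fin d) ℂ) :
    ((List.range k).map M).prod.trace = ∑ f : Fin k → Fin d,
      ∏ j : Fin k, M j (f j) (f ⟨(j + 1) % k, Nat.mod_lt _ hk⟩) := by
  obtain ⟨m, rfl⟩ : ∃ m, k = m + 1 := ⟨k - 1, by omega⟩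
  have h : (List.range (m + 1)).map M = List.ofFn fun j : Fin (m + 1) => M j := by
    rw [List.ofFn_eq_map, ← List.map_coe_finRange_eq_range, List.map_map]; rfl
  rw [h, Matrix.trace, ← (Fin.consEquiv fun _ : Fin (m + 1) => Fin d).sum_comp,
    Fintype.sum_prod_type]
  refine Finset.sum_congr rfl fun a _ => ?_
  rw [Matrix.diag_apply, prod_matrix_apply]
  refine Finset.sum_congr rfl fun f _ => Finset.prod_congr rfl fun j _ => ?_
  congr 1
  refine Fin.lastCases ?_ (fun j => ?_) j
  · rw [Fin.snoc_last]
    simp [Fin.consEquiv_apply]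
  · rw [Fin.snoc_castSucc]
    have : (⟨((j.castSucc : Fin (m + 1)) + 1) % (m + 1), Nat.mod_lt _ hk⟩ : Fin (m + 1)) =
        j.succ := by
      ext
      simp
    rw [this, Fin.consEquiv_apply]
    simp

/-- For the character `γ` of a matrix representation `ρ` on `V = ℂ^d`, `η_n(γ)` is the character of
`V^{⊗ n}`: in the basis `e_{f(1)} ⊗ ⋯ ⊗ e_{f(n)}` of the tensor power, the action
`(g, s)(v_1 ⊗ ⋯ ⊗ v_n) = g_1 v_{s⁻¹(1)} ⊗ ⋯ ⊗ g_n v_{s⁻¹(n)}` has the displayed matrix. -/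
theorem eta_character {d : ℕ} (ρ : Γ →* Matrix (Fin d) (Fin d) ℂ) (γ : ClassFun Γ)
    (hγ : ∀ g, γ.1 g = (ρ g).trace) (x : BG Γ n) :
    eta γ x = Matrix.trace (Matrix.of fun f f' : Fin n → Fin d =>
      ∏ i, ρ (x.left.1 i) (f i) (f' (x.right⁻¹ i))) := by
  classical
  set s := x.right with hs
  let C := Quotient (Equiv.Perm.SameCycle.setoid s)
  let k : C → ℕ := fun c => Function.minimalPeriod s c.out
  have hper (i : Fin n) : i ∈ Function.periodicPts s := by
    refine ⟨orderOf s, orderOf_pos s, ?_⟩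
    rw [Function.IsPeriodicPt, Function.IsFixedPt, ← Equiv.Perm.coe_pow, pow_orderOf_eq_one]
    rfl
  have hk (c : C) : 0 < k c := Function.minimalPeriod_pos_of_mem_periodicPts (hper _)
  have hpow (c : C) : (s ^ k c) c.out = c.out := by
    have := Function.isPeriodicPt_minimalPeriod s c.out
    rwa [Function.IsPeriodicPt, Function.IsFixedPt, ← Equiv.Perm.coe_pow] at this
  have hpow' (c : C) : (s⁻¹ ^ k c) c.out = c.out := by
    rw [inv_pow, Equiv.Perm.inv_eq_iff_eq, hpow]
  have hmod (c : C) (j : ℕ) : (s⁻¹ ^ (j % k c)) c.out = (s⁻¹ ^ j) c.out := by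
    conv_rhs => rw [← Nat.mod_add_div j (k c), pow_add, pow_mul]
    rw [Equiv.Perm.mul_apply]
    congr 1
    exact ((Function.IsFixedPt.iterate (f := (s⁻¹ ^ k c)) (hpow' c) (j / k c)).symm.trans
      (by rw [← Equiv.Perm.coe_pow]))
  let F : (Σ c : C, Fin (k c)) → Fin n := fun p => (s⁻¹ ^ (p.2 : ℕ)) p.1.out
  have hcls (c : C) (j : ℕ) : Quotient.mk (Equiv.Perm.SameCycle.setoid s) ((s⁻¹ ^ j) c.out) = c := by
    rw [← Quotient.out_eq c]
    refine Quotient.sound ?_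
    rw [Quotient.out_eq c]
    refine ⟨j, ?_⟩
    rw [zpow_natCast, ← Equiv.Perm.mul_apply, inv_pow, mul_inv_cancel]
    rfl
  have hF : Function.Bijective F := by
    constructor
    · rintro ⟨c, j⟩ ⟨c', j'⟩ h
      have hc : c = c' := by
        rw [← hcls c j, ← hcls c' j']; exact congrArg _ h
      subst hc
      congr 1
      have h2 := congrArg (fun i => (s ^ ((j : ℕ) + j')) i) h
      simp only [F] at h2
      rw [pow_add, Equiv.Perm.mul_apply, Equiv.Perm.mul_apply, ← Equiv.Perm.mul_apply (s ^ (j' : ℕ)) (s⁻¹ ^ (j' : ℕ)),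
        inv_pow s (j' : ℕ), mul_inv_cancel, ← Equiv.Perm.mul_apply (s ^ (j : ℕ)) (s ^ (j' : ℕ)), ← pow_add,
        add_comm (j : ℕ), pow_add, Equiv.Perm.mul_apply, ← Equiv.Perm.mul_apply (s ^ (j : ℕ)) (s⁻¹ ^ (j : ℕ)),
        inv_pow, mul_inv_cancel, Equiv.Perm.one_apply] at h2
      have h3 := Function.iterate_injOn_Iio_minimalPeriod (f := s) (x := c.out)
        (Set.mem_Iio.2 j'.2) (Set.mem_Iio.2 j.2) (by simpa [← Equiv.Perm.coe_pow] using h2)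
      exact Fin.ext h3.symm
    · intro i
      let c : C := Quotient.mk _ i
      have h : Equiv.Perm.SameCycle s i c.out :=
        (Quotient.exact (Quotient.out_eq c) : Equiv.Perm.SameCycle s c.out i).symm
      obtain ⟨j, -, hj⟩ := h.exists_pow_eq'
      refine ⟨⟨c, ⟨j % k c, Nat.mod_lt _ (hk c)⟩⟩, ?_⟩
      change (s⁻¹ ^ (j % k c)) c.out = i
      rw [hmod, ← hj, inv_pow, ← Equiv.Perm.mul_apply, inv_mul_cancel]
      rfl
  let e := Equiv.ofBijective F hF
  have hnext (c : C) (j : Fin (k c)) :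
      s⁻¹ (F ⟨c, j⟩) = F ⟨c, ⟨((j : ℕ) + 1) % k c, Nat.mod_lt _ (hk c)⟩⟩ := by
    change s⁻¹ ((s⁻¹ ^ (j : ℕ)) c.out) = (s⁻¹ ^ (((j : ℕ) + 1) % k c)) c.out
    rw [hmod, pow_succ', Equiv.Perm.mul_apply]
  let E : (Fin n → Fin d) ≃ ((c : C) → Fin (k c) → Fin d) :=
    (e.symm.arrowCongr (Equiv.refl _)).trans (Equiv.piCurry fun _ _ => Fin d)
  have hE (f : Fin n → Fin d) (c : C) (j : Fin (k c)) : E f c j = f (F ⟨c, j⟩) := rfl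
  unfold eta
  rw [finprod_eq_prod_of_fintype]
  have hterm (c : C) : γ.1 (cycleProd x c.out) = ∑ f : Fin (k c) → Fin d,
      ∏ j : Fin (k c), ρ (x.left.1 (F ⟨c, j⟩)) (f j)
        (f ⟨((j : ℕ) + 1) % k c, Nat.mod_lt _ (hk c)⟩) := by
    rw [hγ, ← trace_prod_eq (hk c) fun j => ρ (x.left.1 ((s⁻¹ ^ j) c.out))]
    unfold cycleProd
    rw [map_list_prod, List.map_map]
    rfl
  rw [Finset.prod_congr rfl fun c _ => hterm c, Finset.prod_univ_sum, Fintype.piFinset_univ,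
    Matrix.trace, ← E.sum_comp]
  refine Finset.sum_congr rfl fun f _ => ?_
  rw [Matrix.diag_apply, Matrix.of_apply, ← e.prod_comp, Fintype.prod_sigma]
  refine Finset.prod_congr rfl fun c _ => Finset.prod_congr rfl fun j _ => ?_
  rw [hE, hE]
  change _ = ρ (x.left.1 (F ⟨c, j⟩)) (f (F ⟨c, j⟩)) (f (s⁻¹ (F ⟨c, j⟩)))
  rw [hnext]

theorem eta_z_mul (γ : ClassFun Γ) (x : BG Γ n) : eta γ (BG.z * x) = eta γ x := by
  have h (g h : Fin n → Γ) (p q : PiGrp n) (s r : Perm (Fin n)) (hg : g = h) (hs : s = r) :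
      eta γ (⟨(g, p), s⟩ : BG Γ n) = eta γ (⟨(h, q), r⟩ : BG Γ n) := by
    subst hg hs; rfl
  exact h _ _ _ _ _ _ (BG.z_mul_left_fst x) (BG.z_mul_right x)

variable (Γ) in
/-- The action of `Γ̃_n` (through `Π_n ⋊ S_n`) on the Clifford algebra `L_n` with generators
`e_1, …, e_n` and relations `e_i e_j + e_j e_i = -2 δ_{ij}`, on its basis
`e_I = e_1 ^ (I 1) ⋯ e_n ^ (I n)`: the element `z` acts as `-1`, `a_i` as the left multiplication
by `e_i`, and `s ∈ S_n` as the automorphism `e_i ↦ e_{s(i)}`. Products of the `e_i` are computed as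
those of the `a_i`, with `-1` in place of `z`. -/
def cliffordRep (n : ℕ) : Representation ℂ (BG Γ n) ((Fin n → ZMod 2) →₀ ℂ) where
  toFun x := Finsupp.linearCombination ℂ fun I =>
    Finsupp.single (x.left.2 * PiGrp.permFun x.right ⟨0, I⟩).supp
      ((-1) ^ (x.left.2 * PiGrp.permFun x.right ⟨0, I⟩).sgn.val)
  map_one' := by
    refine Finsupp.lhom_ext fun I c => ?_
    have h : (1 : BG Γ n).left.2 * PiGrp.permFun (1 : BG Γ n).right ⟨0, I⟩ = ⟨0, I⟩ := by
      change 1 * PiGrp.permFun 1 _ = _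
      rw [PiGrp.permFun_one, one_mul]
    rw [Finsupp.linearCombination_single, h]
    simp
  map_mul' x y := by
    refine Finsupp.lhom_ext fun I c => ?_
    rw [Module.End.mul_apply]
    simp only [Finsupp.linearCombination_single, Finsupp.smul_single, smul_eq_mul]
    set q : PiGrp n := y.left.2 * PiGrp.permFun y.right ⟨0, I⟩ with hq
    set r : PiGrp n := x.left.2 * PiGrp.permFun x.right ⟨0, q.supp⟩ with hr
    have h : (x * y).left.2 * PiGrp.permFun (x * y).right ⟨0, I⟩ = ⟨r.sgn + q.sgn, r.supp⟩ := by
      change x.left.2 * PiGrp.permFun x.right y.left.2 *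
        PiGrp.permFun (x.right * y.right) ⟨0, I⟩ = _
      rw [PiGrp.permFun_permFun, mul_assoc, ← PiGrp.permFun_mul, ← hq]
      refine PiGrp.ext ?_ rfl
      simp only [hr, PiGrp.mul_sgn, PiGrp.permFun]
      ring
    rw [h]
    congr 1
    have h2 : ∀ a b : ZMod 2, ((-1 : ℂ)) ^ (a + b).val = (-1) ^ b.val * (-1) ^ a.val := by
      intro a b
      have h0 : (0 : ZMod 2).val = 0 := rfl
      have h1 : (1 : ZMod 2).val = 1 := rfl
      have h3 : (1 + 1 : ZMod 2) = 0 := rfl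
      refine zc_cases (P := fun a => ((-1 : ℂ)) ^ (a + b).val = (-1) ^ b.val * (-1) ^ a.val) ?_ ?_ a
      · simp
      · refine zc_cases (P := fun b => ((-1 : ℂ)) ^ (1 + b).val = (-1) ^ b.val * (-1) ^ _) ?_ ?_ b
        · simp
        · rw [h3, h0, h1]; norm_num
    rw [h2, mul_assoc]

/-- The character `χ_n` of the basic spin supermodule `L_n`. -/
def chiBasic (x : BG Γ n) : ℂ := (cliffordRep Γ n).character x

theorem cliffordRep_single (x : BG Γ n) (I : Fin n → ZMod 2) (c : ℂ) :
    cliffordRep Γ n x (Finsupp.single I c) =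
      Finsupp.single (x.left.2 * PiGrp.permFun x.right ⟨0, I⟩).supp
      (c * (-1) ^ (x.left.2 * PiGrp.permFun x.right ⟨0, I⟩).sgn.val) := by
  change Finsupp.linearCombination ℂ _ _ = _
  rw [Finsupp.linearCombination_single, Finsupp.smul_single, smul_eq_mul]

theorem chiBasic_mem : (chiBasic : BG Γ n → ℂ) ∈ Rm Γ n := by
  classical
  refine ⟨fun t x => Representation.char_conj _ _ _, fun x => ?_, fun x hx => ?_⟩
  · have hz : cliffordRep Γ n BG.z = (-1 : ℂ) • 1 := by
      refine Finsupp.lhom_ext fun I c => ?_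
      have h : (BG.z : BG Γ n).left.2 * PiGrp.permFun (BG.z : BG Γ n).right ⟨0, I⟩ = ⟨1, I⟩ := by
        rw [BG.z_right, PiGrp.permFun_one]
        refine PiGrp.ext ?_ ?_ <;> simp [PiGrp.z, PiGrp.cocycle_zero_left]
      rw [cliffordRep_single, h]
      simp [ZMod.val_one]
    unfold chiBasic Representation.character
    rw [map_mul, hz, smul_mul_assoc, one_mul, map_smul, neg_one_smul]
  · unfold chiBasic Representation.character
    rw [LinearMap.trace_eq_matrix_trace ℂ (Finsupp.basisSingleOne), Matrix.trace]
    refine Finset.sum_eq_zero fun I _ => ?_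
    rw [Matrix.diag_apply, LinearMap.toMatrix_apply, Finsupp.coe_basisSingleOne,
      cliffordRep_single]
    simp only [Finsupp.basisSingleOne_repr, LinearEquiv.refl_apply]
    rw [Finsupp.single_apply, if_neg]
    intro h
    have h2 := congrArg (fun J : Fin n → ZMod 2 => ∑ i, J i) h
    simp only [PiGrp.mul_supp, PiGrp.permFun, Pi.add_apply, Finset.sum_add_distrib] at h2
    rw [Equiv.sum_comp x.right⁻¹ I] at h2
    have h3 : BG.parity x = 0 := by
      unfold BG.parity
      exact left_eq_add.1 (by rw [add_comm]; exact h2.symm)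
    rw [hx] at h3
    exact one_ne_zero h3

/-- `χ_n(γ) = η_n(γ) ⊛ χ_n`; for the character `γ` of a `Γ`-module `V` this is the character of
`V^{⊗ n} ⊗ L_n`. -/
def chi (n : ℕ) (γ : ClassFun Γ) : Rm Γ n :=
  ⟨fun x => eta γ x * chiBasic x,
    fun t x => by dsimp only; rw [eta_conj, chiBasic_mem.1],
    fun x => by dsimp only; rw [eta_z_mul, chiBasic_mem.2.1, mul_neg],
    fun x hx => by dsimp only; rw [chiBasic_mem.2.2 x hx, mul_zero]⟩

end Characters

/-! ### Weighted forms -/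

section Forms

variable [Fintype Γ]

/-- The weighted bilinear form `⟨f, g⟩_ξ = |Γ|⁻¹ ∑_x ξ(x) f(x) g(x⁻¹)` on functions on `Γ`. -/
def form (ξ f g : Γ → ℂ) : ℂ := (Nat.card Γ : ℂ)⁻¹ * ∑ x, ξ x * f x * g x⁻¹

/-- The weighted bilinear form `⟨f, g⟩_ξ = ⟨η_n(ξ) ⊛ f, g⟩` on functions on `Γ̃_n`. -/
def wform {n : ℕ} (ξ : ClassFun Γ) (f g : BG Γ n → ℂ) : ℂ :=
  (Nat.card (BG Γ n) : ℂ)⁻¹ * ∑ x, eta ξ x * f x * g x⁻¹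

variable (Γ) in
/-- `R_ℤ(Γ)`: the virtual characters of `Γ`, i.e. the subgroup of `R(Γ)` generated by the
characters of the finite-dimensional complex representations. -/
def RZ : AddSubgroup (ClassFun Γ) :=
  AddSubgroup.closure {f | ∃ (d : ℕ) (ρ : Representation ℂ Γ (Fin d → ℂ)),
    (f : Γ → ℂ) = ρ.character}

theorem form_int (ξ f g : RZ Γ) : ∃ k : ℤ, form (ξ : Γ → ℂ) (f : Γ → ℂ) (g : Γ → ℂ) = k := by
  obtain ⟨ξ, hξ⟩ := ξ
  obtain ⟨f, hf⟩ := f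
  obtain ⟨g, hg⟩ := g
  dsimp only
  have : Invertible (Nat.card Γ : ℂ) := invertibleOfNonzero (by simp)
  induction hξ using AddSubgroup.closure_induction with
  | zero => exact ⟨0, by simp [form]⟩
  | add a b _ _ ha hb =>
    obtain ⟨k, hk⟩ := ha
    obtain ⟨l, hl⟩ := hb
    refine ⟨k + l, ?_⟩
    push_cast
    rw [← hk, ← hl]
    simp [form, add_mul, Finset.sum_add_distrib, mul_add]
  | neg a _ ha =>
    obtain ⟨k, hk⟩ := ha
    refine ⟨-k, ?_⟩
    push_cast
    rw [← hk]
    simp [form]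
  | mem ξ hξ =>
  induction hf using AddSubgroup.closure_induction with
  | zero => exact ⟨0, by simp [form]⟩
  | add a b _ _ ha hb =>
    obtain ⟨k, hk⟩ := ha
    obtain ⟨l, hl⟩ := hb
    refine ⟨k + l, ?_⟩
    push_cast
    rw [← hk, ← hl]
    simp [form, add_mul, Finset.sum_add_distrib, mul_add]
  | neg a _ ha =>
    obtain ⟨k, hk⟩ := ha
    refine ⟨-k, ?_⟩
    push_cast
    rw [← hk]
    simp [form]
  | mem f hf =>
  induction hg using AddSubgroup.closure_induction with
  | zero => exact ⟨0, by simp [form]⟩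
  | add a b _ _ ha hb =>
    obtain ⟨k, hk⟩ := ha
    obtain ⟨l, hl⟩ := hb
    refine ⟨k + l, ?_⟩
    push_cast
    rw [← hk, ← hl]
    simp [form, Finset.sum_add_distrib, mul_add]
  | neg a _ ha =>
    obtain ⟨k, hk⟩ := ha
    refine ⟨-k, ?_⟩
    push_cast
    rw [← hk]
    simp [form]
  | mem g hg =>
  obtain ⟨d₁, ρ, hρ⟩ := hξ
  obtain ⟨d₂, σ, hσ⟩ := hf
  obtain ⟨d₃, τ, hτ⟩ := hg
  have h := Representation.card_inv_mul_sum_char_mul_char_eq_finrank τ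
    (Representation.tprod ρ σ)
  rw [Representation.char_tensor] at h
  refine ⟨Module.finrank ℂ (Representation.IntertwiningMap τ (Representation.tprod ρ σ)), ?_⟩
  push_cast
  rw [← h, form, hρ, hσ, hτ]
  rfl

/-- The integer `⟨f, g⟩_ξ` for virtual characters `ξ`, `f`, `g`. -/
def formZ (ξ f g : RZ Γ) : ℤ := (form_int ξ f g).choose

theorem formZ_spec (ξ f g : RZ Γ) :
    form (ξ : Γ → ℂ) (f : Γ → ℂ) (g : Γ → ℂ) = (formZ ξ f g : ℂ) :=
  (form_int ξ f g).choose_spec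

end Forms

/-! ### The operators `H_{±n}(γ)` on `⨁_n R^-(Γ̃_n)` -/

section Operators

variable [Fintype Γ]

variable (Γ) in
/-- The space `⨁_{n ≥ 0} R^-(Γ̃_n)`. -/
abbrev Fock : Type _ := ⨁ n : ℕ, Rm Γ n

/-- The restriction of a function on `Γ̃_{n+k}` to the spin product of `Γ̃_n` and `Γ̃_k`, paired with
`f` in the first factor by the weighted form: the function `y ↦ ⟨f, F(· y)⟩_ξ`. -/
def resPair {n : ℕ} (ξ : ClassFun Γ) (f : Rm Γ n) (k : ℕ) : Rm Γ (n + k) →ₗ[ℂ] Rm Γ k where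
  toFun F := ⟨fun y => wform ξ f.1 fun x => F.1 (inL n k x * inR n k y), by
    have hF (x : BG Γ n) (y : BG Γ k) (t : BG Γ k) (hx : BG.parity x = 0) :
        F.1 (inL n k x * inR n k (t * y * t⁻¹)) = F.1 (inL n k x * inR n k y) := by
      rw [← F.2.1 (inR n k t) (inL n k x * inR n k y)]
      congr 1
      simp only [map_mul, map_inv, ← mul_assoc]
      rw [inR_mul_inL, hx, zero_mul, BG.zc_zero, one_mul]
    refine ⟨fun t y => ?_, fun y => ?_, fun y hy => ?_⟩ <;> dsimp only
    · unfold wform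
      congr 1
      refine Finset.sum_congr rfl fun x _ => ?_
      by_cases hx : BG.parity x = 1
      · rw [f.2.2.2 x hx]; simp
      · have hx0 : BG.parity x = 0 := by
          revert hx; generalize BG.parity x = a; revert a; decide
        dsimp only
        rw [hF _ _ _ (by rw [BG.parity_inv, hx0])]
    · unfold wform
      rw [← mul_neg, ← Finset.sum_neg_distrib]
      congr 1
      refine Finset.sum_congr rfl fun x _ => ?_
      have hz : inR n k (BG.z : BG Γ k) = BG.z := embed_z _
      dsimp only
      rw [map_mul, hz, ← mul_assoc (inL n k _), BG.mul_z, mul_assoc BG.z, F.2.2.1, mul_neg]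
    · unfold wform
      rw [Finset.sum_eq_zero, mul_zero]
      intro x _
      by_cases hx : BG.parity x = 1
      · rw [f.2.2.2 x hx]; simp
      · have hx0 : BG.parity x = 0 := by
          revert hx; generalize BG.parity x = a; revert a; decide
        dsimp only
        rw [F.2.2.2, mul_zero]
        have h1 : BG.parity (inL n k x⁻¹) = BG.parity x⁻¹ := parity_embed _ _
        have h2 : BG.parity (inR n k y) = BG.parity y := parity_embed _ _
        rw [BG.parity_mul, h1, h2, BG.parity_inv, hx0, hy, zero_add]⟩
  map_add' F F' := by
    ext y
    simp only [wform, Submodule.coe_add, Pi.add_apply, mul_add, Finset.sum_add_distrib]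
  map_smul' c F := by
    ext y
    simp only [wform, Submodule.coe_smul, Pi.smul_apply, smul_eq_mul, RingHom.id_apply]
    rw [mul_left_comm, Finset.mul_sum]
    congr 1
    rw [Finset.mul_sum, Finset.mul_sum]
    refine Finset.sum_congr rfl fun x _ => ?_
    ring

/-- The creation operator `H_{-n}(γ)`, mapping `R^-(Γ̃_m)` to `R^-(Γ̃_{n+m})`. -/
def Hcr (n : ℕ) (γ : ClassFun Γ) : Module.End ℂ (Fock Γ) :=
  DirectSum.toModule ℂ ℕ (Fock Γ) fun m =>
    DirectSum.lof ℂ ℕ (fun j => Rm Γ j) (n + m) ∘ₗ indMul (chi n γ) m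

/-- The annihilation operator `H_n(γ)`, mapping `R^-(Γ̃_{n+k})` to `R^-(Γ̃_k)` and `R^-(Γ̃_m)` to `0`
for `m < n`. -/
def Han (ξ : ClassFun Γ) (n : ℕ) (γ : ClassFun Γ) : Module.End ℂ (Fock Γ) where
  toFun F := DFinsupp.mapRange (fun k => resPair ξ (chi n γ) k) (fun _ => map_zero _)
    (DFinsupp.comapDomain (fun k => n + k) (add_right_injective n) F)
  map_add' F F' := by
    refine DFinsupp.ext fun k => ?_
    exact map_add (resPair ξ (chi n γ) k) (F (n + k)) (F' (n + k))
  map_smul' c F := by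
    refine DFinsupp.ext fun k => ?_
    exact map_smul (resPair ξ (chi n γ) k) c (F (n + k))

theorem Han_apply (ξ : ClassFun Γ) (n : ℕ) (γ : ClassFun Γ) (F : Fock Γ) (k : ℕ) :
    Han ξ n γ F k = resPair ξ (chi n γ) k (F (n + k)) := rfl

theorem Han_eq_zero (ξ : ClassFun Γ) (F : Fock Γ) :
    ∃ d, ∀ n, d ≤ n → ∀ γ, Han ξ n γ F = 0 := by
  classical
  refine ⟨(DFinsupp.support F).sup id + 1, fun n hn γ => DFinsupp.ext fun k => ?_⟩
  have h : F (n + k) = 0 := by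
    by_contra h
    have := Finset.le_sup (f := id) (DFinsupp.mem_support_iff.2 h)
    simp only [id] at this
    omega
  exact (congrArg (resPair ξ (chi n γ) k) h).trans (map_zero _)

end Operators

/-! ### Locally finite sums of operators, vertex operators -/

/-- A family of operators is locally finite if each vector is killed by almost all members. -/
def LocFin {V ι : Type*} [AddCommMonoid V] [Module ℂ V] (T : ι → Module.End ℂ V) : Prop :=
  ∀ v, (Function.support fun i => T i v).Finite

/-- The sum of a locally finite family of operators. -/
def locSum {V ι : Type*} [AddCommMonoid V] [Module ℂ V] (T : ι → Module.End ℂ V)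
    (hT : LocFin T) : Module.End ℂ V where
  toFun v := ∑ᶠ i, T i v
  map_add' v w := by
    simp only [map_add]
    exact finsum_add_distrib (hT v) (hT w)
  map_smul' c v := by
    simp only [map_smul, RingHom.id_apply]
    exact (smul_finsum' c (hT v)).symm

section Vertex

variable [Fintype Γ]

/-- The coefficient of `z ^ i` in `H_+(γ, z) = ∑_{n ≥ 0} H_{-n}(γ) z ^ n`. -/
def HplusCoeff (γ : ClassFun Γ) (i : ℤ) : Module.End ℂ (Fock Γ) :=
  if 0 ≤ i then Hcr i.toNat γ else 0

/-- The coefficient of `z ^ (-j)` in `H_-(γ, -z) = ∑_{n ≥ 0} H_n(γ) (-z) ^ (-n)`. -/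
def HminusCoeff (ξ γ : ClassFun Γ) (j : ℕ) : Module.End ℂ (Fock Γ) :=
  (-1 : ℂ) ^ j • Han ξ j γ

theorem HminusCoeff_eq_zero (ξ : ClassFun Γ) (F : Fock Γ) :
    ∃ d, ∀ n, d ≤ n → ∀ γ, HminusCoeff ξ γ n F = 0 := by
  obtain ⟨d, hd⟩ := Han_eq_zero ξ F
  exact ⟨d, fun n hn γ => by simp [HminusCoeff, hd n hn γ]⟩

theorem locFin_one (ξ γ : ClassFun Γ) (A : ℕ → Module.End ℂ (Fock Γ)) :
    LocFin fun j => A j * HminusCoeff ξ γ j := by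
  intro F
  obtain ⟨d, hd⟩ := HminusCoeff_eq_zero ξ F
  refine (Set.finite_lt_nat d).subset fun j hj => ?_
  by_contra h
  refine hj ?_
  change A j (HminusCoeff ξ γ j F) = 0
  rw [hd j (not_lt.1 h) γ, map_zero]

theorem locFin_two (ξ α β : ClassFun Γ) (A : ℕ × ℕ → Module.End ℂ (Fock Γ)) :
    LocFin fun j : ℕ × ℕ => A j * (HminusCoeff ξ α j.1 * HminusCoeff ξ β j.2) := by
  intro F
  obtain ⟨d, hd⟩ := HminusCoeff_eq_zero ξ F
  choose e he using fun l => HminusCoeff_eq_zero ξ (HminusCoeff ξ β l F)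
  refine (((Set.finite_lt_nat ((Finset.range d).sup e)).prod (Set.finite_lt_nat d))).subset ?_
  rintro ⟨j, l⟩ hj
  have hl : l < d := by
    by_contra h
    refine hj ?_
    change A (j, l) (HminusCoeff ξ α j (HminusCoeff ξ β l F)) = 0
    rw [hd l (not_lt.1 h) β, map_zero, map_zero]
  refine ⟨?_, hl⟩
  by_contra h
  refine hj ?_
  change A (j, l) (HminusCoeff ξ α j (HminusCoeff ξ β l F)) = 0
  rw [he l j ((Finset.le_sup (Finset.mem_range.2 hl)).trans (not_lt.1 h)) α, map_zero]

/-- The coefficient of `z ^ (-n)` in `H_+(γ, z) H_-(γ, -z)`. -/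
def XFock (ξ γ : ClassFun Γ) (n : ℤ) : Module.End ℂ (Fock Γ) :=
  locSum (fun j : ℕ => HplusCoeff γ (j - n) * HminusCoeff ξ γ j) (locFin_one ξ γ _)

/-- The coefficient of `z ^ (-p) w ^ (-q)` in `H_+(α, z) H_+(β, w) H_-(α, -z) H_-(β, -w)`. -/
def normalFock (ξ α β : ClassFun Γ) (p q : ℤ) : Module.End ℂ (Fock Γ) :=
  locSum (fun j : ℕ × ℕ => (HplusCoeff α (j.1 - p) * HplusCoeff β (j.2 - q)) *
    (HminusCoeff ξ α j.1 * HminusCoeff ξ β j.2)) (locFin_two ξ α β _)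

variable (Γ) in
/-- The subgroup `2 R_ℤ(Γ)`. -/
def twoRZ : AddSubgroup (RZ Γ) := (zsmulAddGroupHom (α := RZ Γ) 2).range

/-- The form `c₁(α, β) = ⟨α, β⟩_ξ + ⟨α, α⟩_ξ ⟨β, β⟩_ξ mod 2`. -/
def c1 (ξ α β : RZ Γ) : ZMod 2 :=
  ((formZ ξ α β + formZ ξ α α * formZ ξ β β : ℤ) : ZMod 2)

/-- A central extension of `R_ℤ(Γ) / 2 R_ℤ(Γ)` by `⟨±1⟩` with commutator map `c₁`, a choice of
elements `e_{ᾱ}` above `ᾱ`, a maximal subgroup `Φ` of `R_ℤ(Γ)` such that `c₁` vanishes on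
`Φ / 2 R_ℤ(Γ)`, and an irreducible module structure over the extension on `ℂ[R_ℤ(Γ) / Φ]`, with
basis `e^{[β]}`, in which `e_{ᾱ} e^{[β]} = ± e^{[α + β]}`. The elements `e_{ᾱ}`, which are otherwise
determined only up to sign, are normalized by `e_{ᾱ} e^{[0]} = e^{[α]}`. -/
structure LatticeModule (ξ : RZ Γ) (E : Type*) [Group E] where
  ext : GroupExtension ℤˣ E (Multiplicative (RZ Γ ⧸ twoRZ Γ))
  central : ∀ (s : ℤˣ) (a : E), ext.inl s * a = a * ext.inl s
  commutator : ∀ (a b : E) (α β : RZ Γ),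
    ext.rightHom a = Multiplicative.ofAdd (α : RZ Γ ⧸ twoRZ Γ) →
    ext.rightHom b = Multiplicative.ofAdd (β : RZ Γ ⧸ twoRZ Γ) →
    a * b * a⁻¹ * b⁻¹ = ext.inl ((-1) ^ (c1 ξ α β).val)
  e : RZ Γ ⧸ twoRZ Γ → E
  rightHom_e : ∀ a, ext.rightHom (e a) = Multiplicative.ofAdd a
  Φ : AddSubgroup (RZ Γ)
  Φ_maximal : Maximal
    (fun Ψ : AddSubgroup (RZ Γ) => twoRZ Γ ≤ Ψ ∧ ∀ α ∈ Ψ, ∀ β ∈ Ψ, c1 ξ α β = 0) Φ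
  act : Representation ℂ E ((RZ Γ ⧸ Φ) →₀ ℂ)
  irreducible : act.IsIrreducible
  act_neg_one : ∀ v, act (ext.inl (-1)) v = -v
  act_e : ∀ α β : RZ Γ, ∃ s : ℤˣ, act (e (α : RZ Γ ⧸ twoRZ Γ)) (Finsupp.single (β : RZ Γ ⧸ Φ) 1) =
    Finsupp.single ((α + β : RZ Γ) : RZ Γ ⧸ Φ) ((s : ℤ) : ℂ)
  act_e_zero : ∀ α : RZ Γ, act (e (α : RZ Γ ⧸ twoRZ Γ)) (Finsupp.single (0 : RZ Γ ⧸ Φ) 1) =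
    Finsupp.single (α : RZ Γ ⧸ Φ) 1

namespace LatticeModule

variable {ξ : RZ Γ} {E : Type*} [Group E] (M : LatticeModule ξ E)

/-- The sign `ε(α, β)` in `e_{ᾱ} e^{[β]} = ε(α, β) e^{[α + β]}`. -/
def eps (α β : RZ Γ) : ℂ :=
  M.act (M.e (α : RZ Γ ⧸ twoRZ Γ)) (Finsupp.single (β : RZ Γ ⧸ M.Φ) 1)
    ((α + β : RZ Γ) : RZ Γ ⧸ M.Φ)

/-- The space `⨁_n R^-(Γ̃_n) ⊗ ℂ[R_ℤ(Γ) / Φ]`. -/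
abbrev Space : Type _ := Fock Γ ⊗[ℂ] ((RZ Γ ⧸ M.Φ) →₀ ℂ)

/-- `X_n(γ)`, the coefficient of `z ^ (-n)` in the twisted vertex operator
`X(γ, z) = H_+(γ, z) H_-(γ, -z) e_{γ̄}`. -/
def X (γ : RZ Γ) (n : ℤ) : Module.End ℂ M.Space :=
  TensorProduct.map (XFock ξ.1 γ.1 n) (M.act (M.e (γ : RZ Γ ⧸ twoRZ Γ)))

/-- The coefficient of `z ^ (-p) w ^ (-q)` in the normal ordered product
`: X(α, z) X(β, w) : = H_+(α, z) H_+(β, w) H_-(α, -z) H_-(β, -w) e_{ᾱ + β̄}`. -/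
def normalX (α β : RZ Γ) (p q : ℤ) : Module.End ℂ M.Space :=
  TensorProduct.map (normalFock ξ.1 α.1 β.1 p q)
    (M.act (M.e ((α : RZ Γ ⧸ twoRZ Γ) + (β : RZ Γ ⧸ twoRZ Γ))))

end LatticeModule

end Vertex

/-- The coefficient of `t ^ k` in the expansion of `((1 - t) / (1 + t)) ^ a` in powers of `t`. For
`t = w / z` this is the coefficient of `(w / z) ^ k` in `((z - w) / (z + w)) ^ a`. -/
def opeCoeff (a : ℤ) (k : ℕ) : ℂ :=
  (((1 - HahnSeries.single 1 1) / (1 + HahnSeries.single 1 1)) ^ a : LaurentSeries ℂ).coeff k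

end SpinWreath

end

open SpinWreath

/-! Compare the coefficients of `z^(-p) w^(-q)` on both sides. With `a = ⟨α, β⟩_ξ`, the factor
`((z-w)/(z+w))^a = ((1-t)/(1+t))^a`, `t = w/z`, contributes its coefficient of `t^k` together with
the normal ordered coefficient of index `(p-k, q+k)`. The two tensor factors separate. On
`ℂ[R_ℤ(Γ)/Φ]` the elements `e_α e_β` and `e_{α+β}` lie over the same class, so they differ by a
sign; testing on `e^{[0]}` shows that this sign is `ε(α, β)` (`LatticeModule.act_e_mul_act_e`).

On the Fock space everything reduces to moving `H_-(α, -z)` to the right of `H_+(β, w)`. This is a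
Mackey argument. The value of an induced function is a sum over the sets `S` of `n` positions of
outer products extended by zero (`ind_outer`). On a product of elements of the blocks of sizes `m`
and `k`, such an `S` splits as `A ⊔ T`, and since `η_m(ξ)` and `χ_m(α)` are multiplicative on
complementary positions (`Compl.eta_mul`, `Compl.chi_mul`), the part on `A` separates off as a
scalar. Hence `H_m(α) H_{-n}(β)` is the sum over `a` of `⟨χ_a(α), χ_a(β)⟩_ξ H_{-(n-a)}(β)
H_{m-a}(α)` (`Han_Hcr`).

It remains to compute these scalars (`wform_chi`). Averaging `χ_n(x) χ_n(x⁻¹)` over `Π_n` leaves the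
character of the permutation of `x` on the Clifford algebra. That character is a sum over the
invariant sets `S` of the sign of the restriction to `S`, as for an exterior algebra. Averaging
`η_n` over `Γ^n` turns every cycle into a factor `N = ⟨α, β⟩_ξ`. The cycle generating functions of
the symmetric groups, with and without sign, then give `binom(N, b)` and `(-1)^c binom(-N, c)`, so
the pairing in degree `n` is the coefficient of `t^n` in `((1+t)/(1-t))^N`. The sign `(-1)^n`
carried by `H_-(α, -z)` replaces `t` by `-t`, which gives the required factor.

All sums are finite on a given vector: annihilators of large degree kill it, and `H_+` has no
coefficients of negative index. -/

noncomputable section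

namespace SpinWreath

open Equiv (Perm)

variable {Γ : Type*} [Group Γ]

/-! ### Complementary pairs of order embeddings -/

namespace BG

/-- The permutation `t` as an element of `Γ̃_N`. -/
def perm {N : ℕ} (t : Perm (Fin N)) : BG Γ N := SemidirectProduct.inr t

@[simp] theorem perm_right {N : ℕ} (t : Perm (Fin N)) : (perm t : BG Γ N).right = t := rfl

end BG

section Pairs

variable {n m N : ℕ}

theorem extend_extend {A : Type*} {M : ℕ} (g : Fin N ↪o Fin M) (f : Fin n ↪o Fin N) (I : Fin n → A)
    (b : A) : Function.extend g (Function.extend f I (fun _ => b)) (fun _ => b) =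
      Function.extend (f.trans g) I (fun _ => b) := by
  funext i
  by_cases hi : i ∈ Set.range g
  · obtain ⟨j, rfl⟩ := hi
    rw [extend_mem]
    by_cases hj : j ∈ Set.range f
    · obtain ⟨j, rfl⟩ := hj
      rw [extend_mem]
      exact (extend_mem (f.trans g) I _ j).symm
    · rw [extend_notMem f _ _ hj, extend_notMem]
      rintro ⟨k, hk⟩
      exact hj ⟨k, g.injective hk⟩
  · rw [extend_notMem g _ _ hi, extend_notMem]
    rintro ⟨k, hk⟩
    exact hi ⟨f k, hk⟩

theorem embed_embed {M : ℕ} (g : Fin N ↪o Fin M) (f : Fin n ↪o Fin N) (x : BG Γ n) :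
    embed g (embed f x) = embed (f.trans g) x := by
  refine BG.ext' ?_ ?_ ?_
  · exact extend_extend g f _ _
  · exact PiGrp.ext rfl (extend_extend g f _ _)
  · refine Equiv.ext fun i => ?_
    simp only [embed_right]
    by_cases hi : i ∈ Set.range g
    · obtain ⟨j, rfl⟩ := hi
      rw [viaEmbedding_apply']
      by_cases hj : j ∈ Set.range f
      · obtain ⟨j, rfl⟩ := hj
        rw [viaEmbedding_apply']
        exact (viaEmbedding_apply' (f.trans g) x.right j).symm
      · rw [viaEmbedding_notMem f _ hj, viaEmbedding_notMem]
        rintro ⟨k, hk⟩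
        exact hj ⟨k, g.injective hk⟩
    · rw [viaEmbedding_notMem g _ hi, viaEmbedding_notMem]
      rintro ⟨k, hk⟩
      exact hi ⟨f k, hk⟩

theorem extend_perm_inv {A : Type*} {t : Perm (Fin N)} {e e' : Fin n ↪o Fin N}
    (h : ∀ i, t (e i) = e' i) (I : Fin n → A) (b : A) (i : Fin N) :
    Function.extend e I (fun _ => b) (t⁻¹ i) = Function.extend e' I (fun _ => b) i := by
  by_cases hi : i ∈ Set.range e'
  · obtain ⟨i, rfl⟩ := hi
    have h' : t⁻¹ (e' i) = e i := by rw [← h]; simp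
    rw [h', extend_mem, extend_mem]
  · rw [extend_notMem _ _ _ hi, extend_notMem]
    rintro ⟨j, hj⟩
    refine hi ⟨j, ?_⟩
    rw [← h, hj]; simp

/-- A permutation that carries one order embedding to another one intertwines the embeddings of
groups. -/
theorem perm_mul_embed {t : Perm (Fin N)} {e e' : Fin n ↪o Fin N} (h : ∀ i, t (e i) = e' i)
    (x : BG Γ n) : BG.perm t * embed e x = embed e' x * BG.perm t := by
  refine BG.ext' ?_ ?_ ?_
  · rw [BG.mul_left_fst, BG.mul_left_fst]
    funext i
    change 1 * Function.extend e x.left.1 (fun _ => 1) (t⁻¹ i) =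
      Function.extend e' x.left.1 (fun _ => 1) i * 1
    rw [extend_perm_inv h, one_mul, mul_one]
  · rw [BG.mul_left_snd, BG.mul_left_snd]
    have h1 : PiGrp.permFun (embed e' x).right (1 : PiGrp N) = 1 := by
      refine PiGrp.ext ?_ rfl
      simp [PiGrp.permFun, PiGrp.inversions]
    change 1 * _ = _ * PiGrp.permFun _ 1
    rw [h1, one_mul, mul_one, BG.perm_right, embed_left_snd, embed_left_snd]
    refine PiGrp.ext ?_ (funext (extend_perm_inv h x.left.2.supp 0))
    change _ + PiGrp.inversions _ _ = _
    -- On the range of `e` the permutation `t` is the monotone map `e i ↦ e' i`, so it has no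
    -- inversions inside the support of `x` and produces no sign.
    rw [PiGrp.inversions, Finset.sum_eq_zero, add_zero]
    intro i _
    refine Finset.sum_eq_zero fun j _ => ?_
    rw [ite_eq_right_iff]
    rintro ⟨h1, h2⟩
    by_cases hi : i ∈ Set.range e
    · by_cases hj : j ∈ Set.range e
      · obtain ⟨i, rfl⟩ := hi
        obtain ⟨j, rfl⟩ := hj
        rw [h, h, e'.lt_iff_lt] at h2
        rw [e.lt_iff_lt] at h1
        exact absurd h1 h2.not_gt
      · simp [extend_notMem _ _ _ hj]
    · simp [extend_notMem _ _ _ hi]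
  · change t * (embed e x).right = (embed e' x).right * t
    refine Equiv.ext fun i => ?_
    rw [Equiv.Perm.mul_apply, Equiv.Perm.mul_apply, embed_right, embed_right]
    by_cases hi : i ∈ Set.range e
    · obtain ⟨i, rfl⟩ := hi
      rw [viaEmbedding_apply', h, h, viaEmbedding_apply']
    · rw [viaEmbedding_notMem _ _ hi, viaEmbedding_notMem]
      rintro ⟨j, hj⟩
      exact hi ⟨j, t.injective (by rw [h, hj])⟩

/-- Two order embeddings whose ranges partition the set of positions. -/
abbrev Compl (e : Fin n ↪o Fin N) (e' : Fin m ↪o Fin N) : Prop :=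
  IsCompl (Set.range e) (Set.range e')

theorem compl_castAdd_natAdd : Compl (Fin.castAddOrderEmb (n := n) m) (Fin.natAddOrderEmb n) := by
  refine IsCompl.of_eq ?_ ?_
  · refine Set.eq_empty_of_forall_notMem ?_
    rintro i ⟨⟨j, rfl⟩, hj⟩
    exact notMem_left _ hj
  · refine Set.eq_univ_of_forall ?_
    exact block_cases (fun i => Or.inl ⟨i, rfl⟩) fun i => Or.inr ⟨i, rfl⟩

variable {e : Fin n ↪o Fin N} {e' : Fin m ↪o Fin N}

theorem Compl.notMem_right (h : Compl e e') (i : Fin n) : e i ∉ Set.range e' :=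
  fun hi => Set.disjoint_left.1 h.disjoint ⟨i, rfl⟩ hi

theorem Compl.notMem_left (h : Compl e e') (i : Fin m) : e' i ∉ Set.range e :=
  fun hi => Set.disjoint_left.1 h.disjoint hi ⟨i, rfl⟩

theorem Compl.cases (h : Compl e e') {P : Fin N → Prop} (hl : ∀ i, P (e i)) (hr : ∀ i, P (e' i))
    (i : Fin N) : P i := by
  have hi : i ∈ Set.range e ⊔ Set.range e' := by rw [h.sup_eq_top]; trivial
  rcases hi with ⟨j, rfl⟩ | ⟨j, rfl⟩
  exacts [hl j, hr j]

/-- The bijection of index sets given by a complementary pair. -/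
def Compl.sumEquiv (h : Compl e e') : Fin n ⊕ Fin m ≃ Fin N :=
  Equiv.ofBijective (Sum.elim e e') (by
    constructor
    · rintro (i | i) (j | j) hij
      · exact congrArg _ (e.injective hij)
      · exact absurd ⟨j, hij.symm⟩ (h.notMem_right i)
      · exact absurd ⟨i, hij⟩ (h.notMem_right j)
      · exact congrArg _ (e'.injective hij)
    · exact h.cases (fun i => ⟨Sum.inl i, rfl⟩) fun i => ⟨Sum.inr i, rfl⟩)

theorem Compl.card (h : Compl e e') : n + m = N := by
  have := Fintype.card_congr h.sumEquiv
  simpa using this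

/-- The shuffle attached to a complementary pair. -/
theorem Compl.exists_perm {e : Fin n ↪o Fin (n + m)} {e' : Fin m ↪o Fin (n + m)}
    (h : Compl e e') : ∃ t : Perm (Fin (n + m)), (∀ i, t (Fin.castAddOrderEmb m i) = e i) ∧
      ∀ i, t (Fin.natAddOrderEmb n i) = e' i := by
  refine ⟨finSumFinEquiv.symm.trans h.sumEquiv, fun i => ?_, fun i => ?_⟩
  · change h.sumEquiv (finSumFinEquiv.symm (Fin.castAdd m i)) = _
    rw [finSumFinEquiv_symm_apply_castAdd]
    rfl
  · change h.sumEquiv (finSumFinEquiv.symm (Fin.natAdd n i)) = _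
    rw [finSumFinEquiv_symm_apply_natAdd]
    rfl

/-- The shuffle is monotone on each block, so conjugation by it costs no power of `z`. This reduces
questions about arbitrary complementary positions to the two standard blocks. -/
theorem embed_mul_embed {e : Fin n ↪o Fin (n + m)} {e' : Fin m ↪o Fin (n + m)}
    {t : Perm (Fin (n + m))} (h1 : ∀ i, t (Fin.castAddOrderEmb m i) = e i)
    (h2 : ∀ i, t (Fin.natAddOrderEmb n i) = e' i) (x : BG Γ n) (y : BG Γ m) :
    embed e x * embed e' y = BG.perm t * (inL n m x * inR n m y) * (BG.perm t)⁻¹ := by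
  rw [eq_mul_inv_iff_mul_eq, mul_assoc, ← perm_mul_embed h2, ← mul_assoc, ← perm_mul_embed h1,
    mul_assoc]
  rfl

theorem BG.zc_conj (c : ZMod 2) (t x : BG Γ n) : t * (zc c * x) * t⁻¹ = zc c * (t * x * t⁻¹) := by
  rw [← mul_assoc t, zc_comm]; simp only [mul_assoc]

/-- Elements supported on complementary positions commute up to sign. -/
theorem Compl.embed_comm (h : Compl e e') (x : BG Γ n) (y : BG Γ m) :
    embed e' y * embed e x =
      BG.zc (BG.parity x * BG.parity y) * (embed e x * embed e' y) := by
  obtain rfl := h.card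
  obtain ⟨t, h1, h2⟩ := h.exists_perm
  rw [embed_mul_embed h1 h2, ← BG.zc_conj, ← inR_mul_inL,
    eq_mul_inv_of_mul_eq (perm_mul_embed h1 x).symm, eq_mul_inv_of_mul_eq (perm_mul_embed h2 y).symm]
  change BG.perm t * inR n m y * (BG.perm t)⁻¹ * (BG.perm t * inL n m x * (BG.perm t)⁻¹) = _
  group

theorem Compl.unique (h : Compl e e') {x x' : BG Γ n} {y y' : BG Γ m}
    (hxy : embed e x * embed e' y = embed e x' * embed e' y') :
    ∃ c, x' = BG.zc c * x ∧ y' = BG.zc c * y := by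
  obtain rfl := h.card
  obtain ⟨t, h1, h2⟩ := h.exists_perm
  rw [embed_mul_embed h1 h2, embed_mul_embed h1 h2, mul_left_inj, mul_right_inj] at hxy
  exact block_unique hxy

theorem embed_zc (e : Fin n ↪o Fin N) (c : ZMod 2) : embed e (BG.zc c : BG Γ n) = BG.zc c :=
  zc_cases (P := fun c => embed e (BG.zc c : BG Γ n) = BG.zc c) (map_one _) (embed_z _) c

theorem parity_embed_mul_embed (e : Fin n ↪o Fin N) (e' : Fin m ↪o Fin N) (x : BG Γ n)
    (y : BG Γ m) : BG.parity (embed e x * embed e' y) = BG.parity x + BG.parity y := by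
  rw [BG.parity_mul, parity_embed, parity_embed]

theorem parity_eq_one {x : BG Γ n} (h : BG.parity x ≠ 0) : BG.parity x = 1 := by
  revert h; generalize BG.parity x = a; revert a; decide

theorem zc_mul_zc (c d : ZMod 2) : (BG.zc c * BG.zc d : BG Γ n) = BG.zc (c + d) := by
  refine BG.ext' (BG.zc_mul_left_fst _ _) ?_ rfl
  rw [BG.zc_mul_left_snd, add_comm]; rfl

/-- A spin super class function vanishes on `x y` for `x` and `y` supported on complementary
positions, unless both are even. -/
theorem Compl.apply_eq_zero (h : Compl e e') (F : Rm Γ N) {x : BG Γ n} {y : BG Γ m}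
    (hxy : ¬ (BG.parity x = 0 ∧ BG.parity y = 0)) : F.1 (embed e x * embed e' y) = 0 := by
  by_cases hp : BG.parity x + BG.parity y = 0
  · have hx : BG.parity x = 1 ∧ BG.parity y = 1 := by
      revert hxy hp
      generalize BG.parity x = a
      generalize BG.parity y = b
      revert a b; decide
    -- If both factors are odd, conjugation by `x` multiplies `x y` by `z`; a spin class function
    -- then equals its own negative there.
    have h1 := F.2.1 (embed e x) (embed e x * embed e' y)
    have h2 : embed e x * (embed e x * embed e' y) * (embed e x)⁻¹ =
        BG.zc 1 * (embed e x * embed e' y) := by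
      rw [mul_inv_eq_iff_eq_mul, mul_assoc (BG.zc 1), mul_assoc (embed e x) (embed e' y),
        h.embed_comm, hx.1, hx.2, mul_one, ← mul_assoc _ (BG.zc 1), BG.zc_comm, ← mul_assoc (BG.zc 1),
        ← mul_assoc (BG.zc 1), zc_mul_zc]
      change _ = BG.zc 0 * _ * _
      rw [BG.zc_zero, one_mul]
    rw [h2, BG.zc_one, F.2.2.1] at h1
    have h3 : (2 : ℂ) * F.1 (embed e x * embed e' y) = 0 := by linear_combination -h1
    simpa using h3
  · refine F.2.2.2 _ (parity_eq_one ?_)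
    rwa [parity_embed_mul_embed]

theorem apply_inL_mul_inR {e : Fin n ↪o Fin (n + m)} {e' : Fin m ↪o Fin (n + m)} (h : Compl e e')
    (F : Rm Γ (n + m)) (x : BG Γ n) (y : BG Γ m) :
    F.1 (embed e x * embed e' y) = F.1 (inL n m x * inR n m y) := by
  obtain ⟨t, h1, h2⟩ := h.exists_perm
  rw [embed_mul_embed h1 h2, F.2.1]

theorem embed_mul_right_left (h : Compl e e') (x : BG Γ n) (y : BG Γ m) (i : Fin n) :
    (embed e x * embed e' y).right (e i) = e (x.right i) := by
  change (embed e x).right ((embed e' y).right _) = _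
  rw [embed_right, embed_right, viaEmbedding_notMem _ _ (h.notMem_right i), viaEmbedding_apply']

theorem embed_mul_right_right (h : Compl e e') (x : BG Γ n) (y : BG Γ m) (i : Fin m) :
    (embed e x * embed e' y).right (e' i) = e' (y.right i) := by
  change (embed e x).right ((embed e' y).right _) = _
  rw [embed_right, embed_right, viaEmbedding_apply', viaEmbedding_notMem _ _ (h.notMem_left _)]

theorem embed_mul_left_left (h : Compl e e') (x : BG Γ n) (y : BG Γ m) (i : Fin n) :
    (embed e x * embed e' y).left.1 (e i) = x.left.1 i := by
  rw [BG.mul_left_fst, Pi.mul_apply]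
  simp only [embed_left_fst, embed_right, viaEmbedding_inv_apply, extend_mem]
  rw [extend_notMem _ _ _ (h.notMem_right _)]
  exact mul_one _

theorem embed_mul_left_right (h : Compl e e') (x : BG Γ n) (y : BG Γ m) (i : Fin m) :
    (embed e x * embed e' y).left.1 (e' i) = y.left.1 i := by
  rw [BG.mul_left_fst, Pi.mul_apply]
  simp only [embed_left_fst, embed_right, viaEmbedding_inv_notMem _ _ (h.notMem_left _), extend_mem]
  rw [extend_notMem _ _ _ (h.notMem_left _)]
  exact one_mul _

/-- A permutation that preserves a set of positions preserves its complement. -/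
theorem Compl.preserves (h : Compl e e') {s : Perm (Fin N)}
    (hs : ∀ i, s (e i) ∈ Set.range e) : ∃ (s1 : Perm (Fin n)) (s2 : Perm (Fin m)),
      (∀ i, s (e i) = e (s1 i)) ∧ ∀ i, s (e' i) = e' (s2 i) := by
  choose a ha using hs
  have hinj : Function.Injective a := fun i j hij => by
    have := congrArg e hij
    rw [ha, ha] at this
    exact e.injective (s.injective this)
  let s1 := Equiv.ofBijective a (Finite.injective_iff_bijective.1 hinj)
  have hs2 (i : Fin m) : s (e' i) ∈ Set.range e' := by
    by_contra hc
    have : s (e' i) ∈ Set.range e := by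
      revert hc
      refine h.cases (P := fun k => k ∉ Set.range e' → k ∈ Set.range e) (fun j _ => ⟨j, rfl⟩) (fun j hj => absurd ⟨j, rfl⟩ hj) _
    obtain ⟨j, hj⟩ := this
    obtain ⟨k, rfl⟩ := s1.surjective j
    have : s (e k) = s (e' i) := (ha k).symm.trans hj
    exact h.notMem_left i ⟨k, s.injective this⟩
  choose b hb using hs2
  have hinj' : Function.Injective b := fun i j hij => by
    have := congrArg e' hij
    rw [hb, hb] at this
    exact e'.injective (s.injective this)
  exact ⟨s1, Equiv.ofBijective b (Finite.injective_iff_bijective.1 hinj'), fun i => (ha i).symm,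
    fun i => (hb i).symm⟩

/-- The power of `z` in `u` may be placed in either factor; here `x` takes all of it. -/
theorem exists_block {u : BG Γ (n + m)} {s1 : Perm (Fin n)} {s2 : Perm (Fin m)}
    (h1 : ∀ i, u.right (Fin.castAddOrderEmb m i) = Fin.castAddOrderEmb m (s1 i))
    (h2 : ∀ i, u.right (Fin.natAddOrderEmb n i) = Fin.natAddOrderEmb n (s2 i)) :
    ∃ x y, inL n m x * inR n m y = u := by
  let x : BG Γ n := ⟨(fun i => u.left.1 (Fin.castAddOrderEmb m i),
    ⟨u.left.2.sgn, fun i => u.left.2.supp (Fin.castAddOrderEmb m i)⟩), s1⟩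
  let y : BG Γ m := ⟨(fun i => u.left.1 (Fin.natAddOrderEmb n i),
    ⟨0, fun i => u.left.2.supp (Fin.natAddOrderEmb n i)⟩), s2⟩
  refine ⟨x, y, BG.ext' ?_ (PiGrp.ext ?_ ?_) ?_⟩
  · funext i
    revert i
    exact block_cases (fun i => mul_left_fst_left x y i) fun i => mul_left_fst_right x y i
  · rw [mul_sgn_block]; exact add_zero _
  · funext i
    revert i
    exact block_cases (fun i => mul_supp_left x y i) fun i => mul_supp_right x y i
  · refine Equiv.ext fun i => ?_
    revert i
    exact block_cases (fun i => (mul_perm_left x y i).trans (h1 i).symm)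
      fun i => (mul_perm_right x y i).trans (h2 i).symm

/-- The elements `x y` with `x` and `y` supported on complementary positions are those whose
permutation preserves the positions of `x`. -/
theorem Compl.exists_iff (h : Compl e e') (u : BG Γ N) :
    (∃ x y, embed e x * embed e' y = u) ↔ ∀ i, u.right (e i) ∈ Set.range e := by
  refine ⟨?_, fun hu => ?_⟩
  · rintro ⟨x, y, rfl⟩ i
    exact ⟨_, (embed_mul_right_left h x y i).symm⟩
  · obtain ⟨s1, s2, hs1, hs2⟩ := h.preserves hu
    obtain rfl := h.card
    obtain ⟨t, h1, h2⟩ := h.exists_perm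
    have : ∃ x y, inL n m x * inR n m y = (BG.perm t)⁻¹ * u * BG.perm t := by
      refine exists_block (s1 := s1) (s2 := s2) (fun i => ?_) fun i => ?_
      · change t⁻¹ (u.right (t _)) = _
        rw [h1, hs1, ← h1]; simp
      · change t⁻¹ (u.right (t _)) = _
        rw [h2, hs2, ← h2]; simp
    obtain ⟨x, y, hxy⟩ := this
    refine ⟨x, y, ?_⟩
    rw [embed_mul_embed h1 h2, hxy]
    group

theorem embed_zc_mul_embed_zc_mul (e : Fin n ↪o Fin N) (e' : Fin m ↪o Fin N) (x : BG Γ n) (y : BG Γ m) (c : ZMod 2) :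
    embed e (BG.zc c * x) * embed e' (BG.zc c * y) = embed e x * embed e' y := by
  rw [map_mul, map_mul, embed_zc, embed_zc, mul_assoc, ← mul_assoc _ (BG.zc c), BG.zc_comm,
    mul_assoc, ← mul_assoc, zc_mul_zc, CharTwo.add_self_eq_zero, BG.zc_zero, one_mul]

end Pairs

/-! ### Outer tensor products on sets of positions and the induction formula -/

section Tens

variable {n m N : ℕ}

/-- The function `x y ↦ F(x) G(y)` for `x` and `y` supported on the positions of `e` and `e'`,
extended by zero. -/
def tens (e : Fin n ↪o Fin N) (e' : Fin m ↪o Fin N) (F : Rm Γ n) (G : Rm Γ m) : BG Γ N → ℂ :=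
  Function.extend (fun p : BG Γ n × BG Γ m => embed e p.1 * embed e' p.2)
    (fun p => F.1 p.1 * G.1 p.2) 0

variable {e : Fin n ↪o Fin N} {e' : Fin m ↪o Fin N}

/-- Two factorizations of an element differ by a common power of `z`, whose signs in `F` and `G`
cancel. This is what makes `tens` well defined. -/
theorem tens_apply (h : Compl e e') (F : Rm Γ n) (G : Rm Γ m) (x : BG Γ n) (y : BG Γ m) :
    tens e e' F G (embed e x * embed e' y) = F.1 x * G.1 y := by
  refine Function.FactorsThrough.extend_apply (f := fun p : BG Γ n × BG Γ m =>
    embed e p.1 * embed e' p.2) (g := fun p => F.1 p.1 * G.1 p.2) ?_ 0 (x, y)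
  rintro ⟨x, y⟩ ⟨x', y'⟩ hp
  obtain ⟨c, rfl, rfl⟩ := h.unique hp
  dsimp only
  rw [spin_zc F.2.2.1, spin_zc G.2.2.1, mul_mul_mul_comm, neg_one_pow_val_mul, one_mul]

theorem tens_eq_zero (F : Rm Γ n) (G : Rm Γ m) {u : BG Γ N}
    (hu : ¬ ∃ x y, embed e x * embed e' y = u) : tens e e' F G u = 0 := by
  refine Function.extend_apply' _ _ _ ?_
  rintro ⟨⟨x, y⟩, hp⟩
  exact hu ⟨x, y, hp⟩

/-- Both functions vanish on odd elements, so on the support of `tens` the two factors are even and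
commute with everything in the other block. -/
theorem tens_ne_zero (h : Compl e e') {F : Rm Γ n} {G : Rm Γ m} {u : BG Γ N}
    (hu : tens e e' F G u ≠ 0) : ∃ x y, embed e x * embed e' y = u ∧ BG.parity x = 0 ∧
      BG.parity y = 0 := by
  by_contra hc
  refine hu ?_
  by_cases hu' : ∃ x y, embed e x * embed e' y = u
  · obtain ⟨x, y, rfl⟩ := hu'
    rw [tens_apply h]
    by_cases hx : BG.parity x = 0
    · rw [G.2.2.2 y (parity_eq_one fun hy => hc ⟨x, y, rfl, hx, hy⟩), mul_zero]
    · rw [F.2.2.2 x (parity_eq_one hx), zero_mul]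
  · exact tens_eq_zero F G hu'

/-- Where `tens` is non-zero the factors are even, so conjugation by `a b` acts on each factor
separately and the class function property of `F` and `G` applies. If the value at `u` were zero and
the one at the conjugate were not, conjugating back by `t⁻¹` would contradict this. -/
theorem tens_conj (h : Compl e e') (F : Rm Γ n) (G : Rm Γ m) {t : BG Γ N}
    (ht : ∃ x y, embed e x * embed e' y = t) (u : BG Γ N) :
    tens e e' F G (t * u * t⁻¹) = tens e e' F G u := by
  have key {t : BG Γ N} (ht : ∃ x y, embed e x * embed e' y = t) {u : BG Γ N}
      (hu : tens e e' F G u ≠ 0) : tens e e' F G (t * u * t⁻¹) = tens e e' F G u := by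
    obtain ⟨a, b, rfl⟩ := ht
    obtain ⟨x, y, rfl, hx, hy⟩ := tens_ne_zero h hu
    have h1 : embed e' b * embed e x = embed e x * embed e' b := by
      rw [h.embed_comm, hx, zero_mul, BG.zc_zero, one_mul]
    have h2 : embed e' (b * y * b⁻¹) * (embed e a)⁻¹ = (embed e a)⁻¹ * embed e' (b * y * b⁻¹) := by
      rw [← map_inv, h.embed_comm, BG.parity_conj, hy, mul_zero, BG.zc_zero, one_mul]
    have h3 : embed e a * embed e' b * (embed e x * embed e' y) * (embed e a * embed e' b)⁻¹ =
        embed e (a * x * a⁻¹) * embed e' (b * y * b⁻¹) := by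
      calc _ = embed e a * (embed e' b * embed e x) * embed e' y * (embed e' b)⁻¹ *
            (embed e a)⁻¹ := by group
        _ = embed e a * embed e x * (embed e' (b * y * b⁻¹) * (embed e a)⁻¹) := by
          rw [h1]; simp only [map_mul, map_inv]; group
        _ = _ := by rw [h2]; simp only [map_mul, map_inv]; group
    rw [h3, tens_apply h, tens_apply h, F.2.1, G.2.1]
  by_cases hu : tens e e' F G u = 0
  · by_contra hc
    rw [hu] at hc
    have ht' : ∃ x y, embed e x * embed e' y = t⁻¹ := by
      rw [h.exists_iff] at ht ⊢
      intro i
      obtain ⟨s1, s2, h1, -⟩ := h.preserves ht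
      refine ⟨s1⁻¹ i, ?_⟩
      change _ = t.right⁻¹ _
      rw [eq_comm, Equiv.Perm.inv_eq_iff_eq, h1]; simp
    have h1 := key ht' hc
    rw [show t⁻¹ * (t * u * t⁻¹) * t⁻¹⁻¹ = u by group, hu] at h1
    exact hc h1.symm
  · exact key ht hu

/-- Conjugation by the shuffle identifies the summand of any set of positions with the standard one;
this is how cosets of the spin product become subsets. -/
theorem tens_perm {e : Fin n ↪o Fin (n + m)} {e' : Fin m ↪o Fin (n + m)} (h : Compl e e')
    {t : Perm (Fin (n + m))} (h1 : ∀ i, t (Fin.castAddOrderEmb m i) = e i)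
    (h2 : ∀ i, t (Fin.natAddOrderEmb n i) = e' i) (F : Rm Γ n) (G : Rm Γ m) (u : BG Γ (n + m)) :
    tens e e' F G u = tens (Fin.castAddOrderEmb m) (Fin.natAddOrderEmb n) F G
      ((BG.perm t)⁻¹ * u * BG.perm t) := by
  by_cases hu : ∃ x y, embed e x * embed e' y = u
  · obtain ⟨x, y, rfl⟩ := hu
    rw [tens_apply h, embed_mul_embed h1 h2]
    have : (BG.perm t)⁻¹ * (BG.perm t * (inL n m x * inR n m y) * (BG.perm t)⁻¹) * BG.perm t =
      inL n m x * inR n m y := by group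
    rw [this]
    exact (tens_apply compl_castAdd_natAdd F G x y).symm
  · rw [tens_eq_zero _ _ hu, tens_eq_zero]
    rintro ⟨x, y, hxy⟩
    refine hu ⟨x, y, ?_⟩
    rw [embed_mul_embed h1 h2]
    change BG.perm t * (embed _ x * embed _ y) * _ = _
    rw [hxy]
    group

/-- The order embedding of a set of positions. -/
abbrev emb (S : Finset (Fin N)) : Fin S.card ↪o Fin N := S.orderEmbOfFin rfl

theorem compl_emb (S : Finset (Fin N)) : Compl (emb S) (emb Sᶜ) := by
  rw [Compl, emb, emb, Finset.range_orderEmbOfFin, Finset.range_orderEmbOfFin, Finset.coe_compl]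
  exact isCompl_compl

/-- The outer tensor product of two families of spin super class functions on the positions `S` and
their complement. -/
def tensS (F G : ∀ n, Rm Γ n) (S : Finset (Fin N)) : BG Γ N → ℂ :=
  tens (emb S) (emb Sᶜ) (F _) (G _)

/-- An order embedding is determined by its range, so the pair `e`, `e'` depends only on `S`. Taking
families `F`, `G` over all degrees lets the degrees be cardinalities without any transport between
equal numbers. -/
theorem tensS_eq (F G : ∀ n, Rm Γ n) {S : Finset (Fin N)} (h : Compl e e')
    (hS : Set.range e = S) : tensS F G S = tens e e' (F n) (G m) := by
  have hS' : Set.range e' = (Sᶜ : Finset (Fin N)) := by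
    rw [Finset.coe_compl, ← hS]
    exact h.compl_eq.symm
  have card {k : ℕ} {f : Fin k ↪o Fin N} {T : Finset (Fin N)} (hT : Set.range f = T) :
      T.card = k := by
    rw [← Set.ncard_coe_finset, ← hT, Set.ncard_range_of_injective f.injective]
    simp
  obtain rfl := card hS
  obtain rfl := card hS'
  have h1 : e = emb S := Finset.orderEmbOfFin_unique' rfl fun i => by
    rw [← Finset.mem_coe, ← hS]; exact ⟨i, rfl⟩
  have h2 : e' = emb Sᶜ := Finset.orderEmbOfFin_unique' rfl fun i => by
    rw [← Finset.mem_coe, ← hS']; exact ⟨i, rfl⟩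
  rw [h1, h2]
  rfl

theorem mem_spinProd_iff (u : BG Γ (n + m)) : u ∈ spinProd Γ n m ↔
    ∀ i, u.right (Fin.castAddOrderEmb m i) ∈ Set.range (Fin.castAddOrderEmb (n := n) m) :=
  compl_castAdd_natAdd.exists_iff u

theorem compl_of_card {S : Finset (Fin N)} (h1 : S.card = n) (h2 : Sᶜ.card = m) :
    Compl (S.orderEmbOfFin h1) (Sᶜ.orderEmbOfFin h2) := by
  rw [Compl, Finset.range_orderEmbOfFin, Finset.range_orderEmbOfFin, Finset.coe_compl]
  exact isCompl_compl

-- Sort the elements `t` by the set `S` to which they carry the first `n` positions. The fibre over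
-- `S` is a left coset of the spin product, represented by the shuffle of `S`. By `tens_conj` all
-- its terms agree, so the factor `1/|H|` cancels and one term per `S` remains.
open Classical in
theorem ind_outer [Fintype Γ] (F G : ∀ n, Rm Γ n) (u : BG Γ (n + m)) :
    ind (spinProd Γ n m) (outer (F n).1 (G m).1) u =
      ∑ S ∈ Finset.powersetCard n Finset.univ, tensS F G S u := by
  set T := tens (Fin.castAddOrderEmb m) (Fin.natAddOrderEmb n) (F n) (G m) with hT
  have h0 (v : BG Γ (n + m)) : (if h : v ∈ spinProd Γ n m then
      outer (F n).1 (G m).1 ⟨v, h⟩ else 0) = T v := by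
    split_ifs with h
    · obtain ⟨x, y, hxy⟩ := id h
      rw [outer_eq (F n).2.2.1 (G m).2.2.1 ⟨v, h⟩ hxy, ← hxy]
      exact (tens_apply compl_castAdd_natAdd _ _ x y).symm
    · exact (tens_eq_zero _ _ h).symm
  set S0 : Finset (Fin (n + m)) := Finset.univ.map (Fin.castAddOrderEmb (n := n) m).toEmbedding
  have hS0 : (S0 : Set (Fin (n + m))) = Set.range (Fin.castAddOrderEmb (n := n) m) := by
    simp [S0]
    rfl
  have hmem {i : Fin (n + m)} : i ∈ S0 ↔ i ∈ Set.range (Fin.castAddOrderEmb (n := n) m) := by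
    rw [← hS0]; rfl
  let st (t : BG Γ (n + m)) : Finset (Fin (n + m)) := S0.map t.right.toEmbedding
  have hst (t : BG Γ (n + m)) : st t ∈ Finset.powersetCard n Finset.univ := by
    rw [Finset.mem_powersetCard]
    refine ⟨Finset.subset_univ _, ?_⟩
    rw [Finset.card_map, Finset.card_map, Finset.card_univ, Fintype.card_fin]
  unfold ind
  simp only [h0]
  rw [← Finset.sum_fiberwise_of_maps_to (fun t _ => hst t), Finset.mul_sum]
  refine Finset.sum_congr rfl fun S hS => ?_
  have h1 : S.card = n := (Finset.mem_powersetCard.1 hS).2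
  have h2 : Sᶜ.card = m := by rw [Finset.card_compl, h1, Fintype.card_fin]; omega
  have hc := compl_of_card h1 h2
  obtain ⟨s, hs1, hs2⟩ := hc.exists_perm
  have hstab (t : BG Γ (n + m)) : st t = S ↔ (BG.perm s)⁻¹ * t ∈ spinProd Γ n m := by
    have hsS : S0.map s.toEmbedding = S := by
      refine Finset.coe_injective ?_
      rw [Finset.coe_map, hS0, ← Finset.range_orderEmbOfFin S h1, ← Set.range_comp]
      exact congrArg Set.range (funext hs1)
    rw [mem_spinProd_iff]
    change _ ↔ ∀ i, s⁻¹ (t.right _) ∈ _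
    constructor
    · intro h i
      have : t.right (Fin.castAddOrderEmb m i) ∈ st t :=
        Finset.mem_map_of_mem _ (hmem.2 ⟨i, rfl⟩)
      rw [h, ← hsS, Finset.mem_map] at this
      obtain ⟨j, hj, hj'⟩ := this
      rw [← hj', ← hmem]
      simpa using hj
    · intro h
      refine Finset.eq_of_subset_of_card_le ?_ ?_
      · intro j hj
        obtain ⟨k, hk, rfl⟩ := Finset.mem_map.1 hj
        obtain ⟨i, rfl⟩ := hmem.1 hk
        rw [← hsS, Finset.mem_map]
        exact ⟨_, hmem.2 (h i), by simp⟩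
      · rw [h1, (Finset.mem_powersetCard.1 (hst t)).2]
  have hterm : ∀ t ∈ Finset.univ.filter (fun t => st t = S), T (t⁻¹ * u * t) = tensS F G S u := by
    intro t ht
    rw [Finset.mem_filter, hstab] at ht
    rw [tensS_eq F G hc (Finset.range_orderEmbOfFin _ _), tens_perm hc hs1 hs2, ← hT]
    have := tens_conj compl_castAdd_natAdd (F n) (G m) (t := (BG.perm s)⁻¹ * t) ht.2
      (t⁻¹ * u * t)
    rw [← hT] at this
    rw [← this]
    congr 1
    group
  have hcard : (Finset.univ.filter (fun t : BG Γ (n + m) => st t = S)).card =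
      Nat.card (spinProd Γ n m) := by
    rw [← Fintype.card_subtype, ← Nat.card_eq_fintype_card]
    refine Nat.card_congr ((Equiv.mulLeft (BG.perm s)⁻¹).subtypeEquiv fun t => ?_)
    exact hstab t
  rw [Finset.sum_congr rfl hterm, Finset.sum_const, hcard, nsmul_eq_mul, ← mul_assoc,
    inv_mul_cancel₀, one_mul]
  simp

open Classical in
/-- A sum over the elements `x y` with `x`, `y` supported on complementary positions. -/
theorem Compl.sum_eq [Fintype Γ] (h : Compl e e') (f : BG Γ N → ℂ)
    (hf : ∀ u, (¬ ∃ x y, embed e x * embed e' y = u) → f u = 0) :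
    ∑ u, f u = 2⁻¹ * ∑ x, ∑ y, f (embed e x * embed e' y) := by
  rw [← Fintype.sum_prod_type' (f := fun x y => f (embed e x * embed e' y)),
    ← Finset.sum_fiberwise (g := fun p : BG Γ n × BG Γ m => embed e p.1 * embed e' p.2),
    Finset.mul_sum]
  refine Finset.sum_congr rfl fun u _ => ?_
  by_cases hu : ∃ x y, embed e x * embed e' y = u
  · have h1 : ∀ p ∈ Finset.univ.filter (fun p : BG Γ n × BG Γ m => embed e p.1 * embed e' p.2 = u),
        f (embed e p.1 * embed e' p.2) = f u := by
      intro p hp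
      rw [(Finset.mem_filter.1 hp).2]
    rw [Finset.sum_congr rfl h1, Finset.sum_const, nsmul_eq_mul]
    obtain ⟨x, y, hxy⟩ := hu
    -- Every fibre of `(x, y) ↦ x y` consists of exactly two pairs, `(x, y)` and `(z x, z y)`; hence
    -- the factor `2⁻¹`.
    have h2 : Finset.univ.filter (fun p : BG Γ n × BG Γ m => embed e p.1 * embed e' p.2 = u) =
        Finset.univ.image fun c : ZMod 2 => (BG.zc c * x, BG.zc c * y) := by
      ext ⟨x', y'⟩
      rw [Finset.mem_filter, Finset.mem_image, and_iff_right (Finset.mem_univ _)]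
      constructor
      · intro hp
        obtain ⟨c, hc1, hc2⟩ := h.unique (hxy.trans hp.symm)
        exact ⟨c, Finset.mem_univ _, Prod.ext hc1.symm hc2.symm⟩
      · rintro ⟨c, -, hc⟩
        rw [← (Prod.ext_iff.1 hc).1, ← (Prod.ext_iff.1 hc).2]
        exact (embed_zc_mul_embed_zc_mul e e' x y c).trans hxy
    rw [h2, Finset.card_image_of_injective, Finset.card_univ, ZMod.card]
    · push_cast; ring
    · intro c d hcd
      have h3 := congrArg (fun p : BG Γ n × BG Γ m => p.1.left.2.sgn) hcd
      simp only [BG.zc_mul_left_snd] at h3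
      exact add_left_cancel h3
  · rw [hf u hu, Finset.sum_eq_zero, mul_zero]
    intro p hp
    exact absurd ⟨p.1, p.2, (Finset.mem_filter.1 hp).2⟩ hu

end Tens

/-! ### The characters `χ_n(γ)` on products -/

section Eta

variable {n m N : ℕ}

/-- Conjugation by `x ^ k` fixes `x` and moves the base point along its cycle, so the two cycle
products are conjugate in `Γ`. -/
theorem cycleProd_sameCycle (γ : ClassFun Γ) (x : BG Γ n) {i j : Fin n}
    (h : Perm.SameCycle x.right i j) : γ.1 (cycleProd x i) = γ.1 (cycleProd x j) := by
  obtain ⟨k, rfl⟩ := h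
  have h1 : x ^ k * x * (x ^ k)⁻¹ = x := by group
  have h2 : (x ^ k).right = x.right ^ k := map_zpow SemidirectProduct.rightHom x k
  have h3 := cycleProd_conj (x ^ k) x i
  rw [h1, h2] at h3
  rw [h3]
  exact (γ.2 _ _).symm

/-- The value of `γ` at the cycle product of a cycle. -/
def cycleVal (γ : ClassFun Γ) (x : BG Γ n) : Quotient (Perm.SameCycle.setoid x.right) → ℂ :=
  Quotient.lift (fun i => γ.1 (cycleProd x i)) fun _ _ h => cycleProd_sameCycle γ x h

/-- Frees `eta` from the chosen representatives `c.out`, so that bijections between sets of cycles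
can be applied to it. -/
theorem eta_eq (γ : ClassFun Γ) (x : BG Γ n) : eta γ x = ∏ᶠ c, cycleVal γ x c := by
  refine finprod_congr fun c => ?_
  conv_rhs => rw [← Quotient.out_eq c]
  rfl

theorem semiconj_pow {s : Perm (Fin n)} {u : Perm (Fin N)} {e : Fin n ↪o Fin N}
    (h : ∀ i, u (e i) = e (s i)) (k : ℕ) (i : Fin n) : (u ^ k) (e i) = e ((s ^ k) i) := by
  induction k with
  | zero => rfl
  | succ k ih => rw [pow_succ', pow_succ', Perm.mul_apply, ih, h]; rfl

theorem semiconj_inv {s : Perm (Fin n)} {u : Perm (Fin N)} {e : Fin n ↪o Fin N}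
    (h : ∀ i, u (e i) = e (s i)) (i : Fin n) : u⁻¹ (e i) = e (s⁻¹ i) := by
  rw [Perm.inv_eq_iff_eq, h]; simp

theorem semiconj_sameCycle {s : Perm (Fin n)} {u : Perm (Fin N)} {e : Fin n ↪o Fin N}
    (h : ∀ i, u (e i) = e (s i)) (i j : Fin n) :
    Perm.SameCycle u (e i) (e j) ↔ Perm.SameCycle s i j := by
  constructor
  · intro hc
    obtain ⟨k, -, hk⟩ := hc.exists_pow_eq'
    rw [semiconj_pow h] at hk
    exact ⟨k, by rw [zpow_natCast]; exact e.injective hk⟩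
  · intro hc
    obtain ⟨k, -, hk⟩ := hc.exists_pow_eq'
    exact ⟨k, by rw [zpow_natCast, semiconj_pow h, hk]⟩

theorem cycleProd_semiconj {x : BG Γ n} {u : BG Γ N} {e : Fin n ↪o Fin N}
    (h : ∀ i, u.right (e i) = e (x.right i)) (h' : ∀ i, u.left.1 (e i) = x.left.1 i) (i : Fin n) :
    cycleProd u (e i) = cycleProd x i := by
  have hper : Function.minimalPeriod u.right (e i) = Function.minimalPeriod x.right i := by
    rw [Function.minimalPeriod_eq_minimalPeriod_iff]
    intro k
    simp only [Function.IsPeriodicPt, Function.IsFixedPt, ← Equiv.Perm.coe_pow, semiconj_pow h,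
      EmbeddingLike.apply_eq_iff_eq]
  unfold cycleProd
  rw [hper]
  congr 1
  refine List.map_congr_left fun j _ => ?_
  rw [semiconj_pow (semiconj_inv h), h']

variable {e : Fin n ↪o Fin N} {e' : Fin m ↪o Fin N}

/-- The cycles of the product are the disjoint union of those of `x` and of `y`, each with its old
cycle product. -/
theorem Compl.eta_mul (h : Compl e e') (γ : ClassFun Γ) (x : BG Γ n) (y : BG Γ m) :
    eta γ (embed e x * embed e' y) = eta γ x * eta γ y := by
  classical
  set u := embed e x * embed e' y with hu
  have h1 (i : Fin n) : u.right (e i) = e (x.right i) := embed_mul_right_left h x y i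
  have h2 (i : Fin m) : u.right (e' i) = e' (y.right i) := embed_mul_right_right h x y i
  have v1 (i : Fin n) : cycleProd u (e i) = cycleProd x i :=
    cycleProd_semiconj h1 (fun i => embed_mul_left_left h x y i) i
  have v2 (i : Fin m) : cycleProd u (e' i) = cycleProd y i :=
    cycleProd_semiconj h2 (fun i => embed_mul_left_right h x y i) i
  let f1 : Quotient (Perm.SameCycle.setoid x.right) → Quotient (Perm.SameCycle.setoid u.right) :=
    Quotient.map e fun i j hij => (semiconj_sameCycle h1 i j).2 hij
  let f2 : Quotient (Perm.SameCycle.setoid y.right) → Quotient (Perm.SameCycle.setoid u.right) :=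
    Quotient.map e' fun i j hij => (semiconj_sameCycle h2 i j).2 hij
  have hne (i : Fin n) (j : Fin m) : ¬ Perm.SameCycle u.right (e i) (e' j) := by
    intro hc
    obtain ⟨k, -, hk⟩ := hc.exists_pow_eq'
    rw [semiconj_pow h1] at hk
    exact h.notMem_left j ⟨_, hk⟩
  have hbij : Function.Bijective (Sum.elim f1 f2) := by
    constructor
    · rintro (a | a) (b | b)
      · induction a, b using Quotient.inductionOn₂ with | _ a b
        intro hab
        exact congrArg _ (Quotient.sound ((semiconj_sameCycle h1 a b).1 (Quotient.exact hab)))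
      · induction a, b using Quotient.inductionOn₂ with | _ a b
        intro hab
        exact absurd (Quotient.exact hab) (hne a b)
      · induction a, b using Quotient.inductionOn₂ with | _ a b
        intro hab
        exact absurd (Quotient.exact hab.symm) (hne b a)
      · induction a, b using Quotient.inductionOn₂ with | _ a b
        intro hab
        exact congrArg _ (Quotient.sound ((semiconj_sameCycle h2 a b).1 (Quotient.exact hab)))
    · intro c
      induction c using Quotient.inductionOn with | _ c
      revert c
      exact h.cases (fun i => ⟨Sum.inl ⟦i⟧, rfl⟩) fun i => ⟨Sum.inr ⟦i⟧, rfl⟩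
  rw [eta_eq, eta_eq, eta_eq, ← finprod_comp_equiv (Equiv.ofBijective _ hbij),
    finprod_eq_prod_of_fintype, finprod_eq_prod_of_fintype, finprod_eq_prod_of_fintype,
    Fintype.prod_sum_type]
  congr 1
  · refine Finset.prod_congr rfl fun c _ => ?_
    induction c using Quotient.inductionOn with | _ c
    exact congrArg γ.1 (v1 c)
  · refine Finset.prod_congr rfl fun c _ => ?_
    induction c using Quotient.inductionOn with | _ c
    exact congrArg γ.1 (v2 c)

end Eta

/-! ### The signed permutation action on the Clifford basis and multiplicativity of `χ_n` -/

section Clifford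

variable {n m N : ℕ}

/-- The action of `Γ̃_n` on `Π_n` that lifts the one on the basis of the Clifford algebra. -/
def piAct (x : BG Γ n) (q : PiGrp n) : PiGrp n := x.left.2 * PiGrp.permFun x.right q

theorem piAct_mul (x y : BG Γ n) (q : PiGrp n) : piAct (x * y) q = piAct x (piAct y q) := by
  change x.left.2 * PiGrp.permFun x.right y.left.2 * PiGrp.permFun (x.right * y.right) q = _
  rw [PiGrp.permFun_permFun, mul_assoc, ← PiGrp.permFun_mul]
  rfl

theorem piAct_one (q : PiGrp n) : piAct (1 : BG Γ n) q = q := by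
  change 1 * PiGrp.permFun 1 q = q
  rw [PiGrp.permFun_one, one_mul]

theorem piAct_mul_right (x : BG Γ n) (q r : PiGrp n) :
    piAct x (q * r) = piAct x q * PiGrp.permFun x.right r := by
  rw [piAct, PiGrp.permFun_mul, ← mul_assoc]; rfl

theorem piAct_add_sgn (x : BG Γ n) (q : PiGrp n) (c : ZMod 2) :
    piAct x ⟨q.sgn + c, q.supp⟩ = ⟨(piAct x q).sgn + c, (piAct x q).supp⟩ := by
  refine PiGrp.ext ?_ rfl
  simp only [piAct, PiGrp.mul_sgn, PiGrp.permFun]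
  ring

/-- The diagonal matrix coefficient of `x` at the basis element `e_I` of the Clifford algebra. -/
def cliffCoeff (x : BG Γ n) (I : Fin n → ZMod 2) : ℂ :=
  open Classical in if (piAct x ⟨0, I⟩).supp = I then (-1) ^ (piAct x ⟨0, I⟩).sgn.val else 0

theorem chiBasic_eq (x : BG Γ n) : chiBasic x = ∑ I, cliffCoeff x I := by
  classical
  unfold chiBasic Representation.character
  rw [LinearMap.trace_eq_matrix_trace ℂ (Finsupp.basisSingleOne), Matrix.trace]
  refine Finset.sum_congr rfl fun I _ => ?_
  rw [Matrix.diag_apply, LinearMap.toMatrix_apply, Finsupp.coe_basisSingleOne,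
    cliffordRep_single]
  simp only [Finsupp.basisSingleOne_repr, LinearEquiv.refl_apply]
  rw [Finsupp.single_apply, one_mul]
  rfl

theorem neg_one_pow_val_add (a b : ZMod 2) :
    ((-1 : ℂ)) ^ (a + b).val = (-1) ^ a.val * (-1) ^ b.val := by
  have h0 : (0 : ZMod 2).val = 0 := rfl
  have h1 : (1 : ZMod 2).val = 1 := rfl
  have h3 : (1 + 1 : ZMod 2) = 0 := rfl
  refine zc_cases (P := fun a => ((-1 : ℂ)) ^ (a + b).val = (-1) ^ a.val * (-1) ^ b.val) ?_ ?_ a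
  · simp
  · refine zc_cases (P := fun b => ((-1 : ℂ)) ^ (1 + b).val = (-1) ^ _ * (-1) ^ b.val) ?_ ?_ b
    · simp
    · rw [h3, h0, h1]; norm_num

/-- The matrix of `x` is a signed permutation matrix: if `x e_I = ± e_I`, then `x⁻¹ e_I` is `e_I`
with the same sign, and otherwise both diagonal entries vanish. -/
theorem cliffCoeff_inv (x : BG Γ n) (I : Fin n → ZMod 2) : cliffCoeff x⁻¹ I = cliffCoeff x I := by
  have key (x : BG Γ n) (h : (piAct x ⟨0, I⟩).supp = I) :
      piAct x⁻¹ ⟨0, I⟩ = ⟨(piAct x ⟨0, I⟩).sgn, I⟩ := by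
    have h1 : piAct x⁻¹ (piAct x ⟨0, I⟩) = ⟨0, I⟩ := by
      rw [← piAct_mul, inv_mul_cancel, piAct_one]
    have h2 : piAct x ⟨0, I⟩ = ⟨(0 : ZMod 2) + (piAct x ⟨0, I⟩).sgn, I⟩ :=
      PiGrp.ext (zero_add _).symm h
    rw [h2] at h1
    rw [piAct_add_sgn x⁻¹ ⟨0, I⟩] at h1
    have h3 := congrArg PiGrp.sgn h1
    have h4 := congrArg PiGrp.supp h1
    refine PiGrp.ext ?_ h4
    dsimp only at h3 ⊢
    exact CharTwo.add_eq_zero.1 h3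
  unfold cliffCoeff
  by_cases h : (piAct x ⟨0, I⟩).supp = I
  · rw [key x h, if_pos rfl, if_pos h]
  · rw [if_neg h, if_neg]
    intro h'
    have := key x⁻¹ h'
    rw [inv_inv] at this
    exact h (by rw [this])

theorem chiBasic_inv (x : BG Γ n) : chiBasic x⁻¹ = chiBasic x := by
  rw [chiBasic_eq, chiBasic_eq]
  exact Finset.sum_congr rfl fun I _ => cliffCoeff_inv x I

theorem cliffCoeff_perm (s : Perm (Fin n)) (I : Fin n → ZMod 2) :
    cliffCoeff (BG.perm s : BG Γ n) I = open Classical in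
      if (fun i => I (s⁻¹ i)) = I then (-1) ^ (PiGrp.inversions s I).val else 0 := by
  have h : piAct (BG.perm s : BG Γ n) ⟨0, I⟩ = ⟨PiGrp.inversions s I, fun i => I (s⁻¹ i)⟩ := by
    change 1 * PiGrp.permFun s ⟨0, I⟩ = _
    rw [one_mul]
    exact PiGrp.ext (zero_add _) rfl
  unfold cliffCoeff
  rw [h]

/-- With `s` the permutation of `x` one has `x (e_I e_J) = (x e_I) s(e_J)`. If `x e_I = ± e_I`, this
sign occurs twice and cancels. If also `s(J) = J`, the cocycle of `e_I e_J = ± e_{I+J}` occurs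
before and after the action and cancels too. Only the sign of `s` on `e_J` is left. -/
theorem mul_cliffCoeff_add (x : BG Γ n) (I J : Fin n → ZMod 2) :
    cliffCoeff x I * cliffCoeff x (I + J) = open Classical in
      if (piAct x ⟨0, I⟩).supp = I then cliffCoeff (BG.perm x.right : BG Γ n) J else 0 := by
  by_cases hI : (piAct x ⟨0, I⟩).supp = I
  · have h1 : piAct x ⟨0, I + J⟩ = ⟨(piAct x ⟨0, I⟩).sgn + PiGrp.inversions x.right J +
        PiGrp.cocycle I (fun i => J (x.right⁻¹ i)) + PiGrp.cocycle I J,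
        I + fun i => J (x.right⁻¹ i)⟩ := by
      have h2 : (⟨0, I⟩ * ⟨0, J⟩ : PiGrp n) = ⟨0 + PiGrp.cocycle I J, I + J⟩ := by
        refine PiGrp.ext ?_ rfl
        simp
      have h3 := piAct_add_sgn x ⟨0, I + J⟩ (PiGrp.cocycle I J)
      dsimp only at h3
      rw [← h2, piAct_mul_right] at h3
      have h4 := congrArg PiGrp.sgn h3
      have h5 := congrArg PiGrp.supp h3
      simp only [PiGrp.mul_sgn, PiGrp.mul_supp, hI, PiGrp.permFun, zero_add] at h4 h5
      refine PiGrp.ext ?_ h5.symm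
      dsimp only
      rw [h4, add_assoc, CharTwo.add_self_eq_zero, add_zero]
    rw [if_pos hI, cliffCoeff_perm]
    unfold cliffCoeff
    rw [h1, if_pos hI]
    by_cases hJ : (fun i => J (x.right⁻¹ i)) = J
    · rw [if_pos (by dsimp only; rw [hJ]), if_pos hJ]
      dsimp only
      rw [hJ, add_assoc _ (PiGrp.cocycle I J), CharTwo.add_self_eq_zero, add_zero,
        neg_one_pow_val_add, ← mul_assoc, neg_one_pow_val_mul, one_mul]
    · rw [if_neg (by simpa using hJ), if_neg hJ, mul_zero]
  · rw [if_neg hI]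
    unfold cliffCoeff
    rw [if_neg hI, zero_mul]

-- Write the second summation index as `I + J`. The sum over `J` is then the character of the bare
-- permutation and no longer depends on `I`, apart from the condition that `x` fixes `e_I` up to
-- sign.
open Classical in
theorem chiBasic_mul_inv (x : BG Γ n) : chiBasic x * chiBasic x⁻¹ =
    (∑ I : Fin n → ZMod 2, if (piAct x ⟨0, I⟩).supp = I then (1 : ℂ) else 0) *
      chiBasic (BG.perm x.right : BG Γ n) := by
  rw [chiBasic_inv, chiBasic_eq, chiBasic_eq, Finset.sum_mul, Finset.sum_mul]
  refine Finset.sum_congr rfl fun I _ => ?_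
  rw [← Equiv.sum_comp (Equiv.addLeft I) (cliffCoeff x), Finset.mul_sum, Finset.mul_sum]
  refine Finset.sum_congr rfl fun J _ => ?_
  rw [Equiv.coe_addLeft, mul_cliffCoeff_add]
  split_ifs <;> simp

/-- Averaging the product of the characters of the Clifford module and of its dual over `Π_n` gives
the character of its endomorphism algebra over `Π_n`. -/
theorem sum_chiBasic_mul_inv [Fintype Γ] (w : (Fin n → Γ) → Perm (Fin n) → ℂ) :
    ∑ x : BG Γ n, w x.left.1 x.right * (chiBasic x * chiBasic x⁻¹) =
      ∑ x : BG Γ n, w x.left.1 x.right * chiBasic (BG.perm x.right : BG Γ n) := by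
  classical
  have hsum (f : BG Γ n → ℂ) : ∑ x, f x = ∑ s, ∑ g, ∑ q, f ⟨(g, q), s⟩ := by
    rw [← SemidirectProduct.equivProd.symm.sum_comp, Fintype.sum_prod_type, Finset.sum_comm]
    refine Finset.sum_congr rfl fun s _ => ?_
    rw [Fintype.sum_prod_type]
    rfl
  rw [hsum, hsum]
  refine Finset.sum_congr rfl fun s _ => Finset.sum_congr rfl fun g _ => ?_
  dsimp only
  rw [← Finset.mul_sum, ← Finset.mul_sum]
  congr 1
  simp only [chiBasic_mul_inv]
  rw [← Finset.sum_mul, Finset.sum_const, nsmul_eq_mul]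
  congr 1
  rw [Finset.sum_comm]
  -- For given `I` and `s` the support of `q` is forced to be the difference of `I` and `s(I)`, and
  -- only its power of `z` is free.
  have h1 (I : Fin n → ZMod 2) : ∑ q : PiGrp n,
      (if (piAct (⟨(g, q), s⟩ : BG Γ n) ⟨0, I⟩).supp = I then (1 : ℂ) else 0) = 2 := by
    rw [← (PiGrp.equivProd n).symm.sum_comp, Fintype.sum_prod_type]
    have h2 (c : ZMod 2) (K : Fin n → ZMod 2) :
        (piAct (⟨(g, (PiGrp.equivProd n).symm (c, K)), s⟩ : BG Γ n) ⟨0, I⟩).supp = I ↔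
          K = I - fun i => I (s⁻¹ i) := by
      rw [eq_sub_iff_add_eq]; rfl
    simp only [h2, Finset.sum_ite_eq', Finset.mem_univ, if_true]
    simp
  rw [Finset.sum_congr rfl fun I _ => h1 I]
  -- Two choices of `q` for each of the `2 ^ n` indices `I` make up exactly the order of `Π_n`, the
  -- multiplicity on the right-hand side.
  have h3 : Finset.card (Finset.univ : Finset (PiGrp n)) = 2 * 2 ^ n := by
    rw [Finset.card_univ, Fintype.card_congr (PiGrp.equivProd n)]
    simp
  rw [h3]
  simp [mul_comm]

/-- On the basis `e_I e_J` adapted to the blocks, an even `y` passes `e_I` without a sign. Hence `x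
y e_I e_J = (x e_I)(y e_J)`, and diagonal entries multiply. -/
theorem chiBasic_inL_mul_inR (x : BG Γ n) {y : BG Γ m} (hy : BG.parity y = 0) :
    chiBasic (inL n m x * inR n m y) = chiBasic x * chiBasic y := by
  classical
  have hpi {k : ℕ} (z : BG Γ k) (I : Fin k → ZMod 2) :
      piAct z ⟨0, I⟩ = (z * (⟨(1, ⟨0, I⟩), 1⟩ : BG Γ k)).left.2 := rfl
  have hap (I : Fin n → ZMod 2) (J : Fin m → ZMod 2) :
      (⟨(1, ⟨0, Fin.append I J⟩), 1⟩ : BG Γ (n + m)) =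
        inL n m ⟨(1, ⟨0, I⟩), 1⟩ * inR n m ⟨(1, ⟨0, J⟩), 1⟩ := by
    refine BG.ext' ?_ (PiGrp.ext ?_ ?_) ?_
    · funext i
      revert i
      exact block_cases (fun i => (mul_left_fst_left (⟨(1, ⟨0, I⟩), 1⟩ : BG Γ n) ⟨(1, ⟨0, J⟩), 1⟩ i).symm)
        fun i => (mul_left_fst_right (⟨(1, ⟨0, I⟩), 1⟩ : BG Γ n) ⟨(1, ⟨0, J⟩), 1⟩ i).symm
    · rw [mul_sgn_block]; exact (add_zero _).symm
    · funext i
      revert i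
      refine block_cases (fun i => ?_) fun i => ?_
      · rw [mul_supp_left]; exact Fin.append_left I J i
      · rw [mul_supp_right]; exact Fin.append_right I J i
    · change 1 = (inL n m _).right * (inR n m _).right
      simp [inL, inR, embed_right]
  rw [chiBasic_eq, chiBasic_eq, chiBasic_eq, Finset.sum_mul_sum,
    ← (Fin.appendEquiv n m).sum_comp, Fintype.sum_prod_type]
  refine Finset.sum_congr rfl fun I _ => Finset.sum_congr rfl fun J _ => ?_
  have h1 : piAct (inL n m x * inR n m y) ⟨0, Fin.append I J⟩ =
      (inL n m (x * (⟨(1, ⟨0, I⟩), 1⟩ : BG Γ n)) *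
        inR n m (y * (⟨(1, ⟨0, J⟩), 1⟩ : BG Γ m))).left.2 := by
    rw [hpi, hap]
    congr 2
    rw [map_mul, map_mul, mul_assoc, ← mul_assoc (inR n m y), inR_mul_inL, hy, mul_zero, BG.zc_zero,
      one_mul]
    simp only [mul_assoc]
  change cliffCoeff _ (Fin.append I J) = _
  unfold cliffCoeff
  rw [h1, hpi, hpi, mul_sgn_block]
  set a := x * (⟨(1, ⟨0, I⟩), 1⟩ : BG Γ n)
  set b := y * (⟨(1, ⟨0, J⟩), 1⟩ : BG Γ m)
  have h2 : (inL n m a * inR n m b).left.2.supp = Fin.append I J ↔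
      a.left.2.supp = I ∧ b.left.2.supp = J := by
    constructor
    · intro h
      constructor
      · funext i
        rw [← mul_supp_left a b, h]; exact Fin.append_left I J i
      · funext i
        rw [← mul_supp_right a b, h]; exact Fin.append_right I J i
    · rintro ⟨h, h'⟩
      funext i
      revert i
      refine block_cases (fun i => ?_) fun i => ?_
      · rw [mul_supp_left, h]; exact (Fin.append_left I J i).symm
      · rw [mul_supp_right, h']; exact (Fin.append_right I J i).symm
  by_cases ha : a.left.2.supp = I
  · by_cases hb : b.left.2.supp = J
    · rw [if_pos (h2.2 ⟨ha, hb⟩), if_pos ha, if_pos hb, neg_one_pow_val_add]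
    · rw [if_neg fun h => hb (h2.1 h).2, if_neg hb, mul_zero]
  · rw [if_neg fun h => ha (h2.1 h).1, if_neg ha, zero_mul]

/-- The characters `χ_n(γ)` are multiplicative. -/
theorem Compl.chi_mul {e : Fin n ↪o Fin N} {e' : Fin m ↪o Fin N} (h : Compl e e') (γ : ClassFun Γ)
    (x : BG Γ n) (y : BG Γ m) :
    (chi N γ).1 (embed e x * embed e' y) = (chi n γ).1 x * (chi m γ).1 y := by
  by_cases hxy : BG.parity x = 0 ∧ BG.parity y = 0
  · obtain rfl := h.card
    rw [apply_inL_mul_inR h]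
    change eta γ _ * chiBasic _ = eta γ x * chiBasic x * (eta γ y * chiBasic y)
    rw [chiBasic_inL_mul_inR x hxy.2, inL, inR, compl_castAdd_natAdd.eta_mul]
    ring
  · rw [h.apply_eq_zero _ hxy]
    by_cases hx : BG.parity x = 0
    · rw [(chi m γ).2.2.2 y (parity_eq_one fun hy => hxy ⟨hx, hy⟩), mul_zero]
    · rw [(chi n γ).2.2.2 x (parity_eq_one hx), zero_mul]

end Clifford

/-! ### The commutation relation of `H_m(α)` and `H_{-n}(β)` -/

section TensLinear

variable {N : ℕ}

theorem tensS_zero (F G : ∀ n, Rm Γ n) (S : Finset (Fin N)) (hG : G Sᶜ.card = 0) (u : BG Γ N) :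
    tensS F G S u = 0 := by
  by_cases hu : ∃ x y, embed (emb S) x * embed (emb Sᶜ) y = u
  · obtain ⟨x, y, rfl⟩ := hu
    rw [tensS, tens_apply (compl_emb S), hG]
    exact mul_zero _
  · exact tens_eq_zero _ _ hu

theorem tensS_add (F G G' : ∀ n, Rm Γ n) (S : Finset (Fin N)) (u : BG Γ N) :
    tensS F (fun n => G n + G' n) S u = tensS F G S u + tensS F G' S u := by
  by_cases hu : ∃ x y, embed (emb S) x * embed (emb Sᶜ) y = u
  · obtain ⟨x, y, rfl⟩ := hu
    rw [tensS, tensS, tensS, tens_apply (compl_emb S), tens_apply (compl_emb S),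
      tens_apply (compl_emb S)]
    exact mul_add _ _ _
  · rw [tensS, tensS, tensS, tens_eq_zero _ _ hu, tens_eq_zero _ _ hu, tens_eq_zero _ _ hu, add_zero]

end TensLinear

section Operators

variable [Fintype Γ]

/-- By linearity this is `ind_outer` for homogeneous `F`; in the wrong degree both sides vanish by
counting the complement of `S`. The form holds in every degree `N`, with an empty sum when `N < n`.
-/
theorem Hcr_apply (n : ℕ) (γ : ClassFun Γ) (F : Fock Γ) (N : ℕ) (u : BG Γ N) :
    (Hcr n γ F N).1 u =
      ∑ S ∈ Finset.powersetCard n Finset.univ, tensS (fun k => chi k γ) (fun k => F k) S u := by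
  classical
  induction F using DirectSum.induction_on with
  | zero =>
    rw [map_zero]
    refine (Finset.sum_eq_zero fun S _ => ?_).symm
    exact tensS_zero _ _ _ rfl _
  | add F G hF hG =>
    rw [map_add]
    have h1 : ((Hcr n γ F + Hcr n γ G) N).1 u = (Hcr n γ F N).1 u + (Hcr n γ G N).1 u := rfl
    rw [h1, hF, hG, ← Finset.sum_add_distrib]
    exact Finset.sum_congr rfl fun S _ => (tensS_add _ _ _ _ _).symm
  | of m g =>
    have h1 : Hcr n γ (DirectSum.of (fun k => Rm Γ k) m g) =
        DirectSum.of (fun k => Rm Γ k) (n + m) (indMul (chi n γ) m g) := by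
      unfold Hcr
      rw [← DirectSum.lof_eq_of ℂ, DirectSum.toModule_lof]
      rfl
    rw [h1]
    by_cases hN : n + m = N
    · subst hN
      rw [DirectSum.of_eq_same,
        ← ind_outer (fun k => chi k γ) (fun k => DirectSum.of (fun k => Rm Γ k) m g k) u,
        DirectSum.of_eq_same]
      rfl
    · rw [DirectSum.of_eq_of_ne _ _ _ (Ne.symm hN)]
      refine (Finset.sum_eq_zero fun S hS => ?_).symm
      refine tensS_zero _ _ _ (DirectSum.of_eq_of_ne _ _ _ ?_) _
      have h2 := (Finset.mem_powersetCard.1 hS).2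
      have h3 := Finset.card_compl_add_card S
      rw [Fintype.card_fin] at h3
      omega

end Operators

/-! ### Sets of positions in two consecutive blocks -/

section Blocks

variable {a b m k : ℕ}

/-- The order embedding that is given by `f` on the first and by `g` on the second block. -/
def blockEmb (f : Fin a ↪o Fin m) (g : Fin b ↪o Fin k) : Fin (a + b) ↪o Fin (m + k) :=
  OrderEmbedding.ofStrictMono
    (Fin.addCases (fun i => Fin.castAdd k (f i)) fun i => Fin.natAdd m (g i)) (by
      intro i j
      refine Fin.addCases (fun i => ?_) (fun i => ?_) i <;>
        refine Fin.addCases (fun j => ?_) (fun j => ?_) j <;> intro h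
      · simp only [Fin.addCases_left]
        exact f.strictMono h
      · simp [Fin.lt_def]; omega
      · simp [Fin.lt_def] at h; omega
      · simpa using h)

variable (f : Fin a ↪o Fin m) (g : Fin b ↪o Fin k)

theorem blockEmb_castAdd (i : Fin a) :
    blockEmb f g (Fin.castAddOrderEmb b i) = Fin.castAddOrderEmb k (f i) := by
  exact Fin.addCases_left (motive := fun _ => Fin (m + k)) (left := fun i => Fin.castAdd k (f i))
    (right := fun i => Fin.natAdd m (g i)) i

theorem blockEmb_natAdd (i : Fin b) :
    blockEmb f g (Fin.natAddOrderEmb a i) = Fin.natAddOrderEmb m (g i) := by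
  exact Fin.addCases_right (motive := fun _ => Fin (m + k)) (left := fun i => Fin.castAdd k (f i))
    (right := fun i => Fin.natAdd m (g i)) i

theorem embed_blockEmb (x : BG Γ a) (y : BG Γ b) :
    embed (blockEmb f g) (inL a b x * inR a b y) = inL m k (embed f x) * inR m k (embed g y) := by
  rw [map_mul, inL, inR, inL, inR, embed_embed, embed_embed, embed_embed, embed_embed]
  have h1 : (Fin.castAddOrderEmb b).trans (blockEmb f g) = f.trans (Fin.castAddOrderEmb k) :=
    RelEmbedding.ext (blockEmb_castAdd f g)
  have h2 : (Fin.natAddOrderEmb a).trans (blockEmb f g) = g.trans (Fin.natAddOrderEmb m) :=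
    RelEmbedding.ext (blockEmb_natAdd f g)
  rw [h1, h2]

variable {f g} {a' b' : ℕ} {f' : Fin a' ↪o Fin m} {g' : Fin b' ↪o Fin k}

theorem Compl.block (h1 : Compl f f') (h2 : Compl g g') :
    Compl (blockEmb f g) (blockEmb f' g') := by
  refine IsCompl.of_eq ?_ ?_
  · refine Set.eq_empty_of_forall_notMem ?_
    rintro i ⟨⟨j, rfl⟩, ⟨l, hl⟩⟩
    revert j l
    refine block_cases (fun j => ?_) fun j => ?_ <;> refine block_cases (fun l => ?_) fun l => ?_ <;>
      simp only [blockEmb_castAdd, blockEmb_natAdd] <;> intro hl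
    · exact h1.notMem_right j ⟨l, (Fin.castAddOrderEmb k).injective hl⟩
    · exact SpinWreath.notMem_right (g' l) ⟨f j, hl.symm⟩
    · exact SpinWreath.notMem_right (g j) ⟨f' l, hl⟩
    · exact h2.notMem_right j ⟨l, (Fin.natAddOrderEmb m).injective hl⟩
  · refine Set.eq_univ_of_forall ?_
    refine block_cases ?_ ?_
    · exact h1.cases (fun i => Or.inl ⟨_, blockEmb_castAdd f g i⟩)
        fun i => Or.inr ⟨_, blockEmb_castAdd f' g' i⟩
    · exact h2.cases (fun i => Or.inl ⟨_, blockEmb_natAdd f g i⟩)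
        fun i => Or.inr ⟨_, blockEmb_natAdd f' g' i⟩

/-- The union of a set of positions in the first and one in the second block. -/
def blockSet (m k : ℕ) : Finset (Fin m) × Finset (Fin k) ≃ Finset (Fin (m + k)) :=
  Finset.sumEquiv.symm.toEquiv.trans finSumFinEquiv.finsetCongr

/-- Supplies the range condition of `tensS_eq`, so that the outer product attached to `A ⊔ T` can be
evaluated through block embeddings. -/
theorem range_blockEmb (A : Finset (Fin m)) (T : Finset (Fin k)) :
    Set.range (blockEmb (emb A) (emb T)) = blockSet m k (A, T) := by
  ext i
  have h1 (i : Fin m) : i ∈ Set.range (emb A) ↔ i ∈ A := by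
    rw [Finset.range_orderEmbOfFin]; rfl
  have h2 (i : Fin k) : i ∈ Set.range (emb T) ↔ i ∈ T := by
    rw [Finset.range_orderEmbOfFin]; rfl
  have h3 : i ∈ blockSet m k (A, T) ↔ finSumFinEquiv.symm i ∈ A.disjSum T := by
    change i ∈ (A.disjSum T).map _ ↔ _
    rw [Finset.mem_map_equiv]
  rw [Finset.mem_coe, h3]
  revert i
  refine block_cases (fun i _ => ?_) fun i _ => ?_
  · change _ ↔ finSumFinEquiv.symm (Fin.castAdd k i) ∈ _
    rw [finSumFinEquiv_symm_apply_castAdd, Finset.inl_mem_disjSum, ← h1]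
    constructor
    · rintro ⟨j, hj⟩
      revert j
      refine block_cases (fun j hj => ?_) fun j hj => ?_
      · rw [blockEmb_castAdd] at hj
        exact ⟨j, (Fin.castAddOrderEmb k).injective hj⟩
      · rw [blockEmb_natAdd] at hj
        exact absurd ⟨_, hj⟩ (notMem_left i)
    · rintro ⟨j, rfl⟩
      exact ⟨_, blockEmb_castAdd _ _ j⟩
  · change _ ↔ finSumFinEquiv.symm (Fin.natAdd m i) ∈ _
    rw [finSumFinEquiv_symm_apply_natAdd, Finset.inr_mem_disjSum, ← h2]
    constructor
    · rintro ⟨j, hj⟩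
      revert j
      refine block_cases (fun j hj => ?_) fun j hj => ?_
      · rw [blockEmb_castAdd] at hj
        exact absurd ⟨_, hj⟩ (notMem_right i)
      · rw [blockEmb_natAdd] at hj
        exact ⟨j, (Fin.natAddOrderEmb m).injective hj⟩
    · rintro ⟨j, rfl⟩
      exact ⟨_, blockEmb_natAdd _ _ j⟩

theorem card_blockSet (A : Finset (Fin m)) (T : Finset (Fin k)) :
    (blockSet m k (A, T)).card = A.card + T.card := by
  change ((A.disjSum T).map _).card = _
  rw [Finset.card_map, Finset.card_disjSum]

theorem tensS_blockSet (F G : ∀ n, Rm Γ n) (A : Finset (Fin m)) (T : Finset (Fin k)) :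
    tensS F G (blockSet m k (A, T)) = tens (blockEmb (emb A) (emb T)) (blockEmb (emb Aᶜ) (emb Tᶜ))
      (F (A.card + T.card)) (G (Aᶜ.card + Tᶜ.card)) :=
  tensS_eq F G ((compl_emb A).block (compl_emb T)) (range_blockEmb A T)

/-- Regroup `x₁ x₂ y₁ y₂` as `(x₁ y₁)(x₂ y₂)`. Exchanging `x₂` with `y₁` costs no sign because `x₂`
is even. -/
theorem tensS_blockSet_apply (F G : ∀ n, Rm Γ n) (A : Finset (Fin m)) (T : Finset (Fin k))
    (x₁ : BG Γ A.card) {x₂ : BG Γ Aᶜ.card} (y₁ : BG Γ T.card) (y₂ : BG Γ Tᶜ.card)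
    (hx₂ : BG.parity x₂ = 0) :
    tensS F G (blockSet m k (A, T)) (inL m k (embed (emb A) x₁ * embed (emb Aᶜ) x₂) *
      inR m k (embed (emb T) y₁ * embed (emb Tᶜ) y₂)) =
      (F _).1 (inL _ _ x₁ * inR _ _ y₁) * (G _).1 (inL _ _ x₂ * inR _ _ y₂) := by
  rw [tensS_blockSet, ← tens_apply ((compl_emb A).block (compl_emb T)), embed_blockEmb,
    embed_blockEmb]
  congr 1
  have h : inR m k (embed (emb T) y₁) * inL m k (embed (emb Aᶜ) x₂) =
      inL m k (embed (emb Aᶜ) x₂) * inR m k (embed (emb T) y₁) := by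
    rw [inR_mul_inL, parity_embed, hx₂, zero_mul, BG.zc_zero, one_mul]
  simp only [map_mul, mul_assoc]
  rw [← mul_assoc (inR m k (embed (emb T) y₁)), h]
  simp only [mul_assoc]

/-- If `x y` preserves `A ⊔ T`, then, as it also preserves the two blocks, `x` preserves `A` and `y`
preserves `T`. -/
theorem tensS_blockSet_eq_zero (F G : ∀ n, Rm Γ n) (A : Finset (Fin m)) (T : Finset (Fin k))
    {x : BG Γ m} {y : BG Γ k}
    (h : ¬ ((∃ x₁ x₂, embed (emb A) x₁ * embed (emb Aᶜ) x₂ = x) ∧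
      ∃ y₁ y₂, embed (emb T) y₁ * embed (emb Tᶜ) y₂ = y)) :
    tensS F G (blockSet m k (A, T)) (inL m k x * inR m k y) = 0 := by
  rw [tensS_blockSet]
  refine tens_eq_zero _ _ fun hu => h ?_
  rw [((compl_emb A).block (compl_emb T)).exists_iff] at hu
  rw [(compl_emb A).exists_iff, (compl_emb T).exists_iff]
  constructor
  · intro i
    have h1 := hu (Fin.castAddOrderEmb _ i)
    rw [blockEmb_castAdd, mul_perm_left] at h1
    obtain ⟨j, hj⟩ := h1
    revert j
    refine block_cases (fun j hj => ?_) fun j hj => ?_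
    · rw [blockEmb_castAdd] at hj
      exact ⟨j, (Fin.castAddOrderEmb k).injective hj⟩
    · rw [blockEmb_natAdd] at hj
      exact absurd ⟨_, hj⟩ (notMem_left _)
  · intro i
    have h1 := hu (Fin.natAddOrderEmb _ i)
    rw [blockEmb_natAdd, mul_perm_right] at h1
    obtain ⟨j, hj⟩ := h1
    revert j
    refine block_cases (fun j hj => ?_) fun j hj => ?_
    · rw [blockEmb_castAdd] at hj
      exact absurd ⟨_, hj⟩ (notMem_right _)
    · rw [blockEmb_natAdd] at hj
      exact ⟨j, (Fin.natAddOrderEmb m).injective hj⟩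

end Blocks

/-! ### The Mackey computation -/

section Commutation

variable [Fintype Γ]

theorem card_BG (n : ℕ) :
    Nat.card (BG Γ n) = Nat.card Γ ^ n * (2 * 2 ^ n) * n.factorial := by
  rw [Nat.card_congr SemidirectProduct.equivProd, Nat.card_prod, Nat.card_prod, Nat.card_fun,
    Nat.card_congr (PiGrp.equivProd n), Nat.card_prod, Nat.card_fun, Nat.card_perm]
  simp

/-- Orbit counting: the stabilizer of a set of `a` positions is a spin product, of half the order of
the direct product because the two elements `z` are identified, and there are `m.choose a` such
sets. -/
theorem card_BG_split {m a : ℕ} (h : a ≤ m) :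
    (m.choose a : ℂ) * (2⁻¹ * Nat.card (BG Γ a) * Nat.card (BG Γ (m - a))) =
      Nat.card (BG Γ m) := by
  obtain ⟨b, rfl⟩ := Nat.exists_eq_add_of_le h
  rw [Nat.add_sub_cancel_left, card_BG, card_BG, card_BG, ← Nat.add_choose_mul_factorial_mul_factorial,
    Nat.choose_symm_add]
  push_cast
  ring

theorem card_BG_ne_zero (n : ℕ) : (Nat.card (BG Γ n) : ℂ) ≠ 0 := by simp

theorem Han_val (ξ : ClassFun Γ) (m : ℕ) (α : ClassFun Γ) (F : Fock Γ) (k : ℕ) (y : BG Γ k) :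
    (Han ξ m α F k).1 y = (Nat.card (BG Γ m) : ℂ)⁻¹ *
      ∑ x, eta ξ x * (chi m α).1 x * (F (m + k)).1 (inL m k x⁻¹ * inR m k y) := rfl

/-- Only the `x = x₁ x₂` preserving `A` contribute. For these the weight, `χ_m(α)` and the outer
product all factor, so the sum over `x₁` pairs `χ(α)` with `χ(β)` on `A` and the sum over `x₂`
annihilates on the complement. The remaining constant is the order of the stabilizer of `A`. -/
theorem sum_tensS_blockSet (ξ α β : ClassFun Γ) {m k : ℕ} (F : Fock Γ) (A : Finset (Fin m))
    (T : Finset (Fin k)) (y : BG Γ k) :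
    ∑ x, eta ξ x * (chi m α).1 x * tensS (fun j => chi j β) (fun j => F j) (blockSet m k (A, T))
        (inL m k x⁻¹ * inR m k y) =
      2⁻¹ * Nat.card (BG Γ A.card) * Nat.card (BG Γ Aᶜ.card) *
        (wform ξ (chi A.card α).1 (chi A.card β).1 *
          tensS (fun j => chi j β) (fun j => Han ξ Aᶜ.card α F j) T y) := by
  by_cases hy : ∃ y₁ y₂, embed (emb T) y₁ * embed (emb Tᶜ) y₂ = y
  · obtain ⟨y₁, y₂, rfl⟩ := hy
    have hT : tensS (fun j => chi j β) (fun j => Han ξ Aᶜ.card α F j) T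
        (embed (emb T) y₁ * embed (emb Tᶜ) y₂) =
        (chi T.card β).1 y₁ * (Han ξ Aᶜ.card α F Tᶜ.card).1 y₂ := tens_apply (compl_emb T) _ _ _ _
    rw [hT, (compl_emb A).sum_eq]
    · have hterm (x₁ : BG Γ A.card) (x₂ : BG Γ Aᶜ.card) :
          eta ξ (embed (emb A) x₁ * embed (emb Aᶜ) x₂) *
            (chi m α).1 (embed (emb A) x₁ * embed (emb Aᶜ) x₂) *
            tensS (fun j => chi j β) (fun j => F j) (blockSet m k (A, T))
              (inL m k (embed (emb A) x₁ * embed (emb Aᶜ) x₂)⁻¹ *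
                inR m k (embed (emb T) y₁ * embed (emb Tᶜ) y₂)) =
          (eta ξ x₁ * (chi _ α).1 x₁ * (chi _ β).1 x₁⁻¹) * (chi _ β).1 y₁ *
            (eta ξ x₂ * (chi _ α).1 x₂ * (F (Aᶜ.card + Tᶜ.card)).1 (inL _ _ x₂⁻¹ * inR _ _ y₂)) := by
        rw [(compl_emb A).chi_mul, (compl_emb A).eta_mul]
        -- An odd `x₁` or `x₂` gives a vanishing value of `χ(α)` on both sides; even factors
        -- commute, so the inverse can be taken factorwise.
        by_cases h1 : BG.parity x₁ = 0
        · by_cases h2 : BG.parity x₂ = 0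
          · have hinv : (embed (emb A) x₁ * embed (emb Aᶜ) x₂)⁻¹ =
                embed (emb A) x₁⁻¹ * embed (emb Aᶜ) x₂⁻¹ := by
              rw [mul_inv_rev, ← map_inv, ← map_inv, (compl_emb A).embed_comm, BG.parity_inv, h1,
                zero_mul, BG.zc_zero, one_mul]
            rw [hinv, tensS_blockSet_apply _ _ _ _ _ _ _ (by rw [BG.parity_inv, h2]), inL, inR,
              compl_castAdd_natAdd.chi_mul]
            simp only [inL, inR]
            ring
          · rw [(chi _ α).2.2.2 x₂ (parity_eq_one h2)]; ring
        · rw [(chi _ α).2.2.2 x₁ (parity_eq_one h1)]; ring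
      simp only [hterm]
      rw [Han_val, wform, ← Finset.sum_mul_sum, ← Finset.sum_mul]
      have h1 := card_BG_ne_zero (Γ := Γ) A.card
      have h2 := card_BG_ne_zero (Γ := Γ) Aᶜ.card
      field_simp
    -- The outer product is evaluated at `u⁻¹`, which preserves `A` exactly when `u` does.
    · intro u hu
      rw [tensS_blockSet_eq_zero, mul_zero]
      rintro ⟨h1, -⟩
      refine hu ?_
      rw [(compl_emb A).exists_iff] at h1 ⊢
      intro i
      obtain ⟨s1, s2, h2, -⟩ := (compl_emb A).preserves h1
      refine ⟨s1⁻¹ i, ?_⟩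
      have := semiconj_inv h2 i
      rw [← this]
      change (u.right⁻¹)⁻¹ _ = _
      rw [inv_inv]
  · have h1 : tensS (fun j => chi j β) (fun j => Han ξ Aᶜ.card α F j) T y = 0 :=
      tens_eq_zero _ _ hy
    rw [h1, mul_zero, mul_zero]
    refine Finset.sum_eq_zero fun x _ => ?_
    rw [tensS_blockSet_eq_zero _ _ _ _ fun h => hy h.2, mul_zero]

/-- The commutation relation of annihilation and creation operators. -/
theorem Han_Hcr (ξ α β : ClassFun Γ) (m n : ℕ) (F : Fock Γ) :
    Han ξ m α (Hcr n β F) = ∑ a ∈ Finset.range (m + 1), if a ≤ n then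
      wform ξ (chi a α).1 (chi a β).1 • Hcr (n - a) β (Han ξ (m - a) α F) else 0 := by
  classical
  refine DFinsupp.ext fun k => Subtype.ext (funext fun y => ?_)
  have hR : (((∑ a ∈ Finset.range (m + 1), if a ≤ n then
      wform ξ (chi a α).1 (chi a β).1 • Hcr (n - a) β (Han ξ (m - a) α F) else 0 : Fock Γ) k).1 y) =
      ∑ a ∈ Finset.range (m + 1), ∑ T : Finset (Fin k), if a + T.card = n then
        wform ξ (chi a α).1 (chi a β).1 *
          tensS (fun j => chi j β) (fun j => Han ξ (m - a) α F j) T y else 0 := by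
    rw [DFinsupp.finsetSum_apply, AddSubmonoidClass.coe_finsetSum, Finset.sum_apply]
    refine Finset.sum_congr rfl fun a _ => ?_
    split_ifs with ha
    · have h1 : ((wform ξ (chi a α).1 (chi a β).1 • Hcr (n - a) β (Han ξ (m - a) α F) : Fock Γ) k).1 y =
          wform ξ (chi a α).1 (chi a β).1 * (Hcr (n - a) β (Han ξ (m - a) α F) k).1 y := rfl
      rw [h1, Hcr_apply, Finset.mul_sum, ← Finset.sum_filter]
      refine Finset.sum_congr ?_ fun _ _ => rfl
      ext T
      simp only [Finset.mem_powersetCard, Finset.mem_filter, Finset.subset_univ, Finset.mem_univ,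
        true_and]
      omega
    · refine (Finset.sum_eq_zero fun T _ => if_neg ?_).symm
      omega
  rw [hR, Han_val]
  -- Here the `n`-subsets of the `m + k` positions are split as `A ⊔ T`; the size of `A` becomes the
  -- degree `a` that is paired off.
  have hL (x : BG Γ m) : eta ξ x * (chi m α).1 x *
      (Hcr n β F (m + k)).1 (inL m k x⁻¹ * inR m k y) =
      ∑ A : Finset (Fin m), ∑ T : Finset (Fin k), if A.card + T.card = n then
        eta ξ x * (chi m α).1 x * tensS (fun j => chi j β) (fun j => F j) (blockSet m k (A, T))
        (inL m k x⁻¹ * inR m k y) else 0 := by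
    rw [Hcr_apply, Finset.mul_sum, ← Fintype.sum_prod_type' (f := fun A T =>
      if Finset.card A + Finset.card T = n then
        eta ξ x * (chi m α).1 x * tensS (fun j => chi j β) (fun j => F j) (blockSet m k (A, T))
        (inL m k x⁻¹ * inR m k y) else 0)]
    have h1 : Finset.powersetCard n (Finset.univ : Finset (Fin (m + k))) =
        Finset.univ.filter fun S => S.card = n := by
      ext S
      simp [Finset.mem_powersetCard]
    rw [h1, Finset.sum_filter, ← (blockSet m k).sum_comp]
    refine Finset.sum_congr rfl fun p _ => ?_
    rw [← card_blockSet]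
  simp only [hL]
  rw [Finset.sum_comm, Finset.mul_sum]
  -- The contribution of `A` depends only on its cardinality. Summing over `A` gives binomial
  -- weights, which `card_BG_split` cancels against the group orders.
  let g : ℕ → ℂ := fun a => (Nat.card (BG Γ m) : ℂ)⁻¹ *
    ((2⁻¹ * Nat.card (BG Γ a) * Nat.card (BG Γ (m - a))) *
      ∑ T : Finset (Fin k), if a + T.card = n then wform ξ (chi a α).1 (chi a β).1 *
        tensS (fun j => chi j β) (fun j => Han ξ (m - a) α F j) T y else 0)
  have hA (A : Finset (Fin m)) : (Nat.card (BG Γ m) : ℂ)⁻¹ * (∑ x : BG Γ m, ∑ T : Finset (Fin k),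
      if A.card + T.card = n then
        eta ξ x * (chi m α).1 x * tensS (fun j => chi j β) (fun j => F j) (blockSet m k (A, T))
        (inL m k x⁻¹ * inR m k y) else 0) = g A.card := by
    rw [Finset.sum_comm]
    dsimp only [g]
    congr 1
    rw [Finset.mul_sum]
    refine Finset.sum_congr rfl fun T _ => ?_
    split_ifs
    · rw [sum_tensS_blockSet, Finset.card_compl, Fintype.card_fin]
    · simp
  rw [Finset.sum_congr rfl fun A _ => hA A, ← Finset.powerset_univ,
    Finset.sum_powerset_apply_card g, Finset.card_univ, Fintype.card_fin]
  refine Finset.sum_congr rfl fun a ha => ?_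
  have ha' : a ≤ m := Nat.lt_succ_iff.1 (Finset.mem_range.1 ha)
  dsimp only [g]
  rw [nsmul_eq_mul, mul_left_comm, ← mul_assoc (m.choose a : ℂ), card_BG_split ha', ← mul_assoc,
    inv_mul_cancel₀ (card_BG_ne_zero m), one_mul]

end Commutation

/-! ### The pairing of `χ_n(α)` and `χ_n(β)` -/

/-! ### Permutations counted by cycles -/

section CycleCount

/-- The number of cycles of a permutation, fixed points included. -/
def cycleCount {X : Type*} (s : Perm X) : ℕ := Nat.card (Quotient (Perm.SameCycle.setoid s))

/-- A counting criterion: `φ` is a complete invariant of cycles, so its values enumerate them. -/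
theorem cycleCount_eq {X Y : Type*} [Finite X] (s : Perm X) (φ : X → Y)
    (hφ : Function.Surjective φ) (h1 : ∀ x, φ (s x) = φ x)
    (h2 : ∀ x y, φ x = φ y → Perm.SameCycle s x y) : cycleCount s = Nat.card Y := by
  have h3 (k : ℕ) (x : X) : φ ((s ^ k) x) = φ x := by
    induction k with
    | zero => rfl
    | succ k ih => rw [pow_succ', Perm.mul_apply, h1, ih]
  have h4 (x y : X) (h : Perm.SameCycle s x y) : φ x = φ y := by
    obtain ⟨k, -, rfl⟩ := h.exists_pow_eq'
    exact (h3 k x).symm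
  refine Nat.card_congr (Equiv.ofBijective (Quotient.lift φ h4) ⟨?_, ?_⟩)
  · intro a b
    induction a, b using Quotient.inductionOn₂ with | _ a b
    exact fun h => Quotient.sound (h2 a b h)
  · intro y
    obtain ⟨x, rfl⟩ := hφ y
    exact ⟨⟦x⟧, rfl⟩

variable {n : ℕ}

/-- The new permutation is `s` on the shifted points followed by the transposition of `0` and `p`. A
step of `s` survives unless it would land on `p`, in which case it makes a detour through `0`. -/
theorem sameCycle_decomposeFin (p : Fin (n + 1)) (s : Perm (Fin n)) {a b : Fin n}
    (h : Perm.SameCycle s a b) :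
    Perm.SameCycle (Perm.decomposeFin.symm (p, s)) a.succ b.succ := by
  obtain ⟨k, -, rfl⟩ := h.exists_pow_eq'
  clear h
  induction k with
  | zero => exact Perm.SameCycle.refl _ _
  | succ k ih =>
    refine ih.trans ?_
    rw [pow_succ', Perm.mul_apply]
    set c := (s ^ k) a
    have h1 : Perm.SameCycle (Perm.decomposeFin.symm (p, s)) c.succ
        (Equiv.swap 0 p (s c).succ) := ⟨1, by simp⟩
    by_cases hp : (s c).succ = p
    · rw [hp, Equiv.swap_apply_right] at h1
      refine h1.trans ⟨1, ?_⟩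
      rw [zpow_one, Perm.decomposeFin_symm_apply_zero, hp]
    · rwa [Equiv.swap_apply_of_ne_of_ne (Fin.succ_ne_zero _) hp] at h1

/-- For `p = 0` the point `0` is a new fixed point; otherwise it is inserted just before `p` in the
cycle of `p`. -/
theorem cycleCount_decomposeFin (p : Fin (n + 1)) (s : Perm (Fin n)) :
    cycleCount (Perm.decomposeFin.symm (p, s)) = cycleCount s + if p = 0 then 1 else 0 := by
  have hs (a : Fin n) : (Quotient.mk (Perm.SameCycle.setoid s) (s a)) = Quotient.mk _ a :=
    Quotient.sound (Perm.sameCycle_apply_left.2 (Perm.SameCycle.refl _ _))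
  refine Fin.cases ?_ (fun c => ?_) p
  · rw [if_pos rfl]
    have h := cycleCount_eq (Perm.decomposeFin.symm (0, s)) (Fin.cases none fun a =>
      some (Quotient.mk (Perm.SameCycle.setoid s) a) :
        Fin (n + 1) → Option (Quotient (Perm.SameCycle.setoid s))) ?_ ?_ ?_
    · rw [h, Finite.card_option]; rfl
    · rintro (_ | a)
      · exact ⟨0, rfl⟩
      · induction a using Quotient.inductionOn with | _ a
        exact ⟨a.succ, rfl⟩
    · intro x
      refine Fin.cases ?_ (fun a => ?_) x
      · rw [Perm.decomposeFin_symm_apply_zero]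
      · rw [Perm.decomposeFin_symm_apply_succ, Equiv.swap_self]
        exact congrArg some (hs a)
    · intro x y
      refine Fin.cases ?_ (fun a => ?_) x <;> refine Fin.cases ?_ (fun b => ?_) y <;> intro h
      · exact Perm.SameCycle.refl _ _
      · cases h
      · cases h
      · exact sameCycle_decomposeFin _ _ (Quotient.exact (Option.some_injective _ h))
  · rw [if_neg (Fin.succ_ne_zero c), add_zero]
    have h0 : Perm.SameCycle (Perm.decomposeFin.symm (c.succ, s)) 0 c.succ :=
      ⟨1, by rw [zpow_one, Perm.decomposeFin_symm_apply_zero]⟩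
    refine cycleCount_eq (Perm.decomposeFin.symm (c.succ, s)) (Fin.cases
      (Quotient.mk (Perm.SameCycle.setoid s) c) fun a => Quotient.mk (Perm.SameCycle.setoid s) a :
        Fin (n + 1) → Quotient (Perm.SameCycle.setoid s)) ?_ ?_ ?_
    · intro a
      induction a using Quotient.inductionOn with | _ a
      exact ⟨a.succ, rfl⟩
    · intro x
      refine Fin.cases ?_ (fun a => ?_) x
      · rw [Perm.decomposeFin_symm_apply_zero]; rfl
      · rw [Perm.decomposeFin_symm_apply_succ]
        by_cases hp : s a = c
        · rw [hp, Equiv.swap_apply_right]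
          exact (congrArg _ hp.symm).trans (hs a)
        · rw [Equiv.swap_apply_of_ne_of_ne (Fin.succ_ne_zero _) (by simpa using hp)]
          exact hs a
    · intro x y
      refine Fin.cases ?_ (fun a => ?_) x <;> refine Fin.cases ?_ (fun b => ?_) y <;> intro h
      · exact Perm.SameCycle.refl _ _
      · exact h0.trans (sameCycle_decomposeFin _ _ (Quotient.exact h))
      · exact (sameCycle_decomposeFin _ _ (Quotient.exact h)).trans h0.symm
      · exact sameCycle_decomposeFin _ _ (Quotient.exact h)

/-- The generating function of permutations by the number of cycles, weighted by `w = 1` or by the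
sign, satisfies a one-step recursion. -/
theorem sum_cycleCount_succ (N c : ℂ) (w : ∀ n, Perm (Fin n) → ℂ)
    (hw : ∀ n p s, w (n + 1) (Perm.decomposeFin.symm (p, s)) = (if p = 0 then 1 else c) * w n s)
    (n : ℕ) : ∑ s, w (n + 1) s * N ^ cycleCount s = (N + c * n) * ∑ s, w n s * N ^ cycleCount s := by
  rw [← Perm.decomposeFin.symm.sum_comp, Fintype.sum_prod_type, Fin.sum_univ_succ]
  -- The choice `p = 0` adds a cycle and gives `N`; each of the `n` other choices keeps the number
  -- of cycles and gives the weight `c`.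
  have h (p : Fin (n + 1)) : ∑ s, w (n + 1) (Perm.decomposeFin.symm (p, s)) *
      N ^ cycleCount (Perm.decomposeFin.symm (p, s)) =
      (if p = 0 then N else c) * ∑ s, w n s * N ^ cycleCount s := by
    rw [Finset.mul_sum]
    refine Finset.sum_congr rfl fun s _ => ?_
    rw [hw, cycleCount_decomposeFin]
    split_ifs <;> ring
  simp only [h, if_pos, if_neg (Fin.succ_ne_zero _), Finset.sum_const, Finset.card_univ,
    Fintype.card_fin, nsmul_eq_mul]
  ring

theorem choose_succ_mul (r : ℂ) (n : ℕ) :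
    ((n : ℂ) + 1) * Ring.choose r (n + 1) = (r - n) * Ring.choose r n := by
  have h := Ring.choose_smul_choose r (Nat.le_succ n)
  rw [Nat.succ_eq_add_one, Nat.choose_succ_self_right, Nat.add_sub_cancel_left,
    Ring.choose_one_right, nsmul_eq_mul] at h
  push_cast at h
  rw [h, mul_comm]

/-- The recursion produces the rising factorial `N(N+1)⋯(N+n-1)`. It is written with `-N` to match
the coefficients of `(1-t)^(-N)`. -/
theorem sum_cycleCount (N : ℂ) (n : ℕ) :
    ∑ s : Perm (Fin n), (1 : ℂ) * N ^ cycleCount s =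
      n.factorial * ((-1) ^ n * Ring.choose (-N) n) := by
  induction n with
  | zero => simp [cycleCount]
  | succ n ih =>
    rw [sum_cycleCount_succ N 1 (fun _ _ => 1) (by simp), ih, Nat.factorial_succ]
    have h := choose_succ_mul (-N) n
    push_cast
    rw [pow_succ]
    linear_combination (n.factorial * (-1) ^ n : ℂ) * h

/-- Inserting `0` before another point multiplies by a transposition, so now `c = -1` and the
recursion produces the falling factorial. -/
theorem sum_sign_cycleCount (N : ℂ) (n : ℕ) :
    ∑ s : Perm (Fin n), ((Perm.sign s : ℤ) : ℂ) * N ^ cycleCount s =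
      n.factorial * Ring.choose N n := by
  induction n with
  | zero => simp [cycleCount]
  | succ n ih =>
    rw [sum_cycleCount_succ N (-1) (fun _ s => ((Perm.sign s : ℤ) : ℂ)), ih, Nat.factorial_succ]
    · have h := choose_succ_mul N n
      push_cast
      linear_combination -(n.factorial : ℂ) * h
    · intro n p s
      rw [Perm.decomposeFin.symm_sign]
      split_ifs <;> simp

end CycleCount

/-! ### Averages of `η_n` over the group -/

section EtaSums

variable {n : ℕ}

theorem eta_mul_eta (γ δ ε : ClassFun Γ) (h : ∀ g, ε.1 g = γ.1 g * δ.1 g) (x : BG Γ n) :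
    eta ε x = eta γ x * eta δ x := by
  unfold eta
  rw [← finprod_mul_distrib (Set.toFinite _) (Set.toFinite _)]
  exact finprod_congr fun c => h _

/-- For `k` the length of the cycle, the cycle product is the entry of `x ^ k` at `i`. Since `x ^ k`
fixes the position `i`, inversion of the power inverts this entry. -/
theorem cycleProd_inv (x : BG Γ n) (i : Fin n) : cycleProd x⁻¹ i = (cycleProd x i)⁻¹ := by
  have hper : Function.minimalPeriod x⁻¹.right i = Function.minimalPeriod x.right i := by
    rw [Function.minimalPeriod_eq_minimalPeriod_iff]
    intro k
    simp only [Function.IsPeriodicPt, Function.IsFixedPt, ← Equiv.Perm.coe_pow]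
    change (x.right⁻¹ ^ k) i = i ↔ _
    rw [inv_pow, Perm.inv_eq_iff_eq, eq_comm]
  rw [cycleProd_eq, cycleProd_eq, hper, inv_pow]
  set k := Function.minimalPeriod x.right i with hk
  have hfix : (x ^ k).right i = i := by
    have := Function.isPeriodicPt_minimalPeriod x.right i
    rwa [← hk, Function.IsPeriodicPt, Function.IsFixedPt, ← Equiv.Perm.coe_pow, ← pow_right] at this
  have h : (x ^ k * (x ^ k)⁻¹).left.1 i = 1 := by rw [mul_inv_cancel]; rfl
  have h2 : (x ^ k).right⁻¹ i = i := by rw [Perm.inv_eq_iff_eq, hfix]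
  rw [BG.mul_left_fst, Pi.mul_apply, h2] at h
  exact eq_inv_of_mul_eq_one_right h

theorem eta_inv (γ δ : ClassFun Γ) (h : ∀ g, δ.1 g = γ.1 g⁻¹) (x : BG Γ n) :
    eta γ x⁻¹ = eta δ x := by
  let e : Quotient (Perm.SameCycle.setoid x.right) ≃ Quotient (Perm.SameCycle.setoid x⁻¹.right) :=
    Quotient.congr (Equiv.refl _) fun i j => Perm.sameCycle_inv.symm
  rw [eta_eq, eta_eq, ← finprod_comp_equiv e]
  refine finprod_congr fun c => ?_
  induction c using Quotient.inductionOn with | _ c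
  change γ.1 (cycleProd x⁻¹ c) = δ.1 (cycleProd x c)
  rw [h, cycleProd_inv]

/-- The sum of `η_n(δ)` over `Γ^n`. -/
theorem sum_eta [Fintype Γ] (δ : ClassFun Γ) (s : Perm (Fin n)) :
    ∑ g : Fin n → Γ, eta δ (⟨(g, 1), s⟩ : BG Γ n) =
      (Nat.card Γ : ℂ) ^ n * ((Nat.card Γ : ℂ)⁻¹ * ∑ g, δ.1 g) ^ cycleCount s := by
  classical
  let C := Quotient (Perm.SameCycle.setoid s)
  let X (g : Fin n → Γ) : BG Γ n := ⟨(g, 1), s⟩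
  -- `t h` has the entry `h c` at the representative of the cycle `c` and `1` elsewhere. Left
  -- multiplication by it changes only the first factor of the cycle product based there.
  let t (h : C → Γ) : Fin n → Γ := fun i =>
    if (Quotient.mk (Perm.SameCycle.setoid s) i).out = i then h ⟦i⟧ else 1
  have hcyc (h : C → Γ) (g : Fin n → Γ) (c : C) :
      cycleProd (X (t h * g)) c.out = h c * cycleProd (X g) c.out := by
    have hpos : 0 < Function.minimalPeriod s c.out := by
      refine Function.minimalPeriod_pos_of_mem_periodicPts ⟨orderOf s, orderOf_pos s, ?_⟩
      rw [Function.IsPeriodicPt, Function.IsFixedPt, ← Equiv.Perm.coe_pow, pow_orderOf_eq_one]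
      rfl
    obtain ⟨k, hk⟩ := Nat.exists_eq_add_of_lt hpos
    rw [zero_add] at hk
    unfold cycleProd
    change ((List.range (Function.minimalPeriod s c.out)).map
      fun j => (t h * g) ((s⁻¹ ^ j) c.out)).prod = h c *
      ((List.range (Function.minimalPeriod s c.out)).map fun j => g ((s⁻¹ ^ j) c.out)).prod
    rw [hk, List.range_succ_eq_map, List.map_cons, List.map_cons, List.prod_cons, List.prod_cons,
      List.map_map, List.map_map, ← mul_assoc]
    congr 1
    · change t h c.out * g c.out = h c * g c.out
      have h1 : Quotient.mk (Perm.SameCycle.setoid s) c.out = c := Quotient.out_eq c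
      have h2 : t h c.out = h c := by
        change (if (Quotient.mk (Perm.SameCycle.setoid s) c.out).out = c.out then
          h (Quotient.mk (Perm.SameCycle.setoid s) c.out) else 1) = h c
        rw [h1, if_pos rfl]
      rw [h2]
    · congr 1
      refine List.map_congr_left fun j hj => ?_
      change t h ((s⁻¹ ^ (j + 1)) c.out) * g _ = g _
      have h1 : Quotient.mk (Perm.SameCycle.setoid s) ((s⁻¹ ^ (j + 1)) c.out) = c := by
        conv_rhs => rw [← Quotient.out_eq c]
        refine Quotient.sound ⟨((j + 1 : ℕ) : ℤ), ?_⟩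
        rw [zpow_natCast, inv_pow]; simp
      have h2 : t h ((s⁻¹ ^ (j + 1)) c.out) = 1 := by
        refine if_neg ?_
        rw [h1]
        intro h3
        rw [inv_pow, eq_comm, Perm.inv_eq_iff_eq] at h3
        have h4 : Function.IsPeriodicPt s (j + 1) c.out := by
          rw [Function.IsPeriodicPt, Function.IsFixedPt, ← Equiv.Perm.coe_pow]; exact h3.symm
        have h5 := h4.minimalPeriod_le (Nat.succ_pos j)
        rw [List.mem_range] at hj
        omega
      rw [h2, one_mul]
  have heta (g : Fin n → Γ) : eta δ (X g) = ∏ c : C, δ.1 (cycleProd (X g) c.out) :=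
    finprod_eq_prod_of_fintype _
  -- Translation by `t h` does not change the sum over `g`. Summing over all `h` as well replaces
  -- each cycle product by an independent variable running through `Γ`.
  have hshift (h : C → Γ) : ∑ g, eta δ (X g) = ∑ g, ∏ c : C, δ.1 (h c * cycleProd (X g) c.out) := by
    rw [← Equiv.sum_comp (Equiv.mulLeft (t h))]
    refine Finset.sum_congr rfl fun g _ => ?_
    rw [heta]
    exact Finset.prod_congr rfl fun c _ => congrArg _ (hcyc h g c)
  have hsum : (Nat.card Γ : ℂ) ^ cycleCount s * ∑ g, eta δ (X g) =
      (Nat.card Γ : ℂ) ^ n * (∑ g, δ.1 g) ^ cycleCount s := by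
    have h1 : (Nat.card Γ : ℂ) ^ cycleCount s * ∑ g, eta δ (X g) =
        ∑ _h : C → Γ, ∑ g, eta δ (X g) := by
      rw [Finset.sum_const, Finset.card_univ, nsmul_eq_mul, Fintype.card_fun, cycleCount,
        Nat.card_eq_fintype_card, Nat.card_eq_fintype_card]
      push_cast
      rfl
    rw [h1, Finset.sum_congr rfl fun h _ => hshift h, Finset.sum_comm]
    have h2 (g : Fin n → Γ) : ∑ h : C → Γ, ∏ c : C, δ.1 (h c * cycleProd (X g) c.out) =
        (∑ g, δ.1 g) ^ cycleCount s := by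
      have h3 := (Finset.prod_univ_sum (fun _ : C => (Finset.univ : Finset Γ))
        fun c y => δ.1 (y * cycleProd (X g) c.out)).symm
      rw [Fintype.piFinset_univ] at h3
      rw [h3]
      have h4 (c : C) : ∑ y, δ.1 (y * cycleProd (X g) c.out) = ∑ y, δ.1 y :=
        Equiv.sum_comp (Equiv.mulRight (cycleProd (X g) c.out)) δ.1
      rw [Finset.prod_congr rfl fun c _ => h4 c, Finset.prod_const, Finset.card_univ, cycleCount,
        Nat.card_eq_fintype_card]
    rw [Finset.sum_congr rfl fun g _ => h2 g, Finset.sum_const, Finset.card_univ, nsmul_eq_mul,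
      Fintype.card_fun, Nat.card_eq_fintype_card]
    push_cast
    rw [Fintype.card_fin]
  have h0 : (Nat.card Γ : ℂ) ≠ 0 := by simp
  rw [mul_pow, inv_pow]
  field_simp
  rw [← hsum]; ring

/-- The summand does not involve the component in `Π_n`, whose order `2 * 2 ^ n` cancels; `sum_eta`
takes care of `Γ^n`. -/
theorem sum_BG [Fintype Γ] (δ : ClassFun Γ) (w : Perm (Fin n) → ℂ) :
    (Nat.card (BG Γ n) : ℂ)⁻¹ * ∑ x : BG Γ n, eta δ x * w x.right =
      (n.factorial : ℂ)⁻¹ *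
        ∑ s, w s * ((Nat.card Γ : ℂ)⁻¹ * ∑ g, δ.1 g) ^ cycleCount s := by
  have h1 : ∑ x : BG Γ n, eta δ x * w x.right =
      (2 * 2 ^ n) * ∑ s, w s * ∑ g : Fin n → Γ, eta δ (⟨(g, 1), s⟩ : BG Γ n) := by
    rw [← SemidirectProduct.equivProd.symm.sum_comp, Fintype.sum_prod_type, Finset.sum_comm,
      Finset.mul_sum]
    refine Finset.sum_congr rfl fun s _ => ?_
    rw [Fintype.sum_prod_type, Finset.mul_sum, Finset.mul_sum]
    refine Finset.sum_congr rfl fun g _ => ?_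
    have h2 (q : PiGrp n) : eta δ (SemidirectProduct.equivProd.symm ((g, q), s) : BG Γ n) *
        w (SemidirectProduct.equivProd.symm ((g, q), s) : BG Γ n).right =
        w s * eta δ (⟨(g, 1), s⟩ : BG Γ n) := mul_comm _ _
    rw [Finset.sum_congr rfl fun q _ => h2 q, Finset.sum_const, Finset.card_univ,
      Fintype.card_congr (PiGrp.equivProd n)]
    simp
  have h0 : (Nat.card Γ : ℂ) ≠ 0 := by simp
  have h3 : (n.factorial : ℂ) ≠ 0 := by exact_mod_cast n.factorial_ne_zero
  rw [h1, card_BG]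
  simp only [sum_eta]
  push_cast
  simp only [mul_left_comm (w _), ← Finset.mul_sum]
  field_simp

end EtaSums

/-! ### The character of a permutation on the Clifford algebra and the value of the pairing -/

section Pairing

variable {a N : ℕ}

theorem neg_one_pow_inversions_one (s : Perm (Fin a)) :
    (-1 : ℂ) ^ (PiGrp.inversions s 1).val = ((Perm.sign s : ℤ) : ℂ) := by
  have hsum {ι : Type} (S : Finset ι) (f : ι → ZMod 2) :
      (-1 : ℂ) ^ (∑ i ∈ S, f i).val = ∏ i ∈ S, (-1 : ℂ) ^ (f i).val := by
    classical
    induction S using Finset.induction_on with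
    | empty => simp
    | insert i S hi ih => rw [Finset.sum_insert hi, Finset.prod_insert hi, neg_one_pow_val_add, ih]
  unfold PiGrp.inversions
  rw [Perm.sign_eq_prod_prod_Ioi, hsum]
  push_cast
  refine Finset.prod_congr rfl fun i _ => ?_
  rw [hsum, ← Finset.prod_subset (Finset.subset_univ (Finset.Ioi i))]
  · refine Finset.prod_congr rfl fun j hj => ?_
    rw [Finset.mem_Ioi] at hj
    rcases lt_or_gt_of_ne (s.injective.ne hj.ne) with h | h
    · simp [h, h.not_gt]
    · simp [h, h.not_gt, hj, ZMod.val_one]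
  · intro j _ hj
    rw [Finset.mem_Ioi] at hj
    simp [hj]

/-- The indicator functions of subsets. -/
def indicatorEquiv (N : ℕ) : Finset (Fin N) ≃ (Fin N → ZMod 2) where
  toFun S i := if i ∈ S then 1 else 0
  invFun I := Finset.univ.filter fun i => I i = 1
  left_inv S := by ext i; simp
  right_inv I := by
    funext i
    simp only [Finset.mem_filter, Finset.mem_univ, true_and]
    generalize I i = c
    revert c; decide

theorem indicatorEquiv_eq_extend (S : Finset (Fin N)) :
    indicatorEquiv N S = Function.extend (emb S) (1 : Fin S.card → ZMod 2) 0 := by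
  funext i
  by_cases hi : i ∈ Set.range (emb S)
  · have hS : i ∈ S := by rw [Finset.range_orderEmbOfFin] at hi; exact hi
    obtain ⟨j, rfl⟩ := hi
    rw [extend_mem]
    exact if_pos hS
  · rw [extend_notMem _ _ _ hi]
    refine if_neg fun hS => hi ?_
    rw [Finset.range_orderEmbOfFin]
    exact hS

/-- Reordering the permuted product of the `e_i` with `i ∈ S` costs the sign of the restriction to
`S`: on diagonal entries, permutations act on the Clifford algebra as on an exterior algebra. -/
theorem cliffCoeff_indicator (S : Finset (Fin N)) (x₁ : BG Γ S.card) (x₂ : BG Γ Sᶜ.card) :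
    cliffCoeff (BG.perm (embed (emb S) x₁ * embed (emb Sᶜ) x₂).right : BG Γ N)
      (indicatorEquiv N S) = ((Perm.sign x₁.right : ℤ) : ℂ) := by
  set u := embed (emb S) x₁ * embed (emb Sᶜ) x₂
  have h1 (i : Fin S.card) : u.right (emb S i) = emb S (x₁.right i) :=
    embed_mul_right_left (compl_emb S) x₁ x₂ i
  have h2 (i : Fin Sᶜ.card) : u.right (emb Sᶜ i) = emb Sᶜ (x₂.right i) :=
    embed_mul_right_right (compl_emb S) x₁ x₂ i
  rw [cliffCoeff_perm, if_pos, ← neg_one_pow_inversions_one, indicatorEquiv_eq_extend]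
  · congr 2
    unfold PiGrp.inversions
    rw [sum_extend (emb S)]
    · refine Finset.sum_congr rfl fun i _ => ?_
      rw [sum_extend (emb S)]
      · simp only [extend_mem, (emb S).lt_iff_lt, h1]
      · intro j hj; simp [extend_notMem _ _ _ hj]
    · intro i hi; simp [extend_notMem _ _ _ hi]
  · rw [indicatorEquiv_eq_extend]
    funext i
    revert i
    refine (compl_emb S).cases (fun i => ?_) fun i => ?_
    · rw [semiconj_inv h1, extend_mem, extend_mem]; rfl
    · rw [semiconj_inv h2, extend_notMem _ _ _ ((compl_emb S).notMem_left _),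
        extend_notMem _ _ _ ((compl_emb S).notMem_left _)]; rfl

theorem cliffCoeff_indicator_eq_zero (S : Finset (Fin N)) {u : BG Γ N}
    (hu : ¬ ∃ x y, embed (emb S) x * embed (emb Sᶜ) y = u) :
    cliffCoeff (BG.perm u.right : BG Γ N) (indicatorEquiv N S) = 0 := by
  rw [cliffCoeff_perm, if_neg]
  intro h
  refine hu (((compl_emb S).exists_iff u).2 fun i => ?_)
  have h1 := congrFun h (u.right (emb S i))
  have hS : emb S i ∈ S := Finset.orderEmbOfFin_mem _ _ _
  rw [Finset.range_orderEmbOfFin]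
  by_contra hc
  have h2 : indicatorEquiv N S (u.right (emb S i)) = 0 := if_neg hc
  have h3 : indicatorEquiv N S (emb S i) = 1 := if_pos hS
  have h4 : u.right⁻¹ (u.right (emb S i)) = emb S i := by simp
  rw [h4, h2, h3] at h1
  exact one_ne_zero h1

variable [Fintype Γ]

/-- The sum of `η_n(δ)` against the character of the Clifford algebra splits according to the sets
of positions that are preserved. -/
theorem sum_eta_chiBasic_perm (δ : ClassFun Γ) (n : ℕ) :
    (Nat.card (BG Γ n) : ℂ)⁻¹ *
      ∑ x : BG Γ n, eta δ x * chiBasic (BG.perm x.right : BG Γ n) =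
    ∑ b ∈ Finset.range (n + 1),
      ((Nat.card (BG Γ b) : ℂ)⁻¹ * ∑ x : BG Γ b, eta δ x * ((Perm.sign x.right : ℤ) : ℂ)) *
      ((Nat.card (BG Γ (n - b)) : ℂ)⁻¹ * ∑ x : BG Γ (n - b), eta δ x * 1) := by
  let f (b : ℕ) : ℂ := (Nat.card (BG Γ n) : ℂ)⁻¹ *
    (2⁻¹ * ((∑ x : BG Γ b, eta δ x * ((Perm.sign x.right : ℤ) : ℂ)) *
      ∑ x : BG Γ (n - b), eta δ x * 1))
  -- The trace is expanded over basis elements `e_S`. Only elements preserving `S` count, with the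
  -- sign character on `S` and the trivial one on its complement.
  have hS (S : Finset (Fin n)) : (Nat.card (BG Γ n) : ℂ)⁻¹ *
      ∑ x : BG Γ n, eta δ x * cliffCoeff (BG.perm x.right : BG Γ n) (indicatorEquiv n S) =
      f S.card := by
    rw [(compl_emb S).sum_eq]
    · dsimp only [f]
      congr 2
      simp only [(compl_emb S).eta_mul, cliffCoeff_indicator]
      have hc : Sᶜ.card = n - S.card := by rw [Finset.card_compl, Fintype.card_fin]
      rw [← hc, Finset.sum_mul_sum]
      exact Finset.sum_congr rfl fun x _ => Finset.sum_congr rfl fun y _ => by ring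
    · intro u hu
      rw [cliffCoeff_indicator_eq_zero S hu, mul_zero]
  have h1 : (Nat.card (BG Γ n) : ℂ)⁻¹ *
      ∑ x : BG Γ n, eta δ x * chiBasic (BG.perm x.right : BG Γ n) =
      ∑ S : Finset (Fin n), f S.card := by
    rw [← Finset.sum_congr rfl fun S _ => hS S, ← Finset.mul_sum, Finset.sum_comm]
    congr 1
    refine Finset.sum_congr rfl fun x _ => ?_
    rw [chiBasic_eq, ← Finset.mul_sum, (indicatorEquiv n).sum_comp]
  rw [h1, ← Finset.powerset_univ, Finset.sum_powerset_apply_card f, Finset.card_univ,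
    Fintype.card_fin]
  refine Finset.sum_congr rfl fun b hb => ?_
  have hb' : b ≤ n := Nat.lt_succ_iff.1 (Finset.mem_range.1 hb)
  dsimp only [f]
  rw [← card_BG_split hb', nsmul_eq_mul]
  have h2 := card_BG_ne_zero (Γ := Γ) b
  have h3 := card_BG_ne_zero (Γ := Γ) (n - b)
  have h4 : (n.choose b : ℂ) ≠ 0 := by exact_mod_cast (Nat.choose_pos hb').ne'
  field_simp

/-- The three `η`-factors combine to `η_n(δ)` with `δ(g) = ξ(g) α(g) β(g⁻¹)`, a class function of
mean `N = ⟨α, β⟩_ξ`. After the average over `Π_n`, the set `S` of size `b` contributes the signed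
cycle sum and its complement the unsigned one. The result is the coefficient of `t^n` in `(1+t)^N
(1-t)^(-N)`. -/
theorem wform_chi (ξ α β : ClassFun Γ) (n : ℕ) :
    wform ξ (chi n α).1 (chi n β).1 = ∑ b ∈ Finset.range (n + 1),
      Ring.choose (form ξ.1 α.1 β.1) b *
        ((-1) ^ (n - b) * Ring.choose (-form ξ.1 α.1 β.1) (n - b)) := by
  let β' : ClassFun Γ := ⟨fun g => β.1 g⁻¹, fun t x => by
    dsimp only
    rw [conj_inv, β.2]⟩
  let ξα : ClassFun Γ := ⟨fun g => ξ.1 g * α.1 g, fun t x => by dsimp only; rw [ξ.2, α.2]⟩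
  let δ : ClassFun Γ := ⟨fun g => ξα.1 g * β'.1 g, fun t x => by dsimp only; rw [ξα.2, β'.2]⟩
  have hδ (x : BG Γ n) : eta δ x = eta ξ x * eta α x * eta β x⁻¹ := by
    rw [eta_mul_eta ξα β' δ (fun _ => rfl), eta_mul_eta ξ α ξα (fun _ => rfl),
      eta_inv β β' fun _ => rfl]
  have h1 : ∑ x, eta ξ x * (chi n α).1 x * (chi n β).1 x⁻¹ =
      ∑ x : BG Γ n, eta δ x * chiBasic (BG.perm x.right : BG Γ n) := by
    have h2 := sum_chiBasic_mul_inv (Γ := Γ) (n := n) fun g s => eta δ (⟨(g, 1), s⟩ : BG Γ n)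
    have h3 (x : BG Γ n) : eta δ (⟨(x.left.1, 1), x.right⟩ : BG Γ n) = eta δ x := rfl
    simp only [h3] at h2
    rw [← h2]
    refine Finset.sum_congr rfl fun x _ => ?_
    rw [hδ]
    change eta ξ x * (eta α x * chiBasic x) * (eta β x⁻¹ * chiBasic x⁻¹) = _
    ring
  have hform : (Nat.card Γ : ℂ)⁻¹ * ∑ g, δ.1 g = form ξ.1 α.1 β.1 := rfl
  rw [wform, h1, sum_eta_chiBasic_perm]
  refine Finset.sum_congr rfl fun b _ => ?_
  have h4 (n : ℕ) : (n.factorial : ℂ) ≠ 0 := by exact_mod_cast n.factorial_ne_zero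
  rw [sum_BG δ (fun s => ((Perm.sign s : ℤ) : ℂ)), sum_BG δ (fun _ => 1), hform, sum_cycleCount,
    sum_sign_cycleCount, inv_mul_cancel_left₀ (h4 _), inv_mul_cancel_left₀ (h4 _)]

end Pairing

/-! ### Expansion of `((1-t)/(1+t))^a` -/

section Expansion

-- For natural exponents this is the definition of a power. Additivity of the binomial series in the
-- exponent identifies negative exponents as inverses.
open PowerSeries in
theorem ofPowerSeries_binomialSeries (a : ℤ) :
    HahnSeries.ofPowerSeries ℤ ℂ (PowerSeries.binomialSeries ℂ (a : ℂ)) = (1 + HahnSeries.single 1 1) ^ a ∧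
    HahnSeries.ofPowerSeries ℤ ℂ (rescale (-1) (PowerSeries.binomialSeries ℂ (a : ℂ))) =
      (1 - HahnSeries.single 1 1) ^ a := by
  have hnat (d : ℕ) :
      HahnSeries.ofPowerSeries ℤ ℂ (PowerSeries.binomialSeries ℂ (d : ℂ)) = (1 + HahnSeries.single 1 1) ^ d ∧
      HahnSeries.ofPowerSeries ℤ ℂ (rescale (-1) (PowerSeries.binomialSeries ℂ (d : ℂ))) =
      (1 - HahnSeries.single 1 1) ^ d := by
    rw [binomialSeries_nat]
    constructor
    · rw [map_pow, map_add, map_one, HahnSeries.ofPowerSeries_X]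
    · rw [map_pow, map_pow, map_add, map_add, map_one, map_one, rescale_neg_one_X, map_neg,
        HahnSeries.ofPowerSeries_X, sub_eq_add_neg]
  obtain ⟨d, rfl | rfl⟩ := a.eq_nat_or_neg
  · simpa using hnat d
  · have h : PowerSeries.binomialSeries ℂ (((-d : ℤ) : ℂ)) * PowerSeries.binomialSeries ℂ (d : ℂ) = 1 := by
      rw [← binomialSeries_add]; simp
    rw [zpow_neg, zpow_neg, zpow_natCast, zpow_natCast, ← (hnat d).1, ← (hnat d).2]
    constructor
    · refine eq_inv_of_mul_eq_one_left ?_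
      rw [← map_mul, h, map_one]
    · refine eq_inv_of_mul_eq_one_left ?_
      rw [← map_mul, ← map_mul, h, map_one, map_one]

-- Convolve the coefficients of `(1-t)^a` and `(1+t)^(-a)`. The sign `(-1)^k` is taken out so that
-- the remaining sum is literally that of `wform_chi`.
open PowerSeries in
theorem opeCoeff_eq (a : ℤ) (k : ℕ) : opeCoeff a k = (-1) ^ k * ∑ b ∈ Finset.range (k + 1),
      Ring.choose (a : ℂ) b * ((-1) ^ (k - b) * Ring.choose (-(a : ℂ)) (k - b)) := by
  have h : (((1 - HahnSeries.single 1 1) / (1 + HahnSeries.single 1 1)) ^ a : LaurentSeries ℂ) =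
      HahnSeries.ofPowerSeries ℤ ℂ
        (rescale (-1) (PowerSeries.binomialSeries ℂ (a : ℂ)) * PowerSeries.binomialSeries ℂ (-(a : ℂ))) := by
    have h1 := (ofPowerSeries_binomialSeries a).2
    have h2 := (ofPowerSeries_binomialSeries (-a)).1
    push_cast at h2
    rw [map_mul, h1, h2, div_zpow, zpow_neg, div_eq_mul_inv]
  rw [opeCoeff, h, HahnSeries.ofPowerSeries_apply_coeff, coeff_mul,
    Finset.Nat.sum_antidiagonal_eq_sum_range_succ (fun i j =>
      coeff i (rescale (-1) (PowerSeries.binomialSeries ℂ (a : ℂ))) * coeff j (PowerSeries.binomialSeries ℂ (-(a : ℂ)))),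
    Finset.mul_sum]
  refine Finset.sum_congr rfl fun b hb => ?_
  have hb' : b ≤ k := Nat.lt_succ_iff.1 (Finset.mem_range.1 hb)
  obtain ⟨c, rfl⟩ := Nat.exists_eq_add_of_le hb'
  rw [coeff_rescale, binomialSeries_coeff, binomialSeries_coeff, Nat.add_sub_cancel_left, smul_eq_mul,
    smul_eq_mul, mul_one, mul_one, pow_add]
  have h3 : ((-1 : ℂ) ^ c) * (-1) ^ c = 1 := by rw [← mul_pow]; simp
  linear_combination -((-1) ^ b * Ring.choose (a : ℂ) b * Ring.choose (-(a : ℂ)) c) * h3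

/-- This is where the argument `-z` of `H_-` matters: its sign turns `((1+t)/(1-t))^a` into
`((1-t)/(1+t))^a`. -/
theorem neg_one_pow_mul_wform_chi [Fintype Γ] (ξ α β : RZ Γ) (k : ℕ) :
    (-1) ^ k * wform ξ.1 (chi k α.1).1 (chi k β.1).1 = opeCoeff (formZ ξ α β) k := by
  rw [opeCoeff_eq, wform_chi, ← formZ_spec]

end Expansion

/-! ### Products of vertex operators -/

section VertexProduct

variable [Fintype Γ]

theorem HplusCoeff_of_neg (γ : ClassFun Γ) {i : ℤ} (hi : i < 0) : HplusCoeff γ i = 0 :=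
  if_neg (not_le.2 hi)

/-- The commutation relation of `H_-(α, -z)` and `H_+(β, w)`, coefficientwise. -/
theorem HminusCoeff_HplusCoeff (ξ α β : RZ Γ) (j : ℕ) (i : ℤ) (F : Fock Γ) :
    HminusCoeff ξ.1 α.1 j (HplusCoeff β.1 i F) = ∑ k ∈ Finset.range (j + 1),
      opeCoeff (formZ ξ α β) k •
        HplusCoeff β.1 (i - k) (HminusCoeff ξ.1 α.1 (j - k) F) := by
  by_cases hi : 0 ≤ i
  · obtain ⟨n, rfl⟩ := Int.eq_ofNat_of_zero_le hi
    have h1 : HplusCoeff β.1 (n : ℤ) = Hcr n β.1 := by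
      rw [HplusCoeff, if_pos hi, Int.toNat_natCast]
    rw [h1, HminusCoeff, LinearMap.smul_apply, Han_Hcr, Finset.smul_sum]
    refine Finset.sum_congr rfl fun k hk => ?_
    have hk' : k ≤ j := Nat.lt_succ_iff.1 (Finset.mem_range.1 hk)
    split_ifs with hkn
    · have h2 : HplusCoeff β.1 ((n : ℤ) - k) = Hcr (n - k) β.1 := by
        rw [HplusCoeff, if_pos (by omega)]
        congr 1
        omega
      rw [h2, HminusCoeff, LinearMap.smul_apply, map_smul, smul_smul, smul_smul,
        ← neg_one_pow_mul_wform_chi]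
      congr 1
      -- The sign `(-1)^j` is shared out: `(-1)^k` goes into `opeCoeff` and `(-1)^(j-k)` stays with
      -- the remaining annihilator.
      obtain ⟨l, rfl⟩ := Nat.exists_eq_add_of_le hk'
      have h3 : ((-1 : ℂ) ^ k) * (-1) ^ k = 1 := by rw [← mul_pow]; simp
      rw [Nat.add_sub_cancel_left, pow_add]
      ring
    -- For `k > n` the creation index is negative; the convention that such coefficients are zero
    -- matches the case distinction in `Han_Hcr`.
    · rw [HplusCoeff_of_neg _ (by omega), LinearMap.zero_apply, smul_zero, smul_zero]
  · rw [HplusCoeff_of_neg _ (not_le.1 hi), LinearMap.zero_apply, map_zero]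
    refine (Finset.sum_eq_zero fun k _ => ?_).symm
    rw [HplusCoeff_of_neg _ (by omega), LinearMap.zero_apply, smul_zero]

/-- The bound `d` is left free, so that both sides of the product formula can be written over
matching finite ranges. -/
theorem XFock_apply (ξ γ : ClassFun Γ) (n : ℤ) (F : Fock Γ) {d : ℕ}
    (hd : ∀ j, d ≤ j → HminusCoeff ξ γ j F = 0) :
    XFock ξ γ n F = ∑ j ∈ Finset.range d, HplusCoeff γ (j - n) (HminusCoeff ξ γ j F) := by
  refine finsum_eq_sum_of_support_subset _ fun j hj => ?_
  rw [Finset.coe_range, Set.mem_Iio]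
  by_contra h
  refine hj ?_
  change HplusCoeff γ (j - n) (HminusCoeff ξ γ j F) = 0
  rw [hd j (not_lt.1 h), map_zero]

theorem normalFock_apply (ξ α β : ClassFun Γ) (p q : ℤ) (F : Fock Γ) {d e : ℕ}
    (hd : ∀ l, d ≤ l → HminusCoeff ξ β l F = 0)
    (he : ∀ j, e ≤ j → ∀ l, HminusCoeff ξ α j (HminusCoeff ξ β l F) = 0) :
    normalFock ξ α β p q F = ∑ l ∈ Finset.range d, ∑ j ∈ Finset.range e,
      HplusCoeff α (j - p) (HplusCoeff β (l - q)
        (HminusCoeff ξ α j (HminusCoeff ξ β l F))) := by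
  rw [Finset.sum_comm, ← Finset.sum_product' (f := fun (j l : ℕ) => HplusCoeff α (j - p)
    (HplusCoeff β (l - q) (HminusCoeff ξ α j (HminusCoeff ξ β l F))))]
  refine finsum_eq_sum_of_support_subset _ fun j hj => ?_
  rw [Finset.coe_product, Set.mem_prod, Finset.coe_range, Finset.coe_range, Set.mem_Iio, Set.mem_Iio]
  by_contra h
  refine hj ?_
  change HplusCoeff α (j.1 - p) (HplusCoeff β (j.2 - q)
    (HminusCoeff ξ α j.1 (HminusCoeff ξ β j.2 F))) = 0
  by_cases h1 : j.1 < e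
  · rw [hd _ (not_lt.1 fun h2 => h ⟨h1, h2⟩), map_zero, map_zero, map_zero]
  · rw [he _ (not_lt.1 h1), map_zero, map_zero]

/-- Sums along antidiagonals against sums over a rectangle: all of `f` lives in the `K × E`
rectangle, whose antidiagonals have index below `K + E`. -/
theorem sum_range_antidiagonal {A : Type*} [AddCommMonoid A] (f : ℕ → ℕ → A) (K E : ℕ)
    (hK : ∀ k, K ≤ k → ∀ j, f k j = 0) (hE : ∀ j, E ≤ j → ∀ k, f k j = 0) :
    ∑ j ∈ Finset.range (K + E), ∑ k ∈ Finset.range (j + 1), f k (j - k) =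
      ∑ k ∈ Finset.range K, ∑ j ∈ Finset.range E, f k j := by
  rw [← Finset.sum_product' (f := f), ← Finset.sum_fiberwise_of_maps_to
    (t := Finset.range (K + E)) (g := fun p : ℕ × ℕ => p.1 + p.2)]
  · refine Finset.sum_congr rfl fun j _ => ?_
    rw [← Finset.Nat.sum_antidiagonal_eq_sum_range_succ f]
    refine (Finset.sum_subset ?_ ?_).symm
    · intro p hp
      exact Finset.HasAntidiagonal.mem_antidiagonal.2 (Finset.mem_filter.1 hp).2
    · intro p hp hp'
      rw [Finset.HasAntidiagonal.mem_antidiagonal] at hp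
      rw [Finset.mem_filter, Finset.mem_product, Finset.mem_range, Finset.mem_range] at hp'
      by_cases h1 : p.1 < K
      · exact hE _ (not_lt.1 fun h2 => hp' ⟨⟨h1, h2⟩, hp⟩) _
      · exact hK _ (not_lt.1 h1) _
  · intro p hp
    rw [Finset.mem_product, Finset.mem_range, Finset.mem_range] at hp
    rw [Finset.mem_range]
    omega

/-- The product of the Fock space parts of two vertex operators. -/
theorem XFock_XFock (ξ α β : RZ Γ) (p q : ℤ) (F : Fock Γ) : ∃ K : ℕ, ∀ K', K ≤ K' →
    normalFock ξ.1 α.1 β.1 (p - K') (q + K') F = 0 ∧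
    XFock ξ.1 α.1 p (XFock ξ.1 β.1 q F) = ∑ k ∈ Finset.range K',
      opeCoeff (formZ ξ α β) k • normalFock ξ.1 α.1 β.1 (p - k) (q + k) F := by
  obtain ⟨d, hd'⟩ := HminusCoeff_eq_zero ξ.1 F
  have hd : ∀ l, d ≤ l → HminusCoeff ξ.1 β.1 l F = 0 := fun l hl => hd' l hl β.1
  choose e' he' using fun l => HminusCoeff_eq_zero ξ.1 (HminusCoeff ξ.1 β.1 l F)
  set e := (Finset.range d).sup e' with he_def
  have he : ∀ j, e ≤ j → ∀ l, HminusCoeff ξ.1 α.1 j (HminusCoeff ξ.1 β.1 l F) = 0 := by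
    intro j hj l
    by_cases hl : l < d
    · exact he' l j ((Finset.le_sup (Finset.mem_range.2 hl)).trans hj) α.1
    · rw [hd l (not_lt.1 hl), map_zero]
  -- For `l < d` and `k ≥ d + |q|` the creation index `l - q - k` is negative, so no such `k`
  -- contributes.
  refine ⟨d + q.natAbs, fun K hK => ?_⟩
  have hplus (k l : ℕ) (hk : K ≤ k) (hl : l < d) : HplusCoeff β.1 ((l : ℤ) - q - k) = 0 :=
    HplusCoeff_of_neg _ (by omega)
  constructor
  · rw [normalFock_apply ξ.1 α.1 β.1 _ _ F hd he]
    refine Finset.sum_eq_zero fun l hl => Finset.sum_eq_zero fun j _ => ?_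
    rw [← sub_sub, hplus K l le_rfl (Finset.mem_range.1 hl), LinearMap.zero_apply, map_zero]
  · rw [XFock_apply ξ.1 β.1 q F hd, map_sum]
    simp only [normalFock_apply ξ.1 α.1 β.1 _ _ F hd he, Finset.smul_sum]
    rw [Finset.sum_comm]
    refine Finset.sum_congr rfl fun l hl => ?_
    have hl' := Finset.mem_range.1 hl
    have hcomm (j : ℕ) := HminusCoeff_HplusCoeff ξ α β j ((l : ℤ) - q) (HminusCoeff ξ.1 β.1 l F)
    -- For an annihilation index `j ≥ K + e`, each term of the commutation relation has `k ≥ K`,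
    -- where creation vanishes, or `j - k ≥ e`, where annihilation does.
    rw [XFock_apply ξ.1 α.1 p _ (d := K + e)]
    · simp only [hcomm, map_sum, map_smul]
      -- Here `j` is the annihilation index that survives the exchange; the original index was `j +
      -- k`, which shifts `p` to `p - k` in the coefficient of `H_+(α, z)`.
      have h := sum_range_antidiagonal (fun k j => opeCoeff (formZ ξ α β) k •
        HplusCoeff α.1 (((j + k : ℕ) : ℤ) - p) (HplusCoeff β.1 ((l : ℤ) - q - k)
          (HminusCoeff ξ.1 α.1 j (HminusCoeff ξ.1 β.1 l F)))) K e ?_ ?_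
      · refine Eq.trans ?_ (h.trans ?_)
        · refine Finset.sum_congr rfl fun j _ => Finset.sum_congr rfl fun k hk => ?_
          rw [Nat.sub_add_cancel (Nat.lt_succ_iff.1 (Finset.mem_range.1 hk))]
        · refine Finset.sum_congr rfl fun k _ => Finset.sum_congr rfl fun j _ => ?_
          have h1 : ((j + k : ℕ) : ℤ) - p = (j : ℤ) - (p - k) := by push_cast; ring
          rw [h1, sub_sub]
      · intro k hk j
        rw [hplus k l hk hl', LinearMap.zero_apply, map_zero, smul_zero]
      · intro j hj k
        rw [he j hj, map_zero, map_zero, smul_zero]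
    · intro j hj
      rw [hcomm]
      refine Finset.sum_eq_zero fun k _ => ?_
      by_cases hk : K ≤ k
      · rw [hplus k l hk hl', LinearMap.zero_apply, smul_zero]
      · rw [he (j - k) (by omega), map_zero, smul_zero]

/-! ### The lattice factor and the full vertex operators -/

namespace LatticeModule

variable {ξ : RZ Γ} {E : Type*} [Group E] (M : LatticeModule ξ E)

/-- The group elements `e_α e_β` and `e_{α+β}` have the same image in the quotient, so they differ
by a central sign, which acts as a scalar. Applied to `e^{[0]}`, where `act_e_zero` leaves no sign,
the relation identifies that scalar with `eps α β`. -/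
theorem act_e_mul_act_e (α β : RZ Γ) (v : (RZ Γ ⧸ M.Φ) →₀ ℂ) :
    M.act (M.e (α : RZ Γ ⧸ twoRZ Γ)) (M.act (M.e (β : RZ Γ ⧸ twoRZ Γ)) v) =
      M.eps α β • M.act (M.e ((α : RZ Γ ⧸ twoRZ Γ) + (β : RZ Γ ⧸ twoRZ Γ))) v := by
  set a := M.e (α : RZ Γ ⧸ twoRZ Γ)
  set b := M.e (β : RZ Γ ⧸ twoRZ Γ)
  set c := M.e ((α : RZ Γ ⧸ twoRZ Γ) + (β : RZ Γ ⧸ twoRZ Γ)) with hc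
  have h1 : a * b * c⁻¹ ∈ M.ext.rightHom.ker := by
    rw [MonoidHom.mem_ker, map_mul, map_mul, map_inv, M.rightHom_e, M.rightHom_e, M.rightHom_e,
      ofAdd_add, mul_inv_cancel]
  rw [← M.ext.range_inl_eq_ker_rightHom] at h1
  obtain ⟨s, hs⟩ := h1
  have h2 (w : (RZ Γ ⧸ M.Φ) →₀ ℂ) : M.act a (M.act b w) = ((s : ℤ) : ℂ) • M.act c w := by
    rw [← Module.End.mul_apply, ← map_mul, show a * b = M.ext.inl s * c by rw [hs]; group, map_mul,
      Module.End.mul_apply]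
    rcases Int.units_eq_one_or s with rfl | rfl
    · simp
    · rw [M.act_neg_one]; simp
  rw [h2 v]
  congr 1
  have h3 := congrArg (fun f : (RZ Γ ⧸ M.Φ) →₀ ℂ => f ((α + β : RZ Γ) : RZ Γ ⧸ M.Φ))
    (h2 (Finsupp.single (0 : RZ Γ ⧸ M.Φ) 1))
  have h4 : M.act c (Finsupp.single (0 : RZ Γ ⧸ M.Φ) 1) =
      Finsupp.single ((α + β : RZ Γ) : RZ Γ ⧸ M.Φ) 1 := M.act_e_zero (α + β)
  rw [M.act_e_zero β, h4] at h3
  rw [LatticeModule.eps, h3]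
  simp

/-- The product of two vertex operators, applied to a vector. -/
theorem X_mul_X_apply (α β : RZ Γ) (p q : ℤ) (v : M.Space) : ∃ K : ℕ, ∀ K', K ≤ K' →
    M.normalX α β (p - K') (q + K') v = 0 ∧
    M.X α p (M.X β q v) = M.eps α β • ∑ k ∈ Finset.range K',
      opeCoeff (formZ ξ α β) k • M.normalX α β (p - k) (q + k) v := by
  induction v using TensorProduct.induction_on with
  | zero => exact ⟨0, fun K _ => by simp⟩
  | add v w hv hw =>
    obtain ⟨K, hK⟩ := hv
    obtain ⟨L, hL⟩ := hw
    -- The claim is stated for all large cutoffs precisely so that two vectors can share one.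
    refine ⟨max K L, fun N hN => ?_⟩
    obtain ⟨h1, h2⟩ := hK N ((le_max_left _ _).trans hN)
    obtain ⟨h3, h4⟩ := hL N ((le_max_right _ _).trans hN)
    refine ⟨by rw [map_add, h1, h3, add_zero], ?_⟩
    simp only [map_add, smul_add, Finset.sum_add_distrib, h2, h4]
  | tmul F w =>
    obtain ⟨K, hK⟩ := XFock_XFock ξ α β p q F
    refine ⟨K, fun N hN => ?_⟩
    obtain ⟨h1, h2⟩ := hK N hN
    constructor
    · rw [normalX, TensorProduct.map_tmul, h1, TensorProduct.zero_tmul]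
    · rw [X, X, TensorProduct.map_tmul, TensorProduct.map_tmul, h2, act_e_mul_act_e,
        TensorProduct.tmul_smul, TensorProduct.sum_tmul]
      congr 1

end LatticeModule

end VertexProduct

end SpinWreath

end

/-! ### The operator identity -/

theorem mainTheorem11 {Γ : Type*} [Group Γ] [Fintype Γ] (ξ : RZ Γ)
    (hξ : ∀ x, (ξ : Γ → ℂ) x⁻¹ = (ξ : Γ → ℂ) x)
    {E : Type*} [Group E] (M : LatticeModule ξ E) (α β : RZ Γ) (p q : ℤ) :
    ∃ h : LocFin fun k : ℕ => opeCoeff (formZ ξ α β) k • M.normalX α β (p - k) (q + k),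
      M.X α p * M.X β q =
        M.eps α β • locSum
          (fun k : ℕ => opeCoeff (formZ ξ α β) k • M.normalX α β (p - k) (q + k)) h := by
  -- The cutoff for a vector yields both local finiteness and the value of the locally finite sum as
  -- a finite one.
  have hsupp (v : M.Space) (K : ℕ) (hK : ∀ K', K ≤ K' →
      M.normalX α β (p - K') (q + K') v = 0) :
      (Function.support fun k : ℕ =>
        (opeCoeff (formZ ξ α β) k • M.normalX α β (p - k) (q + k)) v) ⊆ Finset.range K := by
    intro k hk
    rw [Finset.coe_range, Set.mem_Iio]
    by_contra h
    refine hk ?_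
    change opeCoeff (formZ ξ α β) k • M.normalX α β (p - k) (q + k) v = 0
    rw [hK k (not_lt.1 h), smul_zero]
  refine ⟨fun v => ?_, LinearMap.ext fun v => ?_⟩
  · obtain ⟨K, hK⟩ := M.X_mul_X_apply α β p q v
    exact (Finset.finite_toSet _).subset (hsupp v K fun K' h => (hK K' h).1)
  · obtain ⟨K, hK⟩ := M.X_mul_X_apply α β p q v
    refine (hK K le_rfl).2.trans ?_
    change _ = M.eps α β • ∑ᶠ k : ℕ, (opeCoeff (formZ ξ α β) k • M.normalX α β (p - k) (q + k)) v
    rw [finsum_eq_sum_of_support_subset _ (hsupp v K fun K' h => (hK K' h).1)]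
    rfl
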